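/- Let $\gamma\in(1,\tfrac43)$. Put $$G(y;\rho,\omega)=\gamma\rho^{\gamma-1}-y^2\omega^2,\qquad h(\rho,\omega)=2\omega^2+(\gamma-1)\omega-\tfrac{4\pi\rho\omega}{4-3\gamma}+(\gamma-1)(2-\gamma),$$ and consider the self-similar Euler--Poisson system $$\rho'=\frac{y\rho h(\rho,\omega)}{G(y;\rho,\omega)},\qquad \omega'=\frac{4-3\gamma-3\omega}{y}-\frac{y\omega h(\rho,\omega)}{G(y;\rho,\omega)}.\tag{1}$$ Let $\omega_F=\frac{4-3\gamma}{3}$, $y_F=\frac{3}{4-3\gamma}\sqrt{\gamma(6\pi)^{-(\gamma-1)}}$ and $y_f=\frac{\sqrt\gamma}{2-\gamma}\big(\frac{4-3\gamma}{2\pi}\big)^{\frac{\gamma-1}{2}}$. For $y_*\in[y_f,y_F]$ let $(\rho(\cdot;y_*),\omega(\cdot;y_*))$ be the solution of (1) of Larson--Penston--Hunter (LPH) type with sonic point $y_*$: it is real analytic near $y_*$ and solves (1), multiplied by $G$, there; its values $\rho_0>0$, $\omega_0$ at $y_*$ satisfy $G(y_*;\rho_0,\omega_0)=0$ and $h(\rho_0,\omega_0)=0$;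 and its derivatives at $y_*$ are $\rho'(y_*)=\rho_0R_1/y_*$, $\omega'(y_*)=W_1/y_*$, where $$R_1=\frac{(9-7\gamma)\omega_0^2-8\omega_0^3-\sqrt{\omega_0^3\,s(\omega_0)}}{2\omega_0^3(\gamma+1)},\qquad W_1=4-3\gamma-3\omega_0-\omega_0R_1,$$ $$s(\omega_0)=-4(4-3\gamma)(\gamma+1)(\gamma-1)(2-\gamma)+(57-114\gamma+73\gamma^2-12\gamma^3)\omega_0-8(3\gamma^2-15\gamma+14)\omega_0^2+8(5-3\gamma)\omega_0^3.$$ Let the sonic time $s(y_*)$ be the infimum of all $a\in(0,y_*)$ such that this solution extends as a solution of (1) with $G>0$ to $(a,y_*)$; the solution is taken on its maximal interval $(s(y_*),y_*]$. Let $$y_c(y_*)=\inf\{y\in(s(y_*),y_*)\,:\,\omega(\tilde y;y_*)>\omega_F\text{ for all }\tilde y\in(y,y_*)\},$$ $$Y=\{y_*\in[y_f,y_F)\,:\,\text{for all }\tilde y_*\in[y_*,y_F)\text{ there is }y\in(s(\tilde y_*),\tilde y_*)\text{ with }\omega(y;\tilde y_*)=\omega_F\},$$ $$\mathcal S=\{y_*\in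 Y\,:\,\omega'(y;\tilde y_*)>0\text{ for all }\tilde y_*\in[y_*,y_F)\text{ and }y\in[y_c(\tilde y_*),\tilde y_*]\},\qquad \bar y_*=\inf Y.$$ Then the following hold. 1. $Y$ is the non-empty open interval $(\bar y_*,y_F)$. 2. For every $y_*\in Y$ the LPH-type solution exists on $(s(y_*),y_*]$, $s(y_*)<y_c(y_*)<y_*$, and $\omega'(y;y_*)>0$ for all $y\in[y_c(y_*),y_*]$; in particular $\omega(\cdot;y_*)$ is strictly increasing on $[y_c(y_*),y_*]$. Consequently $\mathcal S=Y$. 3. For every $\nu>0$ there is $\eta>0$ (depending only on $\gamma$ and $\nu$) such that for all $y_*\in Y$ $$G\big(y;\rho(y;y_*),\omega(y;y_*)\big)\ge\eta\quad\text{for all }y\in[y_c(y_*),y_*-\nu].$$ 4. If $y_*\in[y_f,y_F]$ and $y_0\in(s(y_*),y_*)$ are such that $\omega(y_0;y_*)\in(\omega_F,2-\gamma)$ and $\omega'(y_0;y_*)=\omega''(y_0;y_*)=0$, then $\omega'''(y_0;y_*)<0$. -/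

import Mathlib

open Set Filter Topology

noncomputable section

namespace EulerPoisson

/-- The sonic function `G(y; ρ, ω) = γ ρ^(γ-1) - y² ω²`. -/
def G (γ y ρ ω : ℝ) : ℝ := γ * ρ ^ (γ - 1) - y ^ 2 * ω ^ 2

/-- The function `h(ρ, ω)` in the right-hand side of the self-similar Euler-Poisson system. -/
def h (γ ρ ω : ℝ) : ℝ :=
  2 * ω ^ 2 + (γ - 1) * ω - 4 * Real.pi * ρ * ω / (4 - 3 * γ) + (γ - 1) * (2 - γ)

/-- The (constant) value of the relative velocity of the Friedman solution. -/
def omegaF (γ : ℝ) : ℝ := (4 - 3 * γ) / 3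

/-- The sonic point of the Friedman solution. -/
def yF (γ : ℝ) : ℝ := 3 / (4 - 3 * γ) * Real.sqrt (γ / (6 * Real.pi) ^ (γ - 1))

/-- The sonic point of the far-field solution. -/
def yf (γ : ℝ) : ℝ :=
  Real.sqrt γ / (2 - γ) * ((4 - 3 * γ) / (2 * Real.pi)) ^ ((γ - 1) / 2)

/-- The polynomial `s(ω₀)` occurring in the discriminant of the quadratic equation for
`R = y_* ρ₁ / ρ₀`, where `ρ₁` is the first Taylor coefficient of the density at a sonic point. -/
def discr (γ ω₀ : ℝ) : ℝ :=
  -4 * (4 - 3 * γ) * (γ + 1) * (γ - 1) * (2 - γ)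
    + (57 - 114 * γ + 73 * γ ^ 2 - 12 * γ ^ 3) * ω₀
    - 8 * (3 * γ ^ 2 - 15 * γ + 14) * ω₀ ^ 2
    + 8 * (5 - 3 * γ) * ω₀ ^ 3

/-- The Larson-Penston-Hunter branch (the smaller root) `R₁` for `y_* ρ₁ / ρ₀`. -/
def R₁ (γ ω₀ : ℝ) : ℝ :=
  ((9 - 7 * γ) * ω₀ ^ 2 - 8 * ω₀ ^ 3 - Real.sqrt (ω₀ ^ 3 * discr γ ω₀))
    / (2 * ω₀ ^ 3 * (γ + 1))

/-- The corresponding value `W₁` of `y_* ω₁`. -/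
def W₁ (γ ω₀ : ℝ) : ℝ := 4 - 3 * γ - 3 * ω₀ - ω₀ * R₁ γ ω₀

/-- `(ρ, ω)` is an LPH-type solution with sonic point `ys`, extended as a strictly subsonic
solution of the self-similar Euler-Poisson system to `(a, ys]`.
Near `ys` the functions are given by convergent power series whose coefficients of order zero
satisfy the sonic conditions `G = h = 0`, whose coefficients of order one are those of the LPH
branch, and which satisfy the system (multiplied by `G`, so that it makes sense at the sonic
point itself); comparing coefficients, the latter is the recursive relation which determines
the Taylor coefficients of order at least two. -/
structure IsLPHSolutionOn (γ ys a : ℝ) (ρ ω : ℝ → ℝ) : Prop where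
  analyticAt_rho : AnalyticAt ℝ ρ ys
  analyticAt_omega : AnalyticAt ℝ ω ys
  rho_pos : 0 < ρ ys
  sonic : G γ ys (ρ ys) (ω ys) = 0
  h_eq_zero : h γ (ρ ys) (ω ys) = 0
  rho_one : deriv ρ ys = ρ ys * R₁ γ (ω ys) / ys
  omega_one : deriv ω ys = W₁ γ (ω ys) / ys
  eq_rho_near : ∀ᶠ y in 𝓝 ys,
    G γ y (ρ y) (ω y) * deriv ρ y = y * ρ y * h γ (ρ y) (ω y)
  eq_omega_near : ∀ᶠ y in 𝓝 ys,
    G γ y (ρ y) (ω y) * deriv ω y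
      = (4 - 3 * γ - 3 * ω y) / y * G γ y (ρ y) (ω y) - y * ω y * h γ (ρ y) (ω y)
  subsonic : ∀ y ∈ Ioo a ys, 0 < G γ y (ρ y) (ω y)
  eq_rho : ∀ y ∈ Ioo a ys,
    HasDerivAt ρ (y * ρ y * h γ (ρ y) (ω y) / G γ y (ρ y) (ω y)) y
  eq_omega : ∀ y ∈ Ioo a ys,
    HasDerivAt ω
      ((4 - 3 * γ - 3 * ω y) / y - y * ω y * h γ (ρ y) (ω y) / G γ y (ρ y) (ω y)) y

/-- The sonic time `s(y_*)`: the infimum of all `a ∈ (0, y_*)` such that the LPH-type solution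
extends to `(a, y_*]` and is strictly subsonic on `(a, y_*)`. -/
def sonicTime (γ ys : ℝ) : ℝ :=
  sInf {a | a ∈ Ioo 0 ys ∧ ∃ ρ ω : ℝ → ℝ, IsLPHSolutionOn γ ys a ρ ω}

open Classical in
/-- The LPH-type solution `(ρ(·; y_*), ω(·; y_*))`, extended to the maximal interval
`(s(y_*), y_*]`. Its values outside of this interval and of a neighbourhood of `y_*` carry no
information, and `(0, 0)` is a dummy value for parameters without such a solution. -/
def lphSolution (γ ys : ℝ) : (ℝ → ℝ) × (ℝ → ℝ) :=
  if H : ∃ p : (ℝ → ℝ) × (ℝ → ℝ), IsLPHSolutionOn γ ys (sonicTime γ ys) p.1 p.2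
  then H.choose else (0, 0)

/-- The density `ρ(·; y_*)`. -/
def rho (γ ys : ℝ) : ℝ → ℝ := (lphSolution γ ys).1

/-- The relative velocity `ω(·; y_*)`. -/
def omega (γ ys : ℝ) : ℝ → ℝ := (lphSolution γ ys).2

/-- The critical time `y_c(y_*)`. -/
def criticalTime (γ ys : ℝ) : ℝ :=
  sInf {y | y ∈ Ioo (sonicTime γ ys) ys ∧ ∀ z ∈ Ioo y ys, omegaF γ < omega γ ys z}

/-- The fundamental set `Y`. -/
def Y (γ : ℝ) : Set ℝ :=
  {ys | ys ∈ Ico (yf γ) (yF γ) ∧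
    ∀ t ∈ Ico ys (yF γ), ∃ y ∈ Ioo (sonicTime γ t) t, omega γ t y = omegaF γ}

/-- The set `𝒮` of those `y_* ∈ Y` for which the relative velocity is strictly monotone to the
right of the critical time, for all parameters between `y_*` and `y_F`. -/
def S (γ : ℝ) : Set ℝ :=
  {ys | ys ∈ Y γ ∧ ∀ t ∈ Ico ys (yF γ), ∀ y ∈ Icc (criticalTime γ t) t, 0 < deriv (omega γ t) y}

end EulerPoisson

end

/-! The core is a continuity method in the sonic point `y_*`, run downwards from `y_F` on the
property `CrossesMonotonically`: going left from the sonic point, `ω` descends with `ω' > 0` to a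
value strictly below `ω_F`. It rests on a local theory at the sonic point, on continuous dependence
on `y_*`, and on a sign computation at degenerate critical points of `ω`.

The system is singular at the sonic point, where `G = h = 0`. Put `x = log (y / y_*)` and let `k` be
the derivative of `log ρ` in `x`. Both `G` and `h` are integrals of their own derivatives from `0`
to `x`, hence `x` times an average. Rescaling to `F z = k (ε z)` on `[0, 1]` and dividing by `ε z`
produces an equation `sonicEq` that is analytic on `C([0, 1])` and is solved at `ε = 0` by the
constant `R₁`. Its linearization there is `a • id + b • avg` with `a < 0` and `a + b < 0`, which has
an explicit inverse (`isInvertible_add_smul_avg`). The implicit function theorem then yields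
existence and analytic dependence on `ω₀` (`exists_isLogLPH_family`) and uniqueness
(`IsLogLPH.eventually_eq`). Away from the sonic point ordinary ODE stability takes over, and the two
combine in `continuous_dependence`.

The continuity method starts at `y_F`, where the chosen branch leaves the Friedman value with `ω' >
0` (`crossesMonotonically_yF`). The property is open in `y_*`. It also passes to a limit from the
right at which `ω_F` is attained (`crossesMonotonically_of_right`). In the limit `ω' ≥ 0` up to the
last crossing of `ω_F`, and equality is excluded in three ways. At the sonic point `W₁ > 0`. In the
interior, a zero of `ω'` would be a minimum of `ω'`, so also `ω'' = 0`, and there `ω''' < 0`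
(`degenerate_sign`), which is incompatible with a minimum. At the crossing, `ω' = 0` would make the
solution coincide with the Friedman one (`omega_eq_omegaF`). Hence every member of `Y` crosses
monotonically, so `𝒮 = Y`. Openness of the crossing property, together with the fact that the
solution at `y_f` is the far-field one and never reaches `ω_F`, makes `Y` an open interval ending at
`y_F`.

For the lower bound on `G`: where `ω ≥ ω_F` and `ω' > 0` the second equation forces `h ≤ 0`, so `ρ`
is nonincreasing and `G + ω_F² y²` is nonincreasing (`le_G`). -/

noncomputable section

namespace EulerPoisson

section

open MeasureTheory unitInterval ContDiff

/-! ### Weighted averages on the space of continuous functions on the unit interval -/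

/-- The function `z ↦ f (s z)` on the unit interval, for `s ∈ [0, 1]` (and `s` is projected to
`[0, 1]` otherwise). -/
def dilate (f : C(I, ℝ)) (s : ℝ) : C(I, ℝ) :=
  f.comp ⟨fun z => projIcc 0 1 zero_le_one s * z, by fun_prop⟩

lemma dilate_apply (f : C(I, ℝ)) {s : ℝ} (hs : s ∈ Icc (0 : ℝ) 1) (z : I) :
    dilate f s z = f (⟨s, hs⟩ * z) := by
  simp [dilate, projIcc_of_mem zero_le_one hs]

lemma continuous_dilate (f : C(I, ℝ)) : Continuous (dilate f) := by
  apply ContinuousMap.continuous_of_continuous_uncurry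
  change Continuous fun p : ℝ × I => f (projIcc 0 1 zero_le_one p.1 * p.2)
  have : Continuous fun p : ℝ × I => projIcc (0 : ℝ) 1 zero_le_one p.1 :=
    continuous_projIcc.comp continuous_fst
  fun_prop

lemma norm_dilate_le (f : C(I, ℝ)) (s : ℝ) : ‖dilate f s‖ ≤ ‖f‖ :=
  (ContinuousMap.norm_le _ (norm_nonneg _)).2 fun _ => f.norm_coe_le_norm _

lemma intervalIntegrable_rpow_smul_dilate {θ : ℝ} (hθ : -1 < θ) (f : C(I, ℝ)) :
    IntervalIntegrable (fun s : ℝ => s ^ θ • dilate f s) volume 0 1 :=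
  (intervalIntegral.intervalIntegrable_rpow' hθ).smul_continuousOn
    (continuous_dilate f).continuousOn

/-- The operator `f ↦ ∫₀¹ s^θ f(s z) ds` on continuous functions on the unit interval. -/
def wavg (θ : ℝ) (hθ : -1 < θ) : C(I, ℝ) →L[ℝ] C(I, ℝ) :=
  LinearMap.mkContinuous
    { toFun := fun f => ∫ s in (0 : ℝ)..1, s ^ θ • dilate f s
      map_add' := fun f g => by
        rw [← intervalIntegral.integral_add (intervalIntegrable_rpow_smul_dilate hθ f)
          (intervalIntegrable_rpow_smul_dilate hθ g)]
        congr 1; ext s z; simp [dilate]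
      map_smul' := fun a f => by
        rw [RingHom.id_apply, ← intervalIntegral.integral_smul]
        congr 1; ext s z; simp [dilate]; ring }
    (∫ s in (0 : ℝ)..1, s ^ θ) (fun f => by
      rw [← intervalIntegral.integral_mul_const]
      refine intervalIntegral.norm_integral_le_of_norm_le zero_le_one ?_
        ((intervalIntegral.intervalIntegrable_rpow' hθ).mul_const _)
      refine Eventually.of_forall fun s hs => ?_
      rw [norm_smul, Real.norm_of_nonneg (Real.rpow_nonneg hs.1.le _)]
      exact mul_le_mul_of_nonneg_left (norm_dilate_le f s) (Real.rpow_nonneg hs.1.le _))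

lemma wavg_def {θ : ℝ} (hθ : -1 < θ) (f : C(I, ℝ)) :
    wavg θ hθ f = ∫ s in (0 : ℝ)..1, s ^ θ • dilate f s := rfl

/-- The inclusion of the unit interval as a continuous function. -/
def coord : C(I, ℝ) := ⟨fun z => z, continuous_subtype_val⟩

/-- Monomials are eigenfunctions of all these averaging operators, so operator identities reduce to
identities between scalars by density of polynomials. -/
lemma wavg_coord_pow {θ : ℝ} (hθ : -1 < θ) (n : ℕ) :
    wavg θ hθ (coord ^ n) = (n + θ + 1)⁻¹ • coord ^ n := by
  have : ∀ s ∈ uIcc (0 : ℝ) 1, s ^ θ • dilate (coord ^ n) s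
      = (s ^ θ * s ^ n) • coord ^ n := by
    intro s hs
    rw [uIcc_of_le zero_le_one] at hs
    ext z
    simp [dilate_apply _ hs, coord, mul_pow, mul_assoc]
  rw [wavg_def, intervalIntegral.integral_congr this, intervalIntegral.integral_smul_const]
  congr 1
  have h2 : ∀ s ∈ uIoc (0 : ℝ) 1, s ^ θ * s ^ n = s ^ (n + θ) := by
    intro s hs
    rw [uIoc_of_le zero_le_one] at hs
    rw [add_comm, Real.rpow_add hs.1, Real.rpow_natCast]
  have hn : (0 : ℝ) ≤ n := n.cast_nonneg
  rw [intervalIntegral.integral_congr_ae (Eventually.of_forall h2),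
    integral_rpow (Or.inl (by linarith))]
  rw [Real.one_rpow, Real.zero_rpow (by linarith), sub_zero, one_div]

/-- Two continuous linear operators which agree on the powers of the coordinate are equal. -/
lemma clm_ext_coord_pow {S T : C(I, ℝ) →L[ℝ] C(I, ℝ)}
    (h : ∀ n : ℕ, S (coord ^ n) = T (coord ^ n)) : S = T := by
  have hd : Dense (polynomialFunctions I : Set C(I, ℝ)) := by
    rw [dense_iff_closure_eq, ← Subalgebra.topologicalClosure_coe,
      polynomialFunctions_closure_eq_top]
    rfl
  apply DFunLike.coe_injective
  refine S.continuous.ext_on hd T.continuous ?_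
  rintro f hf
  obtain ⟨p, -, rfl⟩ := hf
  change S (p.toContinuousMapOn I) = T (p.toContinuousMapOn I)
  have : p.toContinuousMapOn I = ∑ i ∈ p.support, p.coeff i • coord ^ i := by
    ext z
    simp [Polynomial.eval_eq_sum, Polynomial.sum_def, coord, ContinuousMap.sum_apply]
  simp [this, h]

/-- The averaging operator `f ↦ ∫₀¹ f(s z) ds`. -/
def avg : C(I, ℝ) →L[ℝ] C(I, ℝ) := wavg 0 (by norm_num)

lemma avg_apply (f : C(I, ℝ)) (z : I) : avg f z = ∫ s in (0 : ℝ)..1, dilate f s z := by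
  have h := (ContinuousMap.evalCLM ℝ z).intervalIntegral_comp_comm
    (intervalIntegrable_rpow_smul_dilate (show (-1 : ℝ) < 0 by norm_num) f)
  rw [avg, wavg_def]
  simpa using h.symm

/-- This is how the singular factor is divided out: a function vanishing at the origin is the
variable times the average of its derivative. -/
lemma avg_one_apply {f : C(I, ℝ)} {F : ℝ → ℝ} {x : ℝ} {z : I}
    (h : ∀ y : I, f y = F (x * y)) : x * z * avg f z = ∫ s in (0 : ℝ)..(x * z), F s := by
  rw [avg_apply]
  have : ∫ s in (0 : ℝ)..1, dilate f s z = ∫ s in (0 : ℝ)..1, F ((x * z) * s) := by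
    refine intervalIntegral.integral_congr fun s hs => ?_
    rw [uIcc_of_le zero_le_one] at hs
    simp only [dilate_apply _ hs, h]
    congr 1
    simp; ring
  rw [this]
  simp

lemma avg_apply_zero (f : C(I, ℝ)) : avg f 0 = f 0 := by
  rw [avg_apply, intervalIntegral.integral_congr (g := fun _ => f 0)]
  · simp
  · intro s hs
    rw [uIcc_of_le zero_le_one] at hs
    simp [dilate_apply _ hs]

lemma avg_one : avg 1 = 1 := by
  have := wavg_coord_pow (show (-1 : ℝ) < 0 by norm_num) 0
  simpa [avg] using this

/-- With `b = a θ`, the operator multiplies `z ^ n` by `a (n + 1 + θ) / (n + 1)`. The reciprocal of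
the last quotient is `1 - θ / (n + θ + 1)`, which is the eigenvalue of `id - θ • wavg θ`. The sign
conditions say exactly that `θ > -1`, so the weight `s ^ θ` is integrable. -/
lemma isInvertible_add_smul_avg {a b : ℝ} (ha : a < 0) (hab : a + b < 0) :
    (a • ContinuousLinearMap.id ℝ C(I, ℝ) + b • avg).IsInvertible := by
  have hne : a ≠ 0 := ha.ne
  obtain ⟨θ, rfl⟩ : ∃ θ, b = a * θ := ⟨b / a, by field_simp⟩
  have hθ : -1 < θ := by nlinarith
  have hn (n : ℕ) : (n + θ + 1) ≠ 0 := by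
    have : (0 : ℝ) ≤ n := n.cast_nonneg
    linarith
  refine ContinuousLinearMap.IsInvertible.of_inverse
    (g := a⁻¹ • (ContinuousLinearMap.id ℝ C(I, ℝ) - θ • wavg θ hθ)) ?_ ?_ <;>
  · apply clm_ext_coord_pow
    intro n
    simp only [ContinuousLinearMap.comp_apply, smul_apply, sub_apply, add_apply,
      ContinuousLinearMap.id_apply, map_smul, map_sub, map_add, wavg_coord_pow, avg, smul_sub,
      smul_add, smul_smul, ← sub_smul, ← add_smul]
    nth_rw 2 [← one_smul ℝ (coord ^ n)]
    congr 1
    have := hn n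
    field_simp
    ring

lemma exp_apply (f : C(I, ℝ)) (z : I) : NormedSpace.exp f z = Real.exp (f z) := by
  rw [Real.exp_eq_exp_ℝ]
  exact NormedSpace.map_exp (ContinuousMap.evalAlgHom ℝ ℝ z) (ContinuousMap.evalCLM ℝ z).continuous f

lemma contDiff_exp : ContDiff ℝ ω (NormedSpace.exp : C(I, ℝ) → C(I, ℝ)) :=
  contDiff_iff_contDiffAt.2 fun x => (NormedSpace.exp_analytic (𝕂 := ℝ) x).contDiffAt

end

section

/-! ### The Larson-Penston-Hunter branch -/

variable {γ w : ℝ}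

/-- The quadratic polynomial whose smaller root is `R₁ γ w`. -/
def quad (γ w R : ℝ) : ℝ :=
  (γ + 1) * w ^ 2 * R ^ 2 + w * (8 * w + 7 * γ - 9) * R
    + (4 - 3 * γ - 3 * w) * (-2 * w + (γ - 1) * (2 - γ) / w)

/-- The square root of the discriminant of `quad γ w`. -/
def sqrtDiscr (γ w : ℝ) : ℝ := Real.sqrt (w ^ 3 * discr γ w) / w

lemma sqrtDiscr_sq (hw : 0 < w) (hs : 0 ≤ discr γ w) :
    sqrtDiscr γ w ^ 2 = w * discr γ w := by
  rw [sqrtDiscr, div_pow, Real.sq_sqrt (by positivity)]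
  field_simp

lemma sqrtDiscr_pos (hw : 0 < w) (hs : 0 < discr γ w) : 0 < sqrtDiscr γ w := by
  unfold sqrtDiscr; positivity

/-- The left side is the `R`-derivative of `quad` at `R₁`; its being minus the root of the
discriminant is what singles out the smaller root. -/
lemma R₁_mul (hγ : 0 < γ + 1) (hw : 0 < w) :
    2 * (γ + 1) * w ^ 2 * R₁ γ w + w * (8 * w + 7 * γ - 9) = -sqrtDiscr γ w := by
  unfold R₁ sqrtDiscr
  field_simp
  ring

lemma quad_complete_square (hw : 0 < w) (R : ℝ) :
    4 * (γ + 1) * w ^ 2 * quad γ w R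
      = (2 * (γ + 1) * w ^ 2 * R + w * (8 * w + 7 * γ - 9)) ^ 2 - w * discr γ w := by
  unfold quad discr
  field_simp
  ring

lemma quad_R₁ (hγ : 0 < γ + 1) (hw : 0 < w) (hs : 0 ≤ discr γ w) : quad γ w (R₁ γ w) = 0 := by
  have h := quad_complete_square (γ := γ) hw (R₁ γ w)
  rw [R₁_mul hγ hw, neg_sq, sqrtDiscr_sq hw hs, sub_self] at h
  have : 4 * (γ + 1) * w ^ 2 ≠ 0 := by positivity
  exact (mul_eq_zero.1 h).resolve_left this

/-- The argument is the value of `R` for which `ω` would be stationary at the sonic point. The sign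
of `quad` there locates it relative to the two roots, and the factorization shows that it is itself
a root at `w = ω_F` and at `w = 2 - γ`. -/
lemma quad_stationary (hw : 0 < w) : quad γ w ((4 - 3 * γ - 3 * w) / w)
    = (4 - 3 * γ - 3 * w) * ((γ - 1) * (2 - γ - w) * (3 * w + 1)) / w := by
  unfold quad
  field_simp
  ring

lemma omegaF_pos (hγ : γ ∈ Ioo (1 : ℝ) (4 / 3)) : 0 < omegaF γ := by
  unfold omegaF; linarith [hγ.2]

lemma omegaF_lt : omegaF γ < 2 - γ := by
  unfold omegaF; linarith

/-- A quadratic with positive leading coefficient which is negative somewhere has two real roots;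
the test point is the stationary value of `quad_stationary`. -/
lemma discr_pos (hγ : γ ∈ Ioo (1 : ℝ) (4 / 3)) (hw : w ∈ Icc (omegaF γ) (2 - γ)) :
    0 < discr γ w := by
  have hw0 : 0 < w := (omegaF_pos hγ).trans_le hw.1
  obtain ⟨h1, h2⟩ := hγ
  obtain ⟨hwl, hwr⟩ := hw
  unfold omegaF at hwl
  have h := quad_complete_square (γ := γ) hw0 ((4 - 3 * γ - 3 * w) / w)
  rw [quad_stationary hw0] at h
  have hK : 2 * (γ + 1) * w ^ 2 * ((4 - 3 * γ - 3 * w) / w)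
      = 2 * (γ + 1) * w * (4 - 3 * γ - 3 * w) := by field_simp
  rw [hK] at h
  have hq : 4 * (γ + 1) * w ^ 2 * ((4 - 3 * γ - 3 * w) *
      ((γ - 1) * (2 - γ - w) * (3 * w + 1)) / w)
      = 4 * (γ + 1) * w * (4 - 3 * γ - 3 * w) * ((γ - 1) * (2 - γ - w) * (3 * w + 1)) := by
    field_simp
  rw [hq] at h
  have hle : 4 * (γ + 1) * w * (4 - 3 * γ - 3 * w) * ((γ - 1) * (2 - γ - w) * (3 * w + 1)) ≤ 0 := by
    apply mul_nonpos_of_nonpos_of_nonneg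
    · apply mul_nonpos_of_nonneg_of_nonpos <;> nlinarith
    · apply mul_nonneg (mul_nonneg _ _) <;> linarith
  -- At the two endpoints the test value of `quad` is zero, and strict positivity comes from the
  -- completed square instead.
  rcases hwl.eq_or_lt with rfl | hwl'
  · nlinarith [mul_pos hw0 hw0, sq_nonneg (γ - 1), mul_pos (mul_pos hw0 hw0) (show 0 < 5 - 3 * γ by linarith)]
  rcases hwr.eq_or_lt with rfl | hwr'
  · have : (2 * (γ + 1) * (2 - γ) * (4 - 3 * γ - 3 * (2 - γ))
        + (2 - γ) * (8 * (2 - γ) + 7 * γ - 9)) = - ((2 - γ) * (5 * γ - 3)) := by ring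
    rw [this, neg_sq] at h
    have : 0 < (2 - γ) * (5 * γ - 3) := mul_pos hw0 (by linarith)
    have h3 : 0 < ((2 - γ) * (5 * γ - 3)) ^ 2 := by positivity
    exact pos_of_mul_pos_right (a := 2 - γ) (by linarith [h, hle]) hw0.le
  · have : 4 * (γ + 1) * w * (4 - 3 * γ - 3 * w) * ((γ - 1) * (2 - γ - w) * (3 * w + 1)) < 0 := by
      apply mul_neg_of_neg_of_pos
      · apply mul_neg_of_pos_of_neg <;> nlinarith
      · apply mul_pos (mul_pos _ _) <;> linarith
    have h3 := sq_nonneg (2 * (γ + 1) * w * (4 - 3 * γ - 3 * w) + w * (8 * w + 7 * γ - 9))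
    exact pos_of_mul_pos_right (a := w) (by linarith) hw0.le

/-- The derivative of the sonic function along the Larson-Penston-Hunter branch, normalized. -/
def lam (γ w : ℝ) : ℝ := (γ + 1) * w ^ 2 * R₁ γ w + 4 * w ^ 2 - 2 * w * (4 - 3 * γ)

/-- By `R₁_mul`, twice this number equals `-sqrtDiscr γ w - (7 - 5γ) w`, and `5γ < 7` since `γ <
4/3`. It gives the strict decrease of `G` through the sonic point and the sign of the identity part
of the linearization. -/
lemma lam_neg (hγ : γ ∈ Ioo (1 : ℝ) (4 / 3)) (hw : w ∈ Icc (omegaF γ) (2 - γ)) :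
    lam γ w < 0 := by
  have hw0 : 0 < w := (omegaF_pos hγ).trans_le hw.1
  have h := R₁_mul (γ := γ) (by linarith [hγ.1]) hw0
  have := sqrtDiscr_pos hw0 (discr_pos hγ hw)
  unfold lam
  nlinarith [hγ.2]

lemma W₁_eq (hw : 0 < w) : W₁ γ w = w * ((4 - 3 * γ - 3 * w) / w - R₁ γ w) := by
  unfold W₁; field_simp

/-- By `W₁_eq` the claim is that `R₁` lies below the stationary value `K`. For `w > ω_F` this holds
because `quad` is negative at `K`, so `K` lies strictly between the roots. -/
lemma W₁_pos (hγ : γ ∈ Ioo (1 : ℝ) (4 / 3)) (hw : w ∈ Ico (omegaF γ) (2 - γ)) :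
    0 < W₁ γ w := by
  have hw0 : 0 < w := (omegaF_pos hγ).trans_le hw.1
  have hd := discr_pos hγ (Ico_subset_Icc_self hw)
  obtain ⟨h1, h2⟩ := hγ
  obtain ⟨hwl, hwr⟩ := hw
  unfold omegaF at hwl
  rw [W₁_eq hw0]
  refine mul_pos hw0 ?_
  have hR := R₁_mul (γ := γ) (by linarith) hw0
  have hT := sqrtDiscr_pos hw0 hd
  have hTs := sqrtDiscr_sq hw0 hd.le
  have h := quad_complete_square (γ := γ) hw0 ((4 - 3 * γ - 3 * w) / w)
  rw [quad_stationary hw0] at h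
  set K := (4 - 3 * γ - 3 * w) / w with hK
  have key : - sqrtDiscr γ w < 2 * (γ + 1) * w ^ 2 * K + w * (8 * w + 7 * γ - 9) := by
    -- For `w = ω_F` the stationary value is `0`, a root of `quad`; it is the larger one because `8
    -- w + 7 γ - 9 = (5 - 3 γ) / 3 > 0`.
    rcases hwl.eq_or_lt with heq | hwl'
    · have hK0 : K = 0 := by rw [hK, ← heq]; ring_nf
      have : 0 < w * (8 * w + 7 * γ - 9) := mul_pos hw0 (by rw [← heq]; linarith)
      rw [hK0]; linarith
    · have : 4 * (γ + 1) * w ^ 2 * ((4 - 3 * γ - 3 * w)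
          * ((γ - 1) * (2 - γ - w) * (3 * w + 1)) / w) < 0 := by
        apply mul_neg_of_pos_of_neg
        · have : 0 < γ + 1 := by linarith
          positivity
        apply div_neg_of_neg_of_pos _ hw0
        apply mul_neg_of_neg_of_pos (by linarith)
        apply mul_pos (mul_pos _ _) <;> linarith
      exact (abs_lt_of_sq_lt_sq' (by linarith) hT.le).1
  have hpos : 0 < 2 * (γ + 1) * w ^ 2 := by
    have : 0 < γ + 1 := by linarith
    positivity
  exact pos_of_mul_pos_right (a := 2 * (γ + 1) * w ^ 2) (by linarith) hpos.le

/-- At `w = 2 - γ` the stationary value is again a root, but now `quad` has negative slope there, so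
it is the smaller one. This identifies the branch at `y_f` with the far-field solution. -/
lemma R₁_far (hγ : γ ∈ Ioo (1 : ℝ) (4 / 3)) : R₁ γ (2 - γ) = -2 / (2 - γ) := by
  have hw0 : 0 < 2 - γ := by linarith [hγ.2]
  have hd := discr_pos hγ (right_mem_Icc.2 omegaF_lt.le)
  obtain ⟨h1, h2⟩ := hγ
  have hR := R₁_mul (γ := γ) (by linarith) hw0
  have hT := sqrtDiscr_pos hw0 hd
  have hTs := sqrtDiscr_sq hw0 hd.le
  have h := quad_complete_square (γ := γ) hw0 ((4 - 3 * γ - 3 * (2 - γ)) / (2 - γ))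
  rw [quad_stationary hw0, ← hTs, sub_self, mul_zero, zero_mul, mul_zero, zero_div, mul_zero] at h
  have hK : (4 - 3 * γ - 3 * (2 - γ)) / (2 - γ) = -2 / (2 - γ) := by ring_nf
  rw [hK] at h
  have hneg : 2 * (γ + 1) * (2 - γ) ^ 2 * (-2 / (2 - γ)) + (2 - γ) * (8 * (2 - γ) + 7 * γ - 9) < 0 := by
    have : 2 * (γ + 1) * (2 - γ) ^ 2 * (-2 / (2 - γ)) = -4 * (γ + 1) * (2 - γ) := by
      field_simp; ring
    rw [this]; nlinarith
  have h3 : 2 * (γ + 1) * (2 - γ) ^ 2 * (-2 / (2 - γ)) + (2 - γ) * (8 * (2 - γ) + 7 * γ - 9)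
      = - sqrtDiscr γ (2 - γ) := by
    rcases sq_eq_sq_iff_eq_or_eq_neg.1 (sub_eq_zero.1 h.symm) with h | h
    · linarith
    · exact h
  have hpos : 2 * (γ + 1) * (2 - γ) ^ 2 ≠ 0 := by
    have : 0 < γ + 1 := by linarith
    positivity
  exact mul_left_cancel₀ hpos (by linarith)

lemma continuousAt_R₁ (hγ : 0 < γ + 1) (hw : 0 < w) : ContinuousAt (R₁ γ) w := by
  unfold R₁ discr
  apply ContinuousAt.div (by fun_prop) (by fun_prop)
  positivity

end

section

/-! ### The rescaled equation for the logarithmic derivative of the density -/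

open MeasureTheory unitInterval ContDiff

variable {γ w : ℝ}

/-- The independent variable `x = ε z`. -/
def xC (ε : ℝ) : C(I, ℝ) := ε • coord

/-- The logarithm of the density in terms of its rescaled derivative `k`. -/
def uC (ε : ℝ) (k : C(I, ℝ)) : C(I, ℝ) := xC ε * avg k

/-- The relative velocity in terms of `k`. -/
def omC (γ ε w : ℝ) (k : C(I, ℝ)) : C(I, ℝ) :=
  NormedSpace.exp (-((3 : ℝ) • xC ε + uC ε k))
    * (w • 1 + (4 - 3 * γ) • (xC ε * avg (NormedSpace.exp ((3 : ℝ) • xC ε + uC ε k))))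

/-- The derivative of the relative velocity in terms of `k`. -/
def domC (γ ε w : ℝ) (k : C(I, ℝ)) : C(I, ℝ) :=
  (4 - 3 * γ) • 1 - (3 : ℝ) • omC γ ε w k - omC γ ε w k * k

/-- The coefficient of the linear term of `h` at a sonic point, multiplied by `ω₀`. -/
def aF (γ w : ℝ) : ℝ := 2 * w ^ 2 + (γ - 1) * w + (γ - 1) * (2 - γ)

/-- The derivative of the normalized sonic function. -/
def dGC (γ ε w : ℝ) (k : C(I, ℝ)) : C(I, ℝ) :=
  ((γ - 1) * w ^ 2) • (NormedSpace.exp ((γ - 1) • uC ε k) * k)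
    - (2 : ℝ) • (NormedSpace.exp ((2 : ℝ) • xC ε)
      * (omC γ ε w k * omC γ ε w k + omC γ ε w k * domC γ ε w k))

/-- The derivative of `ω₀ h`. -/
def dHC (γ ε w : ℝ) (k : C(I, ℝ)) : C(I, ℝ) :=
  w • (((4 : ℝ) • omC γ ε w k + (γ - 1) • 1) * domC γ ε w k)
    - aF γ w • (NormedSpace.exp (uC ε k) * ((4 - 3 * γ) • 1 - (3 : ℝ) • omC γ ε w k))

/-- The rescaled equation for `k`. -/
def sonicEq (γ : ℝ) (p : (ℝ × ℝ) × C(I, ℝ)) : C(I, ℝ) :=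
  p.1.2 • (p.2 * avg (dGC γ p.1.1 p.1.2 p.2))
    - NormedSpace.exp ((2 : ℝ) • xC p.1.1) * avg (dHC γ p.1.1 p.1.2 p.2)

lemma contDiff_uC : ContDiff ℝ ω fun p : (ℝ × ℝ) × C(I, ℝ) => uC p.1.1 p.2 := by
  unfold uC xC; fun_prop

lemma contDiff_omC : ContDiff ℝ ω fun p : (ℝ × ℝ) × C(I, ℝ) => omC γ p.1.1 p.1.2 p.2 := by
  have h1 : ContDiff ℝ ω fun p : (ℝ × ℝ) × C(I, ℝ) => (3 : ℝ) • xC p.1.1 + uC p.1.1 p.2 := by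
    have := contDiff_uC
    unfold xC; fun_prop
  have h2 := contDiff_exp.comp h1
  have h3 := contDiff_exp.comp h1.neg
  simp only [Function.comp_def] at h2 h3
  unfold omC
  have h4 : ContDiff ℝ ω fun p : (ℝ × ℝ) × C(I, ℝ) =>
      avg (NormedSpace.exp ((3 : ℝ) • xC p.1.1 + uC p.1.1 p.2)) := avg.contDiff.comp h2
  have h5 : ContDiff ℝ ω fun p : (ℝ × ℝ) × C(I, ℝ) => xC p.1.1 := by unfold xC; fun_prop
  fun_prop

lemma contDiff_sonicEq : ContDiff ℝ ω (sonicEq γ) := by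
  have h1 := contDiff_omC (γ := γ)
  have hu := contDiff_uC
  have h2 : ContDiff ℝ ω fun p : (ℝ × ℝ) × C(I, ℝ) => domC γ p.1.1 p.1.2 p.2 := by
    unfold domC; fun_prop
  have h3 : ContDiff ℝ ω fun p : (ℝ × ℝ) × C(I, ℝ) => NormedSpace.exp ((γ - 1) • uC p.1.1 p.2) :=
    contDiff_exp.comp (by fun_prop)
  have h4 : ContDiff ℝ ω fun p : (ℝ × ℝ) × C(I, ℝ) => NormedSpace.exp (uC p.1.1 p.2) :=
    contDiff_exp.comp hu
  have h5 : ContDiff ℝ ω fun p : (ℝ × ℝ) × C(I, ℝ) => NormedSpace.exp ((2 : ℝ) • xC p.1.1) :=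
    contDiff_exp.comp (by unfold xC; fun_prop)
  have h6 : ContDiff ℝ ω fun p : (ℝ × ℝ) × C(I, ℝ) => dGC γ p.1.1 p.1.2 p.2 := by
    unfold dGC; fun_prop
  have h7 : ContDiff ℝ ω fun p : (ℝ × ℝ) × C(I, ℝ) => dHC γ p.1.1 p.1.2 p.2 := by
    unfold dHC aF; fun_prop
  unfold sonicEq
  fun_prop

/-- At `ε = 0` all exponentials are `1` and `ω` is frozen at `w`, so only a quadratic expression in
`k` and its average survives. -/
lemma sonicEq_zero (k : C(I, ℝ)) : sonicEq γ ((0, w), k)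
    = w • (k * avg (((γ + 1) * w ^ 2) • k + (4 * w ^ 2 - 2 * w * (4 - 3 * γ)) • 1))
      - avg ((-w ^ 2 * (4 * w + γ - 1)) • k
        + ((4 - 3 * γ - 3 * w) * (w * (4 * w + γ - 1) - aF γ w)) • 1) := by
  have ho : omC γ 0 w k = w • 1 := by simp [omC, xC, uC]
  have hG : dGC γ 0 w k
      = ((γ + 1) * w ^ 2) • k + (4 * w ^ 2 - 2 * w * (4 - 3 * γ)) • 1 := by
    ext z
    simp [dGC, domC, ho, xC, uC]
    ring
  have hH : dHC γ 0 w k = (-w ^ 2 * (4 * w + γ - 1)) • k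
        + ((4 - 3 * γ - 3 * w) * (w * (4 * w + γ - 1) - aF γ w)) • 1 := by
    ext z
    simp [dHC, domC, ho, xC, uC]
    ring
  simp only [sonicEq, hG, hH]
  simp [xC]

lemma sonicEq_zero_const (hw : 0 < w) (R : ℝ) :
    sonicEq γ ((0, w), R • 1) = (w * quad γ w R) • 1 := by
  rw [sonicEq_zero]
  ext z
  simp only [map_add, map_smul, avg_one, quad, aF]
  simp
  field_simp
  ring

lemma fderiv_sonicEq_inr (R : ℝ) :
    fderiv ℝ (sonicEq γ) ((0, w), R • 1) ∘L .inr ℝ (ℝ × ℝ) C(I, ℝ)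
      = (w * ((γ + 1) * w ^ 2 * R + 4 * w ^ 2 - 2 * w * (4 - 3 * γ)))
          • ContinuousLinearMap.id ℝ C(I, ℝ)
        + (w * ((γ + 1) * w ^ 2 * R) + w ^ 2 * (4 * w + γ - 1)) • avg := by
  have h1 : HasFDerivAt (sonicEq γ) (fderiv ℝ (sonicEq γ) ((0, w), R • 1)) ((0, w), R • 1) :=
    (contDiff_sonicEq.differentiable (by simp)).differentiableAt.hasFDerivAt
  have h2 : HasFDerivAt (fun k : C(I, ℝ) => (((0 : ℝ), w), k)) (.inr ℝ (ℝ × ℝ) C(I, ℝ))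
      (R • (1 : C(I, ℝ))) := hasFDerivAt_prodMk_right _ _
  have h3 := h1.comp (R • (1 : C(I, ℝ))) h2
  have h4 : sonicEq γ ∘ (fun k : C(I, ℝ) => (((0 : ℝ), w), k)) = fun k => _ :=
    funext fun k => sonicEq_zero k
  rw [h4] at h3
  have hid := hasFDerivAt_id (𝕜 := ℝ) (R • (1 : C(I, ℝ)))
  have h5 (a b : ℝ) : HasFDerivAt (fun k : C(I, ℝ) => avg (a • k + b • 1)) (a • avg)
      (R • (1 : C(I, ℝ))) := by
    have h : (fun k : C(I, ℝ) => avg (a • k + b • 1)) = fun k => (a • avg) k + avg (b • 1) := by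
      ext; simp
    rw [h]
    exact (a • avg).hasFDerivAt.add_const _
  have h6 := ((hid.mul (h5 ((γ + 1) * w ^ 2) (4 * w ^ 2 - 2 * w * (4 - 3 * γ)))).const_smul w).sub
    (h5 (-w ^ 2 * (4 * w + γ - 1)) ((4 - 3 * γ - 3 * w) * (w * (4 * w + γ - 1) - aF γ w)))
  refine (h3.unique h6).trans ?_
  ext f z
  simp [avg_one]
  ring

/-- The identity coefficient is `w * lam γ w`, negative by `lam_neg`. The sum of the two
coefficients is `w` times the slope of `quad` at `R₁`, that is `-w * sqrtDiscr γ w`; choosing the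
smaller root is what makes it negative. -/
lemma isInvertible_fderiv_sonicEq (hγ : γ ∈ Ioo (1 : ℝ) (4 / 3))
    (hw : w ∈ Icc (omegaF γ) (2 - γ)) :
    (fderiv ℝ (sonicEq γ) ((0, w), R₁ γ w • 1) ∘L .inr ℝ (ℝ × ℝ) C(I, ℝ)).IsInvertible := by
  have hw0 : 0 < w := (omegaF_pos hγ).trans_le hw.1
  have hl := lam_neg hγ hw
  have hR := R₁_mul (γ := γ) (by linarith [hγ.1]) hw0
  have hT := sqrtDiscr_pos hw0 (discr_pos hγ hw)
  rw [fderiv_sonicEq_inr]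
  unfold lam at hl
  refine isInvertible_add_smul_avg (mul_neg_of_pos_of_neg hw0 hl) ?_
  nlinarith

end

section

open MeasureTheory unitInterval ContDiff

variable {γ w : ℝ}

/-! ### Solutions in logarithmic variables -/

/-- The sonic function in the variables `x = log (y / y_*)`, `u = log (ρ / ρ₀)`, divided by
`y_* ^ 2`. -/
def Gn (γ w x u om : ℝ) : ℝ :=
  w ^ 2 * Real.exp ((γ - 1) * u) - Real.exp (2 * x) * om ^ 2

/-- The function `h`, multiplied by `ω₀`, in the variables `u = log (ρ / ρ₀)`, `ω`. -/
def hn (γ w u om : ℝ) : ℝ :=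
  w * (2 * om ^ 2 + (γ - 1) * om + (γ - 1) * (2 - γ)) - aF γ w * (Real.exp u * om)

/-- The kinematic relations between `k = u'`, `u` and `ω` in logarithmic variables. -/
structure IsLogSol (γ w r : ℝ) (k u om : ℝ → ℝ) : Prop where
  cont : ContinuousOn k (Ioo (-r) r)
  u_zero : u 0 = 0
  om_zero : om 0 = w
  deriv_u : ∀ x ∈ Ioo (-r) r, HasDerivAt u (k x) x
  deriv_om : ∀ x ∈ Ioo (-r) r, HasDerivAt om (4 - 3 * γ - 3 * om x - om x * k x) x

lemma mul_mem_Ioo {r ε : ℝ} (hε : ε ∈ Ioo (-r) r) (z : I) : ε * z ∈ Ioo (-r) r := by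
  rw [mem_Ioo, ← abs_lt] at hε ⊢
  rw [abs_mul, abs_of_nonneg z.2.1]
  exact (mul_le_of_le_one_right (abs_nonneg _) z.2.2).trans_lt hε

lemma integral_eq_sub_of_Ioo {r x : ℝ} {f f' : ℝ → ℝ} (hx : x ∈ Ioo (-r) r)
    (hf : ∀ s ∈ Ioo (-r) r, HasDerivAt f (f' s) s) (hc : ContinuousOn f' (Ioo (-r) r)) :
    ∫ s in (0 : ℝ)..x, f' s = f x - f 0 := by
  have h0 : (0 : ℝ) ∈ Ioo (-r) r := by
    have := hx.1.trans hx.2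
    constructor <;> linarith
  have hs : uIcc 0 x ⊆ Ioo (-r) r := (ordConnected_Ioo).uIcc_subset h0 hx
  exact intervalIntegral.integral_eq_sub_of_hasDerivAt (fun s h => hf s (hs h))
    (hc.mono hs).intervalIntegrable

lemma xC_apply (ε : ℝ) (z : I) : xC ε z = ε * z := rfl

namespace IsLogSol

variable {r ε : ℝ} {k u om : ℝ → ℝ} {F : C(I, ℝ)}

lemma uC_apply (H : IsLogSol γ w r k u om) (hε : ε ∈ Ioo (-r) r) (hF : ∀ z : I, F z = k (ε * z))
    (z : I) : uC ε F z = u (ε * z) := by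
  have h1 : uC ε F z = ε * z * avg F z := by simp [uC, xC_apply]
  rw [h1, avg_one_apply hF, integral_eq_sub_of_Ioo (mul_mem_Ioo hε z) H.deriv_u H.cont, H.u_zero,
    sub_zero]

lemma cont_u (H : IsLogSol γ w r k u om) : ContinuousOn u (Ioo (-r) r) :=
  HasDerivAt.continuousOn H.deriv_u

lemma cont_om (H : IsLogSol γ w r k u om) : ContinuousOn om (Ioo (-r) r) :=
  HasDerivAt.continuousOn H.deriv_om

/-- The equation for `ω` is linear once `k` is known; this is its integrating factor, and it
explains the formula `omC`. -/
lemma deriv_exp_mul_om (H : IsLogSol γ w r k u om) {x : ℝ} (hx : x ∈ Ioo (-r) r) :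
    HasDerivAt (fun x => Real.exp (3 * x + u x) * om x)
      ((4 - 3 * γ) * Real.exp (3 * x + u x)) x := by
  have h := ((((hasDerivAt_id x).const_mul 3).add (H.deriv_u x hx)).exp).mul (H.deriv_om x hx)
  refine h.congr_deriv ?_
  simp
  ring

lemma omC_apply (H : IsLogSol γ w r k u om) (hε : ε ∈ Ioo (-r) r)
    (hF : ∀ z : I, F z = k (ε * z)) (z : I) : omC γ ε w F z = om (ε * z) := by
  have hu := H.uC_apply hε hF
  have h1 : ∀ z : I, NormedSpace.exp ((3 : ℝ) • xC ε + uC ε F) z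
      = Real.exp (3 * (ε * z) + u (ε * z)) := by
    intro z
    rw [exp_apply]
    simp [hu, xC_apply]
  have h2 := avg_one_apply (F := fun x => Real.exp (3 * x + u x)) h1 (z := z)
  have hcu := H.cont_u
  have h3 := integral_eq_sub_of_Ioo (mul_mem_Ioo hε z) (fun s hs => H.deriv_exp_mul_om hs)
    (by fun_prop)
  rw [intervalIntegral.integral_const_mul, ← h2, H.u_zero, H.om_zero] at h3
  simp only [mul_zero, add_zero, Real.exp_zero, one_mul] at h3
  have h4 : omC γ ε w F z = Real.exp (-(3 * (ε * z) + u (ε * z)))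
      * (w + (4 - 3 * γ) * (ε * z * avg (NormedSpace.exp ((3 : ℝ) • xC ε + uC ε F)) z)) := by
    simp only [omC, ContinuousMap.mul_apply, exp_apply]
    simp [hu, xC_apply]
  rw [h4, h3, Real.exp_neg]
  field_simp
  ring

lemma deriv_Gn (H : IsLogSol γ w r k u om) {x : ℝ} (hx : x ∈ Ioo (-r) r) :
    HasDerivAt (fun x => Gn γ w x (u x) (om x))
      ((γ - 1) * w ^ 2 * (Real.exp ((γ - 1) * u x) * k x) - 2 * (Real.exp (2 * x)
        * (om x * om x + om x * (4 - 3 * γ - 3 * om x - om x * k x)))) x := by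
  have h := ((((H.deriv_u x hx).const_mul (γ - 1)).exp).const_mul (w ^ 2)).sub
    ((((hasDerivAt_id x).const_mul 2).exp).mul ((H.deriv_om x hx).pow 2))
  refine h.congr_deriv ?_
  simp
  ring

lemma deriv_hn (H : IsLogSol γ w r k u om) {x : ℝ} (hx : x ∈ Ioo (-r) r) :
    HasDerivAt (fun x => hn γ w (u x) (om x))
      (w * ((4 * om x + (γ - 1)) * (4 - 3 * γ - 3 * om x - om x * k x))
        - aF γ w * (Real.exp (u x) * (4 - 3 * γ - 3 * om x))) x := by
  have ho := H.deriv_om x hx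
  have h := (((((ho.pow 2).const_mul 2).add (ho.const_mul (γ - 1))).add_const
    ((γ - 1) * (2 - γ))).const_mul w).sub (((H.deriv_u x hx).exp.mul ho).const_mul (aF γ w))
  refine h.congr_deriv ?_
  simp
  ring

lemma Gn_zero (H : IsLogSol γ w r k u om) : Gn γ w 0 (u 0) (om 0) = 0 := by
  simp [Gn, H.u_zero, H.om_zero]

lemma hn_zero (H : IsLogSol γ w r k u om) : hn γ w (u 0) (om 0) = 0 := by
  simp [hn, H.u_zero, H.om_zero, aF]
  ring

lemma avg_dGC_apply (H : IsLogSol γ w r k u om) (hε : ε ∈ Ioo (-r) r)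
    (hF : ∀ z : I, F z = k (ε * z)) (z : I) :
    ε * z * avg (dGC γ ε w F) z = Gn γ w (ε * z) (u (ε * z)) (om (ε * z)) := by
  have hu := H.uC_apply hε hF
  have ho := H.omC_apply hε hF
  have h1 : ∀ z : I, dGC γ ε w F z = (fun x : ℝ => (γ - 1) * w ^ 2 * (Real.exp ((γ - 1) * u x) * k x)
      - 2 * (Real.exp (2 * x) * (om x * om x + om x * (4 - 3 * γ - 3 * om x - om x * k x))))
      (ε * z) := by
    intro z
    simp only [dGC, domC, ContinuousMap.sub_apply, ContinuousMap.smul_apply,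
      ContinuousMap.mul_apply, ContinuousMap.add_apply, exp_apply, ho, hu, hF]
    simp [xC_apply]
  have hcu := H.cont_u
  have hco := H.cont_om
  have hck := H.cont
  rw [avg_one_apply (F := fun x : ℝ => (γ - 1) * w ^ 2 * (Real.exp ((γ - 1) * u x) * k x)
      - 2 * (Real.exp (2 * x) * (om x * om x + om x * (4 - 3 * γ - 3 * om x - om x * k x)))) h1, integral_eq_sub_of_Ioo (mul_mem_Ioo hε z) (fun s hs => H.deriv_Gn hs)
    (by fun_prop), H.Gn_zero, sub_zero]

lemma avg_dHC_apply (H : IsLogSol γ w r k u om) (hε : ε ∈ Ioo (-r) r)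
    (hF : ∀ z : I, F z = k (ε * z)) (z : I) :
    ε * z * avg (dHC γ ε w F) z = hn γ w (u (ε * z)) (om (ε * z)) := by
  have hu := H.uC_apply hε hF
  have ho := H.omC_apply hε hF
  have h1 : ∀ z : I, dHC γ ε w F z
      = (fun x : ℝ => w * ((4 * om x + (γ - 1)) * (4 - 3 * γ - 3 * om x - om x * k x))
        - aF γ w * (Real.exp (u x) * (4 - 3 * γ - 3 * om x))) (ε * z) := by
    intro z
    simp only [dHC, domC, ContinuousMap.sub_apply, ContinuousMap.smul_apply,
      ContinuousMap.mul_apply, ContinuousMap.add_apply, exp_apply, ho, hu, hF]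
    simp
  have hcu := H.cont_u
  have hco := H.cont_om
  have hck := H.cont
  rw [avg_one_apply (F := fun x : ℝ => w * ((4 * om x + (γ - 1)) * (4 - 3 * γ - 3 * om x - om x * k x))
        - aF γ w * (Real.exp (u x) * (4 - 3 * γ - 3 * om x))) h1, integral_eq_sub_of_Ioo (mul_mem_Ioo hε z) (fun s hs => H.deriv_hn hs)
    (by fun_prop), H.hn_zero, sub_zero]

/-- For `ε z ≠ 0` this makes the desingularized equation equivalent to the system multiplied by `G`.
Both signs of `ε` are allowed, so both sides of the sonic point are covered. -/
lemma sonicEq_apply (H : IsLogSol γ w r k u om) (hε : ε ∈ Ioo (-r) r)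
    (hF : ∀ z : I, F z = k (ε * z)) (z : I) :
    ε * z * sonicEq γ ((ε, w), F) z
      = w * k (ε * z) * Gn γ w (ε * z) (u (ε * z)) (om (ε * z))
        - Real.exp (2 * (ε * z)) * hn γ w (u (ε * z)) (om (ε * z)) := by
  rw [← H.avg_dGC_apply hε hF, ← H.avg_dHC_apply hε hF, ← hF]
  simp only [sonicEq, ContinuousMap.sub_apply, ContinuousMap.smul_apply, ContinuousMap.mul_apply,
    exp_apply]
  simp [xC_apply]
  ring

/-- At the origin, the rescaled equation reduces to the quadratic equation for `R`. -/
lemma sonicEq_apply_zero (hw : 0 < w) (F : C(I, ℝ)) :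
    sonicEq γ ((ε, w), F) 0 = w * quad γ w (F 0) := by
  have h1 : omC γ ε w F 0 = w := by
    simp [omC, exp_apply, uC, xC, coord]
  have hG : dGC γ ε w F 0 = (γ + 1) * w ^ 2 * F 0 + (4 * w ^ 2 - 2 * w * (4 - 3 * γ)) := by
    simp [dGC, domC, h1, exp_apply, uC, xC, coord]; ring
  have hH : dHC γ ε w F 0 = (-w ^ 2 * (4 * w + γ - 1)) * F 0
        + ((4 - 3 * γ - 3 * w) * (w * (4 * w + γ - 1) - aF γ w)) := by
    simp [dHC, domC, h1, exp_apply, uC, xC, coord]; ring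
  simp [sonicEq, avg_apply_zero, exp_apply, hG, hH, xC, coord, quad, aF]
  field_simp
  ring

end IsLogSol

/-- A continuous function is the logarithmic derivative of the density of a solution of the
kinematic relations. -/
lemma exists_isLogSol {r : ℝ} (γ w : ℝ) (hr : 0 < r) {k : ℝ → ℝ} (hk : ContinuousOn k (Ioo (-r) r)) :
    ∃ u om : ℝ → ℝ, IsLogSol γ w r k u om := by
  have key : ∀ f : ℝ → ℝ, ContinuousOn f (Ioo (-r) r) → ∀ x ∈ Ioo (-r) r,
      HasDerivAt (fun x => ∫ s in (0 : ℝ)..x, f s) (f x) x := by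
    intro f hf x hx
    have h0 : (0 : ℝ) ∈ Ioo (-r) r := by constructor <;> linarith
    have hs : uIcc 0 x ⊆ Ioo (-r) r := (ordConnected_Ioo).uIcc_subset h0 hx
    exact intervalIntegral.integral_hasDerivAt_right ((hf.mono hs).intervalIntegrable)
      (hf.stronglyMeasurableAtFilter isOpen_Ioo x hx) (hf.continuousAt (isOpen_Ioo.mem_nhds hx))
  set u : ℝ → ℝ := fun x => ∫ s in (0 : ℝ)..x, k s with hu
  have hdu := key k hk
  have hcu : ContinuousOn u (Ioo (-r) r) := HasDerivAt.continuousOn hdu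
  set e : ℝ → ℝ := fun x => Real.exp (3 * x + u x) with he
  have hde := key e (by fun_prop)
  refine ⟨u, fun x => Real.exp (-(3 * x + u x)) * (w + (4 - 3 * γ) * ∫ s in (0 : ℝ)..x, e s),
    hk, by simp [hu], by simp [hu], hdu, fun x hx => ?_⟩
  have hdu' : HasDerivAt u (k x) x := hdu x hx
  have h := ((((hasDerivAt_id x).const_mul 3).add hdu').neg.exp).mul
    (((hde x hx).const_mul (4 - 3 * γ)).const_add w)
  refine h.congr_deriv ?_
  have hE : Real.exp (-(3 * x + u x)) * e x = 1 := by rw [he, ← Real.exp_add]; simp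
  simp only [Pi.neg_apply, Pi.add_apply, id]
  linear_combination (4 - 3 * γ) * hE

end

section

open MeasureTheory unitInterval ContDiff

variable {γ w : ℝ}

/-! ### Local existence and uniqueness at the sonic point -/

lemma dilate_coe_apply (f : C(I, ℝ)) (s z : I) : dilate f s z = f (s * z) := dilate_apply f s.2 z

lemma avg_dilate (f : C(I, ℝ)) (s : I) : avg (dilate f s) = dilate (avg f) s := by
  ext z
  rw [dilate_coe_apply, avg_apply, avg_apply]
  refine intervalIntegral.integral_congr fun t ht => ?_
  rw [uIcc_of_le zero_le_one] at ht
  simp only [dilate_apply _ ht, dilate_coe_apply]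
  congr 1
  rw [mul_left_comm]

lemma dilate_mul (f g : C(I, ℝ)) (s : ℝ) : dilate (f * g) s = dilate f s * dilate g s := rfl

lemma dilate_add (f g : C(I, ℝ)) (s : ℝ) : dilate (f + g) s = dilate f s + dilate g s := rfl

lemma dilate_sub (f g : C(I, ℝ)) (s : ℝ) : dilate (f - g) s = dilate f s - dilate g s := rfl

lemma dilate_neg (f : C(I, ℝ)) (s : ℝ) : dilate (-f) s = -dilate f s := rfl

lemma dilate_smul (a : ℝ) (f : C(I, ℝ)) (s : ℝ) : dilate (a • f) s = a • dilate f s := rfl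

lemma dilate_one (s : ℝ) : dilate 1 s = 1 := rfl

lemma dilate_exp (f : C(I, ℝ)) (s : ℝ) :
    dilate (NormedSpace.exp f) s = NormedSpace.exp (dilate f s) := by
  ext z
  rw [exp_apply]
  exact exp_apply _ _

lemma dilate_xC (ε : ℝ) (s : I) : dilate (xC ε) s = xC (s * ε) := by
  ext z
  rw [dilate_coe_apply, xC_apply, xC_apply]
  simp; ring

/-- Shrinking the interval by `s` replaces `k` by its dilation and `ε` by `s ε`. This covariance is
what turns the solutions obtained separately for each `ε` into restrictions of one function of `x`.
-/
lemma sonicEq_dilate (ε : ℝ) (k : C(I, ℝ)) (s : I) :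
    sonicEq γ ((s * ε, w), dilate k s) = dilate (sonicEq γ ((ε, w), k)) s := by
  have hu : uC (s * ε) (dilate k s) = dilate (uC ε k) s := by
    simp only [uC, dilate_mul, avg_dilate, dilate_xC]
  have ho : omC γ (s * ε) w (dilate k s) = dilate (omC γ ε w k) s := by
    simp only [omC, dilate_mul, dilate_add, dilate_smul, dilate_one, dilate_exp, dilate_neg,
      ← avg_dilate, dilate_xC, hu]
  have hd : domC γ (s * ε) w (dilate k s) = dilate (domC γ ε w k) s := by
    simp only [domC, dilate_mul, dilate_sub, dilate_smul, dilate_one, ho]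
  have hG : dGC γ (s * ε) w (dilate k s) = dilate (dGC γ ε w k) s := by
    simp only [dGC, dilate_mul, dilate_sub, dilate_add, dilate_smul, dilate_exp, dilate_xC,
      hu, ho, hd]
  have hH : dHC γ (s * ε) w (dilate k s) = dilate (dHC γ ε w k) s := by
    simp only [dHC, dilate_mul, dilate_sub, dilate_add, dilate_smul, dilate_one, dilate_exp,
      hu, ho, hd]
  simp only [sonicEq, dilate_mul, dilate_sub, dilate_smul, dilate_exp, dilate_xC, ← avg_dilate,
    hG, hH]

/-- A solution of the normalized system in logarithmic variables, on `(-r, r)`, which at the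
origin has a sonic point of Larson-Penston-Hunter type. -/
structure IsLogLPH (γ w r : ℝ) (k u om : ℝ → ℝ) : Prop extends IsLogSol γ w r k u om where
  k_zero : k 0 = R₁ γ w
  eqn : ∀ x ∈ Ioo (-r) r,
    w * k x * Gn γ w x (u x) (om x) = Real.exp (2 * x) * hn γ w (u x) (om x)

lemma sonicEq_R₁ (hγ : γ ∈ Ioo (1 : ℝ) (4 / 3)) (hw : w ∈ Icc (omegaF γ) (2 - γ)) :
    sonicEq γ ((0, w), R₁ γ w • 1) = 0 := by
  have hw0 : 0 < w := (omegaF_pos hγ).trans_le hw.1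
  rw [sonicEq_zero_const hw0, quad_R₁ (by linarith [hγ.1]) hw0 (discr_pos hγ hw).le, mul_zero,
    zero_smul]

/-- The solution of the rescaled equation, given by the implicit function theorem. -/
lemma exists_implicit (hγ : γ ∈ Ioo (1 : ℝ) (4 / 3)) (hw : w ∈ Icc (omegaF γ) (2 - γ)) :
    ∃ φ : ℝ × ℝ → C(I, ℝ), φ (0, w) = R₁ γ w • 1 ∧ ContDiffAt ℝ ω φ (0, w) ∧
      (∀ᶠ p in 𝓝 ((0 : ℝ), w), sonicEq γ (p, φ p) = 0) ∧
      ∀ᶠ v in 𝓝 (((0 : ℝ), w), R₁ γ w • (1 : C(I, ℝ))), sonicEq γ v = 0 ↔ φ v.1 = v.2 := by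
  have hc : ContDiffAt ℝ ω (sonicEq γ) ((0, w), R₁ γ w • 1) := contDiff_sonicEq.contDiffAt
  have hinv := isInvertible_fderiv_sonicEq hγ hw
  have h0 := sonicEq_R₁ hγ hw
  refine ⟨hc.implicitFunction (by simp) hinv, hc.implicitFunction_apply_self (by simp) hinv,
    hc.contDiffAt_implicitFunction (by simp) hinv, ?_, ?_⟩
  · simpa only [h0] using hc.eventually_apply_implicitFunction (by simp) hinv
  · simpa only [h0] using hc.eventually_apply_eq_iff_implicitFunction (by simp) hinv

/-- Away from `z = 0` one divides by `ε z`; at `z = 0`, where this is impossible, the equation is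
the quadratic one satisfied by `R₁`. -/
lemma IsLogLPH.sonicEq_eq_zero {r ε : ℝ} {k u om : ℝ → ℝ} (hγ : 0 < γ + 1) (hw : 0 < w)
    (hs : 0 ≤ discr γ w) (H : IsLogLPH γ w r k u om) (hε : ε ∈ Ioo (-r) r) (hε0 : ε ≠ 0)
    {F : C(I, ℝ)} (hF : ∀ z : I, F z = k (ε * z)) : sonicEq γ ((ε, w), F) = 0 := by
  ext z
  by_cases hz : z = 0
  · rw [hz, IsLogSol.sonicEq_apply_zero hw, hF]
    simp [H.k_zero, quad_R₁ hγ hw hs]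
  · have h := H.sonicEq_apply hε hF z
    rw [H.eqn _ (mul_mem_Ioo hε z), sub_self] at h
    exact (mul_eq_zero.1 h).resolve_left (mul_ne_zero hε0 fun h => hz (Subtype.ext h))

/-- The rescaled functions `z ↦ k (ε z)` converge to `k 0`. -/
lemma eventually_exists_rescale {r : ℝ} {k : ℝ → ℝ} (hr : 0 < r) (hk : ContinuousOn k (Ioo (-r) r)) :
    ∀ η > 0, ∀ᶠ ε in 𝓝 (0 : ℝ), ∃ F : C(I, ℝ), (∀ z : I, F z = k (ε * z)) ∧
      dist F (k 0 • 1) < η := by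
  intro η hη
  have h0 : (0 : ℝ) ∈ Ioo (-r) r := by constructor <;> linarith
  have hc := hk.continuousAt (isOpen_Ioo.mem_nhds h0)
  obtain ⟨d, hd, h⟩ := Metric.continuousAt_iff.1 hc η hη
  have h1 : Ioo (-(min d r)) (min d r) ∈ 𝓝 (0 : ℝ) := by
    apply isOpen_Ioo.mem_nhds
    have := lt_min hd hr
    constructor <;> linarith
  filter_upwards [h1] with ε hε
  have hεr : ε ∈ Ioo (-r) r :=
    Ioo_subset_Ioo (neg_le_neg (min_le_right _ _)) (min_le_right _ _) hε
  have hεd : ε ∈ Ioo (-d) d :=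
    Ioo_subset_Ioo (neg_le_neg (min_le_left _ _)) (min_le_left _ _) hε
  refine ⟨⟨fun z : I => k (ε * z), hk.comp_continuous (by fun_prop) (mul_mem_Ioo hεr)⟩,
    fun z => rfl, ?_⟩
  rw [ContinuousMap.dist_lt_iff hη]
  intro z
  have := h (x := ε * z) (by
    have := mul_mem_Ioo hεd z
    rw [Real.dist_eq, sub_zero, abs_lt]; exact this)
  simpa using this

/-- Solutions of Larson-Penston-Hunter type are unique near the sonic point. -/
theorem IsLogLPH.eventually_eq {r₁ r₂ : ℝ} {k₁ u₁ om₁ k₂ u₂ om₂ : ℝ → ℝ}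
    (hγ : γ ∈ Ioo (1 : ℝ) (4 / 3)) (hw : w ∈ Icc (omegaF γ) (2 - γ)) (hr₁ : 0 < r₁) (hr₂ : 0 < r₂)
    (H₁ : IsLogLPH γ w r₁ k₁ u₁ om₁) (H₂ : IsLogLPH γ w r₂ k₂ u₂ om₂) :
    ∀ᶠ x in 𝓝 0, k₁ x = k₂ x ∧ u₁ x = u₂ x ∧ om₁ x = om₂ x := by
  have hw0 : 0 < w := (omegaF_pos hγ).trans_le hw.1
  obtain ⟨φ, -, -, -, hφ⟩ := exists_implicit hγ hw
  rw [nhds_prod_eq, eventually_prod_iff] at hφ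
  obtain ⟨pa, hpa, pb, hpb, hφ⟩ := hφ
  obtain ⟨η, hη, hpb⟩ := Metric.eventually_nhds_iff.1 hpb
  have hpa' : ∀ᶠ ε in 𝓝 (0 : ℝ), pa (ε, w) := by
    have : Tendsto (fun ε : ℝ => (ε, w)) (𝓝 0) (𝓝 (0, w)) := by
      apply Continuous.tendsto' (by fun_prop); rfl
    exact this.eventually hpa
  have hIoo : ∀ r : ℝ, 0 < r → ∀ᶠ ε in 𝓝 (0 : ℝ), ε ∈ Ioo (-r) r := fun r hr =>
    isOpen_Ioo.mem_nhds (by constructor <;> linarith)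
  filter_upwards [hpa', eventually_exists_rescale hr₁ H₁.cont η hη,
    eventually_exists_rescale hr₂ H₂.cont η hη, hIoo _ hr₁, hIoo _ hr₂]
    with ε h1 ⟨F₁, hF₁, hd₁⟩ ⟨F₂, hF₂, hd₂⟩ hε₁ hε₂
  rcases eq_or_ne ε 0 with rfl | hε0
  · simp [H₁.k_zero, H₂.k_zero, H₁.u_zero, H₂.u_zero, H₁.om_zero, H₂.om_zero]
  rw [H₁.k_zero] at hd₁
  rw [H₂.k_zero] at hd₂
  have hs := (discr_pos hγ hw).le
  have hγ' : 0 < γ + 1 := by linarith [hγ.1]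
  have e₁ := (hφ h1 (hpb hd₁)).1 (H₁.sonicEq_eq_zero hγ' hw0 hs hε₁ hε0 hF₁)
  have e₂ := (hφ h1 (hpb hd₂)).1 (H₂.sonicEq_eq_zero hγ' hw0 hs hε₂ hε0 hF₂)
  simp only at e₁ e₂
  obtain rfl : F₁ = F₂ := e₁.symm.trans e₂
  have hk := (hF₁ 1).symm.trans (hF₂ 1)
  have hu := (H₁.uC_apply hε₁ hF₁ 1).symm.trans (H₂.uC_apply hε₂ hF₂ 1)
  have ho := (H₁.omC_apply hε₁ hF₁ 1).symm.trans (H₂.omC_apply hε₂ hF₂ 1)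
  simp only [Icc.coe_one, mul_one] at hk hu ho
  exact ⟨hk, hu, ho⟩

lemma contDiffAt_eval_one {φ : ℝ × ℝ → C(I, ℝ)} {p : ℝ × ℝ} (hp : ContDiffAt ℝ ω φ p) :
    ContDiffAt ℝ ω (fun p => φ p 1) p ∧ ContDiffAt ℝ ω (fun p => uC p.1 (φ p) 1) p
      ∧ ContDiffAt ℝ ω (fun p => omC γ p.1 p.2 (φ p) 1) p := by
  have ev : ContDiff ℝ ω (fun f : C(I, ℝ) => f 1) :=
    (ContinuousMap.evalCLM ℝ (1 : I) : C(I, ℝ) →L[ℝ] ℝ).contDiff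
  have hp' : ContDiffAt ℝ ω (fun p => (p, φ p)) p := contDiffAt_id.prodMk hp
  have h2 : ContDiffAt ℝ ω (fun p => uC p.1 (φ p)) p :=
    ContDiffAt.comp (g := fun q : (ℝ × ℝ) × C(I, ℝ) => uC q.1.1 q.2) (f := fun p => (p, φ p)) p
      contDiff_uC.contDiffAt hp'
  have h3 : ContDiffAt ℝ ω (fun p => omC γ p.1 p.2 (φ p)) p :=
    ContDiffAt.comp (g := fun q : (ℝ × ℝ) × C(I, ℝ) => omC γ q.1.1 q.1.2 q.2)
      (f := fun p => (p, φ p)) p contDiff_omC.contDiffAt hp'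
  exact ⟨ev.comp_contDiffAt p hp, ev.comp_contDiffAt p h2, ev.comp_contDiffAt p h3⟩

/-- Near a sonic point there is an analytic family of solutions of Larson-Penston-Hunter type,
parametrized by the relative velocity at the sonic point. -/
theorem exists_isLogLPH_family (hγ : γ ∈ Ioo (1 : ℝ) (4 / 3))
    (hw : w ∈ Icc (omegaF γ) (2 - γ)) :
    ∃ K U Om : ℝ × ℝ → ℝ, ∃ r > 0,
      (∀ p ∈ Ioo (-r) r ×ˢ Ioo (w - r) (w + r), AnalyticAt ℝ K p ∧ AnalyticAt ℝ U p ∧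
        AnalyticAt ℝ Om p) ∧
      ∀ v ∈ Ioo (w - r) (w + r),
        IsLogLPH γ v r (fun x => K (x, v)) (fun x => U (x, v)) (fun x => Om (x, v)) ∧
        ∀ x ∈ Ioo (-r) 0, 0 < Gn γ v x (U (x, v)) (Om (x, v)) := by
  have hw0 : 0 < w := (omegaF_pos hγ).trans_le hw.1
  obtain ⟨φ, hφ0, hφc, hφ, hφu⟩ := exists_implicit hγ hw
  rw [nhds_prod_eq, eventually_prod_iff] at hφu
  obtain ⟨pa, hpa, pb, hpb, hφu⟩ := hφu
  obtain ⟨η, hη, hpb⟩ := Metric.eventually_nhds_iff.1 hpb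
  have hφη : ∀ᶠ p in 𝓝 ((0 : ℝ), w), dist (φ p) (R₁ γ w • 1) < η := by
    have := hφc.continuousAt
    rw [ContinuousAt, hφ0] at this
    exact this.eventually (Metric.ball_mem_nhds _ hη)
  have hRη : ∀ᶠ p in 𝓝 ((0 : ℝ), w), dist (R₁ γ p.2 • (1 : C(I, ℝ))) (R₁ γ w • 1) < η := by
    have hc : ContinuousAt (fun p : ℝ × ℝ => R₁ γ p.2 • (1 : C(I, ℝ))) (0, w) :=
      (ContinuousAt.comp (g := R₁ γ) (f := Prod.snd) (continuousAt_R₁ (by linarith [hγ.1]) hw0)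
        continuousAt_snd).smul continuousAt_const
    exact hc.eventually (Metric.ball_mem_nhds _ hη)
  have hdpos : ∀ᶠ p in 𝓝 ((0 : ℝ), w), 0 < p.2 ∧ 0 < discr γ p.2 := by
    have hc1 : ContinuousAt (fun p : ℝ × ℝ => p.2) (0, w) := continuousAt_snd
    have hc2 : ContinuousAt (fun p : ℝ × ℝ => discr γ p.2) (0, w) := by
      unfold discr; fun_prop
    exact (hc1.eventually (lt_mem_nhds hw0)).and
      (hc2.eventually (lt_mem_nhds (discr_pos hγ hw)))
  have hcd : ∀ᶠ p in 𝓝 ((0 : ℝ), w), ContDiffAt ℝ ω φ p := hφc.eventually (by simp)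
  set K : ℝ × ℝ → ℝ := fun p => φ p 1 with hK
  set U : ℝ × ℝ → ℝ := fun p => uC p.1 (φ p) 1 with hU
  set Om : ℝ × ℝ → ℝ := fun p => omC γ p.1 p.2 (φ p) 1 with hOm
  have hcdK : ∀ p, ContDiffAt ℝ ω φ p → ContDiffAt ℝ ω K p ∧ ContDiffAt ℝ ω U p
      ∧ ContDiffAt ℝ ω Om p := by
    intro p hp
    exact contDiffAt_eval_one hp
  obtain ⟨cK, cU, cO⟩ := hcdK _ hφc
  have hU0 : ∀ v, U (0, v) = 0 := fun v => by simp [hU, uC, xC_apply]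
  have hO0 : ∀ v, Om (0, v) = v := fun v => by
    simp [hOm, omC, exp_apply, uC, xC_apply]
  have hK0 : K (0, w) = R₁ γ w := by simp [hK, hφ0]
  -- `D` is the `x`-derivative of `Gn` along the family and equals `lam γ w < 0` at the base point.
  -- Its negativity nearby makes `Gn` positive to the left of the sonic point.
  set D : ℝ × ℝ → ℝ := fun p => (γ - 1) * p.2 ^ 2 * (Real.exp ((γ - 1) * U p) * K p)
    - 2 * (Real.exp (2 * p.1) * (Om p * Om p + Om p * (4 - 3 * γ - 3 * Om p - Om p * K p)))
    with hD
  have hDneg : ∀ᶠ p in 𝓝 ((0 : ℝ), w), D p < 0 := by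
    have hc : ContinuousAt D (0, w) := by
      have := cK.continuousAt
      have := cU.continuousAt
      have := cO.continuousAt
      fun_prop
    refine hc.eventually (gt_mem_nhds ?_)
    have hl := lam_neg hγ hw
    have : D (0, w) = lam γ w := by
      simp only [hD, hU0, hO0, hK0, lam]
      simp
      ring
    rwa [this]
  obtain ⟨r, hr, hbox⟩ := Metric.eventually_nhds_iff.1
    (hφ.and (hφη.and (hRη.and (hdpos.and (hcd.and (hpa.and hDneg))))))
  have hbox' : ∀ x ∈ Ioo (-r) r, ∀ v ∈ Ioo (w - r) (w + r), dist (x, v) ((0 : ℝ), w) < r := by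
    intro x hx v hv
    rw [Prod.dist_eq, max_lt_iff, Real.dist_eq, Real.dist_eq, abs_lt, abs_lt]
    refine ⟨⟨?_, ?_⟩, ?_, ?_⟩ <;> linarith [hx.1, hx.2, hv.1, hv.2]
  refine ⟨K, U, Om, r, hr, ?_, ?_⟩
  · rintro ⟨x, v⟩ ⟨hx, hv⟩
    obtain ⟨h1, h2, h3⟩ := hcdK _ (hbox (hbox' x hx v hv)).2.2.2.2.1
    exact ⟨h1.analyticAt, h2.analyticAt, h3.analyticAt⟩
  intro v hv
  have h0r : (0 : ℝ) ∈ Ioo (-r) r := by constructor <;> linarith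
  -- the rescaling property
  have hscale : ∀ ε ∈ Ioo (-r) r, ∀ z : I, φ (ε, v) z = K (ε * z, v) := by
    intro ε hε s
    have hb := hbox (hbox' ε hε v hv)
    have hb' := hbox (hbox' (s * ε) (by rw [mul_comm]; exact mul_mem_Ioo hε s) v hv)
    -- The dilation of `φ (ε, v)` solves the equation for the parameter `s ε` and, dilation being a
    -- contraction, stays near the base point; local uniqueness identifies it with `φ (s ε, v)`.
    have h1 : sonicEq γ ((s * ε, v), dilate (φ (ε, v)) s) = 0 := by
      rw [sonicEq_dilate, hb.1]
      rfl
    have h2 : dist (dilate (φ (ε, v)) s) (R₁ γ w • 1) < η := by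
      have : dilate (φ (ε, v)) s - R₁ γ w • 1 = dilate (φ (ε, v) - R₁ γ w • 1) s := rfl
      rw [dist_eq_norm, this]
      refine (norm_dilate_le _ _).trans_lt ?_
      rw [← dist_eq_norm]
      exact hb.2.1
    have h3 := (hφu hb'.2.2.2.2.2.1 (hpb h2)).1 h1
    simp only at h3
    simp only [hK, mul_comm ε, h3, dilate_coe_apply, mul_one]
  have hKc : ContinuousOn (fun x => K (x, v)) (Ioo (-r) r) := by
    intro x hx
    have h := (hcdK _ (hbox (hbox' x hx v hv)).2.2.2.2.1).1.continuousAt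
    exact (ContinuousAt.comp (f := fun x : ℝ => (x, v)) h (by fun_prop)).continuousWithinAt
  obtain ⟨u, om, H⟩ := exists_isLogSol γ v hr hKc
  have hu : ∀ x ∈ Ioo (-r) r, U (x, v) = u x := fun x hx => by
    simpa using H.uC_apply hx (hscale x hx) 1
  have ho : ∀ x ∈ Ioo (-r) r, Om (x, v) = om x := fun x hx => by
    simpa using H.omC_apply hx (hscale x hx) 1
  have hnear : ∀ x ∈ Ioo (-r) r, ∀ᶠ y in 𝓝 x, U (y, v) = u y ∧ Om (y, v) = om y :=
    fun x hx => by
      filter_upwards [isOpen_Ioo.mem_nhds hx] with y hy using ⟨hu y hy, ho y hy⟩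
  have H' : IsLogSol γ v r (fun x => K (x, v)) (fun x => U (x, v)) (fun x => Om (x, v)) := by
    refine ⟨hKc, hU0 v, hO0 v, fun x hx => ?_, fun x hx => ?_⟩
    · exact (H.deriv_u x hx).congr_of_eventuallyEq ((hnear x hx).mono fun y h => h.1)
    · simp only [ho x hx]
      exact (H.deriv_om x hx).congr_of_eventuallyEq ((hnear x hx).mono fun y h => h.2)
  refine ⟨⟨H', ?_, fun x hx => ?_⟩, fun x hx => ?_⟩
  · have hb := hbox (hbox' 0 h0r v hv)
    -- The implicit function is pinned to `R₁` only at `w`; for nearby `v` the constant `R₁ γ v` is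
    -- also a solution close to the base point, so uniqueness applies again.
    have h1 : sonicEq γ ((0, v), R₁ γ v • 1) = 0 := by
      rw [sonicEq_zero_const hb.2.2.2.1.1, quad_R₁ (by linarith [hγ.1]) hb.2.2.2.1.1
        hb.2.2.2.1.2.le, mul_zero, zero_smul]
    have h2 := (hφu hb.2.2.2.2.2.1 (hpb hb.2.2.1)).1 h1
    simp only at h2
    simp [hK, h2]
  · have hb := hbox (hbox' x hx v hv)
    have h1 := H'.sonicEq_apply hx (hscale x hx) 1
    rw [hb.1] at h1
    simp only [ContinuousMap.zero_apply, mul_zero, Icc.coe_one, mul_one] at h1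
    linarith
  · have hanti : StrictAntiOn (fun x => Gn γ v x (U (x, v)) (Om (x, v))) (Ioo (-r) r) := by
      refine strictAntiOn_of_deriv_neg (convex_Ioo _ _)
        (HasDerivAt.continuousOn fun x hx => H'.deriv_Gn hx) fun y hy => ?_
      rw [interior_Ioo] at hy
      rw [(H'.deriv_Gn hy).deriv]
      exact (hbox (hbox' y hy v hv)).2.2.2.2.2.2
    have := hanti ⟨hx.1, hx.2.trans hr⟩ h0r hx.2
    have h0 := H'.Gn_zero
    simp only at h0 this
    rwa [h0] at this

end

section

/-! ### Uniqueness and stability for ordinary differential equations -/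

open scoped NNReal

/-- Two solutions of an ordinary differential equation with a continuously differentiable right-hand
side which agree at a point agree on the whole interval. -/
theorem eqOn_of_hasDerivAt {E : Type*} [NormedAddCommGroup E] [NormedSpace ℝ E]
    {U : Set (ℝ × E)} {f : ℝ × E → E} (hf : ∀ p ∈ U, ContDiffAt ℝ 1 f p) {a b y₀ : ℝ}
    {v₁ v₂ : ℝ → E} (h₀ : y₀ ∈ Ioo a b)
    (h₁ : ∀ y ∈ Ioo a b, HasDerivAt v₁ (f (y, v₁ y)) y ∧ (y, v₁ y) ∈ U)
    (h₂ : ∀ y ∈ Ioo a b, HasDerivAt v₂ (f (y, v₂ y)) y ∧ (y, v₂ y) ∈ U) (heq : v₁ y₀ = v₂ y₀) :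
    EqOn v₁ v₂ (Ioo a b) := by
  have hloc : ∀ y ∈ Ioo a b, v₁ y = v₂ y → v₁ =ᶠ[𝓝 y] v₂ := by
    intro y hy he
    obtain ⟨K, s, hs, hL⟩ := (hf _ (h₁ y hy).2).exists_lipschitzOnWith
    have hc1 : ContinuousAt (fun z => (z, v₁ z)) y :=
      continuousAt_id.prodMk (h₁ y hy).1.continuousAt
    have hc2 : ContinuousAt (fun z => (z, v₂ z)) y :=
      continuousAt_id.prodMk (h₂ y hy).1.continuousAt
    refine ODE_solution_unique_of_eventually (v := fun z p => f (z, p))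
      (s := fun z => {p | (z, p) ∈ s}) (K := K) (Eventually.of_forall fun z => ?_) ?_ ?_ he
    · intro p hp q hq
      have := hL hp hq
      simpa [Prod.edist_eq] using this
    · filter_upwards [isOpen_Ioo.mem_nhds hy, hc1 hs] with z hz hzs
      exact ⟨(h₁ z hz).1, hzs⟩
    · rw [he] at hs
      filter_upwards [isOpen_Ioo.mem_nhds hy, hc2 hs] with z hz hzs
      exact ⟨(h₂ z hz).1, hzs⟩
  -- The points near which the solutions agree form an open set, relatively closed by continuity and
  -- local uniqueness; connectedness finishes.
  have hsub : Ioo a b ⊆ {y | v₁ =ᶠ[𝓝 y] v₂} := by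
    refine isPreconnected_Ioo.subset_of_closure_inter_subset isOpen_setOfPred_eventually_nhds
      ⟨y₀, h₀, hloc y₀ h₀ heq⟩ ?_
    rintro y ⟨hy, hyI⟩
    refine hloc y hyI ?_
    have hfr : ∃ᶠ z in 𝓝 y, v₁ z = v₂ z :=
      (mem_closure_iff_frequently.1 hy).mono fun z hz => hz.self_of_nhds
    have hc : ContinuousAt (fun z => v₁ z - v₂ z) y :=
      (h₁ y hyI).1.continuousAt.sub (h₂ y hyI).1.continuousAt
    by_contra hne
    have := hc.eventually_ne (sub_ne_zero.2 hne)
    exact hfr (this.mono fun z hz h => hz (sub_eq_zero.2 h))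
  exact fun y hy => (hsub hy).self_of_nhds

/-- The projection onto the ball of radius `δ` of the plane with the supremum norm. -/
def clamp (δ : ℝ) (hδ : 0 ≤ δ) (q : ℝ × ℝ) : ℝ × ℝ :=
  (projIcc (-δ) δ (by linarith) q.1, projIcc (-δ) δ (by linarith) q.2)

lemma lipschitzWith_clamp {δ : ℝ} (hδ : 0 ≤ δ) : LipschitzWith 1 (clamp δ hδ) := by
  have hδ' : -δ ≤ δ := by linarith
  have h : LipschitzWith (1 * 1) (Subtype.val ∘ projIcc (-δ) δ hδ') :=
    (LipschitzWith.subtype_val _).comp (LipschitzWith.projIcc hδ')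
  have h' := (h.comp LipschitzWith.prod_fst).prodMk (h.comp LipschitzWith.prod_snd)
  simp only [mul_one, max_self] at h'
  exact h'

lemma norm_clamp_le {δ : ℝ} (hδ : 0 ≤ δ) (q : ℝ × ℝ) : ‖clamp δ hδ q‖ ≤ δ := by
  rw [clamp, Prod.norm_def, max_le_iff]
  exact ⟨abs_le.2 (projIcc (-δ) δ (by linarith) q.1).2, abs_le.2 (projIcc (-δ) δ (by linarith) q.2).2⟩

lemma clamp_of_norm_le {δ : ℝ} (hδ : 0 ≤ δ) {q : ℝ × ℝ} (hq : ‖q‖ ≤ δ) : clamp δ hδ q = q := by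
  rw [Prod.norm_def, max_le_iff] at hq
  rw [clamp, projIcc_of_mem _ (abs_le.1 hq.1), projIcc_of_mem _ (abs_le.1 hq.2)]

/-- Stability of solutions of ordinary differential equations on compact intervals under
perturbations of the value at the right endpoint. -/
theorem exists_solution_near {U : Set (ℝ × (ℝ × ℝ))} {f : ℝ × (ℝ × ℝ) → ℝ × ℝ} (hU : IsOpen U)
    (hf : ∀ p ∈ U, ContDiffAt ℝ 1 f p) {a b : ℝ} (hab : a ≤ b) {v₀ : ℝ → ℝ × ℝ}
    (h₀ : ∀ y ∈ Icc a b, HasDerivWithinAt v₀ (f (y, v₀ y)) (Icc a b) y ∧ (y, v₀ y) ∈ U)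
    {ε : ℝ} (hε : 0 < ε) :
    ∃ δ > 0, ∀ q, dist q (v₀ b) < δ → ∃ v : ℝ → ℝ × ℝ, v b = q ∧
      ∀ y ∈ Icc a b, HasDerivWithinAt v (f (y, v y)) (Icc a b) y ∧ (y, v y) ∈ U ∧
        dist (v y) (v₀ y) < ε := by
  have hc₀ : ContinuousOn v₀ (Icc a b) := HasDerivWithinAt.continuousOn fun y hy => (h₀ y hy).1
  have hcg : ContinuousOn (fun y => (y, v₀ y)) (Icc a b) := continuousOn_id.prodMk hc₀
  have hcomp : IsCompact ((fun y => (y, v₀ y)) '' Icc a b) := isCompact_Icc.image_of_continuousOn hcg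
  obtain ⟨d, hd, hdU⟩ := hcomp.exists_cthickening_subset_open hU (by
    rintro _ ⟨y, hy, rfl⟩; exact (h₀ y hy).2)
  set T := Metric.cthickening d ((fun y => (y, v₀ y)) '' Icc a b) with hT
  have hTc : IsCompact T := hcomp.cthickening
  have hmem : ∀ y ∈ Icc a b, ∀ q : ℝ × ℝ, dist q (v₀ y) ≤ d → (y, q) ∈ T := by
    intro y hy q hq
    refine Metric.mem_cthickening_of_dist_le (y, q) (y, v₀ y) d _ ⟨y, hy, rfl⟩ ?_
    simpa [Prod.dist_eq, hd.le] using hq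
  have hfc : ContinuousOn f T := fun p hp => (hf p (hdU hp)).continuousAt.continuousWithinAt
  have hfc' : ContinuousOn (fderiv ℝ f) T := fun p hp =>
    ((hf p (hdU hp)).continuousAt_fderiv (by simp)).continuousWithinAt
  obtain ⟨M, hM⟩ := hTc.exists_bound_of_continuousOn hfc
  obtain ⟨L, hL⟩ := hTc.exists_bound_of_continuousOn hfc'
  have hT0 : (a, v₀ a) ∈ T := hmem a (left_mem_Icc.2 hab) _ (by simpa using hd.le)
  have hM0 : 0 ≤ M := (norm_nonneg _).trans (hM _ hT0)
  have hL0 : 0 ≤ L := (norm_nonneg _).trans (hL _ hT0)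
  lift M to ℝ≥0 using hM0
  lift L to ℝ≥0 using hL0
  have hLip : ∀ y ∈ Icc a b, LipschitzOnWith L (fun q => f (y, q)) (Metric.closedBall (v₀ y) d) := by
    intro y hy
    refine Convex.lipschitzOnWith_of_nnnorm_hasFDerivWithin_le (𝕜 := ℝ)
      (f' := fun q => (fderiv ℝ f (y, q)).comp (.inr ℝ ℝ (ℝ × ℝ))) (fun q hq => ?_)
      (fun q hq => ?_) (convex_closedBall _ _)
    · exact (((hf _ (hdU (hmem y hy q hq))).differentiableAt (by simp)).hasFDerivAt.comp q
        (hasFDerivAt_prodMk_right y q)).hasFDerivWithinAt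
    · rw [← NNReal.coe_le_coe, coe_nnnorm]
      refine (ContinuousLinearMap.opNorm_comp_le _ _).trans ?_
      refine (mul_le_of_le_one_right (norm_nonneg _) ?_).trans (hL _ (hmem y hy q hq))
      exact ContinuousLinearMap.norm_inr_le_one ℝ ℝ (ℝ × ℝ)
  -- Truncating the state around the reference solution gives a bounded, globally Lipschitz field,
  -- so Picard-Lindelöf works on the whole interval. The truncation is inactive for solutions
  -- staying within `d` of `v₀`.
  set F : ℝ → ℝ × ℝ → ℝ × ℝ := fun y q => f (y, v₀ y + clamp d hd.le (q - v₀ y)) with hF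
  have hball : ∀ y q, v₀ y + clamp d hd.le (q - v₀ y) ∈ Metric.closedBall (v₀ y) d := by
    intro y q
    rw [Metric.mem_closedBall, dist_eq_norm, add_sub_cancel_left]
    exact norm_clamp_le _ _
  have hFLip : ∀ y ∈ Icc a b, LipschitzWith L (F y) := by
    intro y hy
    have h1 : LipschitzWith 1 (fun q => v₀ y + clamp d hd.le (q - v₀ y)) := by
      refine LipschitzWith.of_dist_le_mul fun p q => ?_
      have := (lipschitzWith_clamp hd.le).dist_le_mul (p - v₀ y) (q - v₀ y)
      simpa using this
    refine LipschitzWith.of_dist_le_mul fun p q => ?_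
    refine ((hLip y hy).dist_le_mul _ (hball y p) _ (hball y q)).trans ?_
    gcongr
    simpa using h1.dist_le_mul p q
  -- Speed at most `M` and initial data within distance `1` keep every solution in the ball of
  -- radius `1 + M (b - a)`.
  have hPL : IsPicardLindelof F (tmin := a) (tmax := b) ⟨b, right_mem_Icc.2 hab⟩ (v₀ b)
      (1 + M * (b - a).toNNReal) 1 M L := by
    refine ⟨fun y hy => (hFLip y hy).lipschitzOnWith, fun q _ => ?_, fun y hy q _ => ?_, ?_⟩
    · refine hfc.comp (continuousOn_id.prodMk (hc₀.add ?_)) fun y hy => hmem y hy _ (hball y q)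
      exact (lipschitzWith_clamp hd.le).continuous.comp_continuousOn (continuousOn_const.sub hc₀)
    · exact hM _ (hmem y hy _ (hball y q))
    · simp [hab]
  obtain ⟨α, hα, L', hα'⟩ := hPL.exists_forall_mem_closedBall_eq_hasDerivWithinAt_lipschitzOnWith
  have hself : EqOn (α (v₀ b)) v₀ (Icc a b) := by
    obtain ⟨h1, h2⟩ := hα (v₀ b) (Metric.mem_closedBall_self (by simp))
    have hwiden : ∀ {v : ℝ → ℝ × ℝ} {v'}, ∀ y ∈ Ioc a b, HasDerivWithinAt v v' (Icc a b) y →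
        HasDerivWithinAt v v' (Iic y) y := by
      intro v v' y hy h
      exact (h.mono (Icc_subset_Icc_right hy.2)).mono_of_mem_nhdsWithin (Icc_mem_nhdsLE hy.1)
    refine ODE_solution_unique_of_mem_Icc_left (v := F) (s := fun _ => univ) (K := L)
      (fun y hy => (hFLip y (Ioc_subset_Icc_self hy)).lipschitzOnWith)
      (HasDerivWithinAt.continuousOn h2) (fun y hy => hwiden y hy (h2 y (Ioc_subset_Icc_self hy)))
      (fun _ _ => mem_univ _) hc₀ (fun y hy => ?_) (fun _ _ => mem_univ _) h1
    have h3 : F y (v₀ y) = f (y, v₀ y) := by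
      simp only [hF, sub_self]
      rw [clamp_of_norm_le hd.le (by simpa using hd.le), add_zero]
    rw [h3]
    exact hwiden y hy (h₀ y (Ioc_subset_Icc_self hy)).1
  set η := min d ε with hη
  have hη0 : 0 < η := lt_min hd hε
  refine ⟨min 1 (η / (L' + 1)), lt_min one_pos (by positivity), fun q hq => ?_⟩
  obtain ⟨hq1, hq2⟩ := lt_min_iff.1 hq
  have hqb : q ∈ Metric.closedBall (v₀ b) ((1 : ℝ≥0) : ℝ) := by
    simpa using hq1.le
  obtain ⟨h1, h2⟩ := hα q hqb
  refine ⟨α q, h1, fun y hy => ?_⟩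
  have hdist : dist (α q y) (v₀ y) < η := by
    have := (hα' y hy).dist_le_mul q hqb (v₀ b) (Metric.mem_closedBall_self (by simp))
    simp only [hself hy] at this
    refine this.trans_lt ?_
    rw [lt_div_iff₀ (by positivity)] at hq2
    nlinarith [dist_nonneg (x := q) (y := v₀ b)]
  have hd' : dist (α q y) (v₀ y) ≤ d := hdist.le.trans (min_le_left _ _)
  refine ⟨?_, hdU (hmem y hy _ hd'), hdist.trans_le (min_le_right _ _)⟩
  have h3 : F y (α q y) = f (y, α q y) := by
    simp only [hF]
    rw [clamp_of_norm_le hd.le (by rwa [← dist_eq_norm])]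
    simp
  rw [← h3]
  exact h2 y hy

end

section

/-! ### Sonic points -/

variable {γ w : ℝ}

/-- The density at a sonic point with relative velocity `w`. -/
def rho0 (γ w : ℝ) : ℝ := (4 - 3 * γ) * aF γ w / (4 * Real.pi * w)

/-- The sonic point with relative velocity `w`. -/
def ystar (γ w : ℝ) : ℝ := Real.sqrt (γ * rho0 γ w ^ (γ - 1)) / w

lemma aF_pos (hγ : γ ∈ Ioo (1 : ℝ) (4 / 3)) (w : ℝ) : 0 < aF γ w := by
  obtain ⟨h1, h2⟩ := hγ
  unfold aF
  nlinarith [sq_nonneg (4 * w + (γ - 1)), mul_pos (sub_pos.2 h1) (sub_pos.2 h2)]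

lemma rho0_pos (hγ : γ ∈ Ioo (1 : ℝ) (4 / 3)) (hw : 0 < w) : 0 < rho0 γ w := by
  have := aF_pos hγ w
  have : 0 < 4 - 3 * γ := by linarith [hγ.2]
  unfold rho0; positivity

lemma ystar_pos (hγ : γ ∈ Ioo (1 : ℝ) (4 / 3)) (hw : 0 < w) : 0 < ystar γ w := by
  have := rho0_pos hγ hw
  have : 0 < γ := by linarith [hγ.1]
  unfold ystar; positivity

lemma ystar_sq (hγ : γ ∈ Ioo (1 : ℝ) (4 / 3)) (hw : 0 < w) :
    ystar γ w ^ 2 * w ^ 2 = γ * rho0 γ w ^ (γ - 1) := by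
  have := rho0_pos hγ hw
  have : 0 < γ := by linarith [hγ.1]
  rw [ystar, div_pow, Real.sq_sqrt (by positivity)]
  field_simp

lemma h_eq (ρ om : ℝ) :
    h γ ρ om = aF γ om - 4 * Real.pi * ρ * om / (4 - 3 * γ) := by
  unfold h aF; ring

/-- The condition `h = 0` is linear in `ρ` and forces `ω > 0` because `aF` is positive; then `G = 0`
determines `y_*`. Sonic points are thus parametrized by `ω₀` alone. -/
lemma sonic_point_unique (hγ : γ ∈ Ioo (1 : ℝ) (4 / 3)) {ys ρ om : ℝ} (hys : 0 < ys) (hρ : 0 < ρ)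
    (hG : G γ ys ρ om = 0) (hh : h γ ρ om = 0) : 0 < om ∧ ρ = rho0 γ om ∧ ys = ystar γ om := by
  have hc : 0 < 4 - 3 * γ := by linarith [hγ.2]
  have ha := aF_pos hγ om
  rw [h_eq, sub_eq_zero, eq_div_iff hc.ne'] at hh
  have hom : 0 < om := by
    have : 0 < 4 * Real.pi * ρ * om := by rw [← hh]; positivity
    exact pos_of_mul_pos_right this (by positivity)
  have hρ' : ρ = rho0 γ om := by
    unfold rho0
    have := Real.pi_pos
    field_simp
    linarith
  refine ⟨hom, hρ', ?_⟩
  have h2 := ystar_sq hγ hom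
  unfold G at hG
  rw [hρ'] at hG
  have h3 : ys ^ 2 = ystar γ om ^ 2 := by
    have : om ^ 2 ≠ 0 := by positivity
    exact mul_right_cancel₀ this (by linarith)
  exact (sq_eq_sq₀ hys.le (ystar_pos hγ hom).le).1 h3

lemma h_rho0 (hγ : γ ∈ Ioo (1 : ℝ) (4 / 3)) (hw : 0 < w) : h γ (rho0 γ w) w = 0 := by
  have hc : 0 < 4 - 3 * γ := by linarith [hγ.2]
  have := Real.pi_pos
  rw [h_eq, rho0]
  field_simp
  ring

lemma G_rho0 (hγ : γ ∈ Ioo (1 : ℝ) (4 / 3)) (hw : 0 < w) :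
    G γ (ystar γ w) (rho0 γ w) w = 0 := by
  rw [G, ystar_sq hγ hw, sub_self]

/-- The square is `γ (ρ₀ / w) ^ (γ - 1) * w ^ (γ - 3)`. Both `ρ₀ / w`, a positive combination of
nonpositive powers of `w`, and `w ^ (γ - 3)` decrease. -/
lemma strictAntiOn_ystar (hγ : γ ∈ Ioo (1 : ℝ) (4 / 3)) : StrictAntiOn (ystar γ) (Ioi 0) := by
  intro v hv w hw hvw
  rw [mem_Ioi] at hv hw
  have hc : 0 < 4 - 3 * γ := by linarith [hγ.2]
  have hγ0 : 0 < γ := by linarith [hγ.1]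
  have hγ1 : 0 < γ - 1 := by linarith [hγ.1]
  have hγ2 : 0 < 2 - γ := by linarith [hγ.2]
  have hpi := Real.pi_pos
  have e : ∀ v, 0 < v → rho0 γ v / v = (4 - 3 * γ) / (4 * Real.pi) *
      (2 + (γ - 1) / v + (γ - 1) * (2 - γ) / v ^ 2) := by
    intro v hv
    unfold rho0 aF
    field_simp
  have key : ∀ v, 0 < v → ystar γ v ^ 2 = γ * ((rho0 γ v / v) ^ (γ - 1) * v ^ (γ - 3)) := by
    intro v hv
    have h := ystar_sq hγ hv
    have h1 : v ^ (γ - 3) = v ^ (γ - 1) / v ^ 2 := by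
      rw [← Real.rpow_natCast, ← Real.rpow_sub hv]; norm_num; ring_nf
    rw [Real.div_rpow (rho0_pos hγ hv).le hv.le, h1]
    have := Real.rpow_pos_of_pos hv (γ - 1)
    field_simp
    linarith
  have hlt : ystar γ w ^ 2 < ystar γ v ^ 2 := by
    rw [key v hv, key w hw]
    refine mul_lt_mul_of_pos_left ?_ hγ0
    have hrw := div_pos (rho0_pos hγ hw) hw
    refine mul_lt_mul'' ?_ ?_ (by positivity) (by positivity)
    · refine Real.rpow_lt_rpow hrw.le ?_ hγ1
      rw [e v hv, e w hw]
      gcongr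
    · exact Real.rpow_lt_rpow_of_neg hv hvw (by linarith)
  exact lt_of_pow_lt_pow_left₀ 2 (ystar_pos hγ hv).le hlt

lemma continuousOn_rho0 : ContinuousOn (rho0 γ) (Ioi 0) := by
  unfold rho0 aF
  refine ContinuousOn.div (by fun_prop) (by fun_prop) fun v hv => ?_
  have := Real.pi_pos
  rw [mem_Ioi] at hv
  positivity

lemma continuousOn_ystar (hγ : γ ∈ Ioo (1 : ℝ) (4 / 3)) : ContinuousOn (ystar γ) (Ioi 0) := by
  unfold ystar
  refine ContinuousOn.div ?_ continuousOn_id fun v hv => ne_of_gt hv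
  refine Real.continuous_sqrt.comp_continuousOn (continuousOn_const.mul ?_)
  exact continuousOn_rho0.rpow_const fun v hv => Or.inl (rho0_pos hγ hv).ne'

lemma rho0_omegaF (hγ : γ ∈ Ioo (1 : ℝ) (4 / 3)) : rho0 γ (omegaF γ) = 1 / (6 * Real.pi) := by
  have hc : 0 < 4 - 3 * γ := by linarith [hγ.2]
  have := Real.pi_pos
  unfold rho0 aF omegaF
  field_simp
  ring

lemma ystar_omegaF (hγ : γ ∈ Ioo (1 : ℝ) (4 / 3)) : ystar γ (omegaF γ) = yF γ := by
  have hc : 0 < 4 - 3 * γ := by linarith [hγ.2]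
  have := Real.pi_pos
  rw [ystar, rho0_omegaF hγ, yF, one_div, Real.inv_rpow (by positivity), omegaF, div_eq_mul_inv γ]
  field_simp

lemma rho0_far (hγ : γ ∈ Ioo (1 : ℝ) (4 / 3)) :
    rho0 γ (2 - γ) = (4 - 3 * γ) / (2 * Real.pi) := by
  have hc : 0 < 2 - γ := by linarith [hγ.2]
  have := Real.pi_pos
  unfold rho0 aF
  field_simp
  ring

lemma ystar_far (hγ : γ ∈ Ioo (1 : ℝ) (4 / 3)) : ystar γ (2 - γ) = yf γ := by
  have hc : 0 < 2 - γ := by linarith [hγ.2]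
  have hc : 0 < 4 - 3 * γ := by linarith [hγ.2]
  have := Real.pi_pos
  rw [ystar, rho0_far hγ, yf, Real.sqrt_mul (by linarith [hγ.1])]
  have h1 : Real.sqrt (((4 - 3 * γ) / (2 * Real.pi)) ^ (γ - 1))
      = ((4 - 3 * γ) / (2 * Real.pi)) ^ ((γ - 1) / 2) := by
    rw [Real.sqrt_eq_rpow, ← Real.rpow_mul (by positivity)]
    ring_nf
  rw [h1]
  ring

lemma yf_pos (hγ : γ ∈ Ioo (1 : ℝ) (4 / 3)) : 0 < yf γ := by
  rw [← ystar_far hγ]; exact ystar_pos hγ (by linarith [hγ.2])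

lemma yf_lt_yF (hγ : γ ∈ Ioo (1 : ℝ) (4 / 3)) : yf γ < yF γ := by
  rw [← ystar_far hγ, ← ystar_omegaF hγ]
  exact strictAntiOn_ystar hγ (omegaF_pos hγ) (show (0 : ℝ) < 2 - γ by linarith [hγ.2])
    omegaF_lt

lemma exists_ystar_eq (hγ : γ ∈ Ioo (1 : ℝ) (4 / 3)) {t : ℝ} (ht : t ∈ Icc (yf γ) (yF γ)) :
    ∃ v, v ∈ Icc (omegaF γ) (2 - γ) ∧ ystar γ v = t := by
  rw [← ystar_far hγ, ← ystar_omegaF hγ] at ht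
  have hsub : Icc (omegaF γ) (2 - γ) ⊆ Ioi 0 := fun v hv => (omegaF_pos hγ).trans_le hv.1
  exact intermediate_value_Icc' omegaF_lt.le ((continuousOn_ystar hγ).mono hsub) ht

open Classical in
/-- The relative velocity at the sonic point `t`. -/
def omega0 (γ t : ℝ) : ℝ :=
  if H : ∃ v, v ∈ Icc (omegaF γ) (2 - γ) ∧ ystar γ v = t then H.choose else 0

lemma omega0_spec (hγ : γ ∈ Ioo (1 : ℝ) (4 / 3)) {t : ℝ} (ht : t ∈ Icc (yf γ) (yF γ)) :
    omega0 γ t ∈ Icc (omegaF γ) (2 - γ) ∧ ystar γ (omega0 γ t) = t := by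
  have H := exists_ystar_eq hγ ht
  rw [omega0, dif_pos H]
  exact H.choose_spec

lemma omega0_pos (hγ : γ ∈ Ioo (1 : ℝ) (4 / 3)) {t : ℝ} (ht : t ∈ Icc (yf γ) (yF γ)) :
    0 < omega0 γ t := (omegaF_pos hγ).trans_le (omega0_spec hγ ht).1.1

lemma omega0_ystar (hγ : γ ∈ Ioo (1 : ℝ) (4 / 3)) {t : ℝ} (ht : t ∈ Icc (yf γ) (yF γ)) (hw : 0 < w)
    (h : ystar γ w = t) : omega0 γ t = w :=
  (strictAntiOn_ystar hγ).injOn (omega0_pos hγ ht) hw ((omega0_spec hγ ht).2.trans h.symm)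

lemma omega0_strictAntiOn (hγ : γ ∈ Ioo (1 : ℝ) (4 / 3)) :
    StrictAntiOn (omega0 γ) (Icc (yf γ) (yF γ)) := by
  intro s hs t ht hst
  by_contra hle
  have := (strictAntiOn_ystar hγ).antitoneOn (omega0_pos hγ hs) (omega0_pos hγ ht) (not_lt.1 hle)
  rw [(omega0_spec hγ hs).2, (omega0_spec hγ ht).2] at this
  exact absurd hst (not_lt.2 this)

lemma continuousOn_omega0 (hγ : γ ∈ Ioo (1 : ℝ) (4 / 3)) :
    ContinuousOn (omega0 γ) (Icc (yf γ) (yF γ)) := by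
  intro t ht
  have hw := omega0_pos hγ ht
  have hsp := (omega0_spec hγ ht).2
  have hanti := strictAntiOn_ystar hγ
  rw [ContinuousWithinAt, (nhds_basis_Ioo_pos _).tendsto_right_iff]
  intro ε hε
  set η := min ε (omega0 γ t / 2) with hη
  have hη0 : 0 < η := lt_min hε (by linarith)
  have hη1 : η ≤ ε := min_le_left _ _
  have hη2 : η ≤ omega0 γ t / 2 := min_le_right _ _
  have hm : (0 : ℝ) < omega0 γ t - η := by linarith
  have hp : (0 : ℝ) < omega0 γ t + η := by linarith
  have h1 : t < ystar γ (omega0 γ t - η) := by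
    have := hanti (mem_Ioi.2 hm) (mem_Ioi.2 hw) (by linarith)
    rwa [hsp] at this
  have h2 : ystar γ (omega0 γ t + η) < t := by
    have := hanti (mem_Ioi.2 hw) (mem_Ioi.2 hp) (by linarith)
    rwa [hsp] at this
  filter_upwards [self_mem_nhdsWithin, mem_nhdsWithin_of_mem_nhds (Ioo_mem_nhds h2 h1)] with s hs hs'
  have hs0 := omega0_pos hγ hs
  rw [← (omega0_spec hγ hs).2] at hs'
  have := (hanti.lt_iff_gt hp hs0).1 hs'.1
  have := (hanti.lt_iff_gt hs0 hm).1 hs'.2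
  constructor <;> linarith

end

section

/-! ### Conversion between the original and the logarithmic variables -/

variable {γ w : ℝ}

lemma G_exp (hγ : γ ∈ Ioo (1 : ℝ) (4 / 3)) (hw : 0 < w) (x u om : ℝ) :
    G γ (ystar γ w * Real.exp x) (rho0 γ w * Real.exp u) om = ystar γ w ^ 2 * Gn γ w x u om := by
  have h := ystar_sq hγ hw
  rw [G, Gn, Real.mul_rpow (rho0_pos hγ hw).le (Real.exp_pos _).le, ← Real.exp_mul, ← mul_assoc,
    ← h, two_mul x, Real.exp_add x x, mul_comm u]
  ring

lemma h_exp (hγ : γ ∈ Ioo (1 : ℝ) (4 / 3)) (hw : 0 < w) (u om : ℝ) :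
    w * h γ (rho0 γ w * Real.exp u) om = hn γ w u om := by
  have hc : 0 < 4 - 3 * γ := by linarith [hγ.2]
  have := Real.pi_pos
  have h1 : 4 * Real.pi * (rho0 γ w * Real.exp u) * om / (4 - 3 * γ) * w
      = aF γ w * (Real.exp u * om) := by
    rw [rho0]
    field_simp
  rw [h, hn, ← h1]
  ring

lemma continuous_G_comp (hγ : γ ∈ Ioo (1 : ℝ) (4 / 3)) {s : Set ℝ} {ρ om : ℝ → ℝ}
    (hρ : ContinuousOn ρ s) (ho : ContinuousOn om s) :
    ContinuousOn (fun y => G γ y (ρ y) (om y)) s := by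
  unfold G
  have : ContinuousOn (fun y => ρ y ^ (γ - 1)) s :=
    hρ.rpow_const fun y _ => Or.inr (by linarith [hγ.1])
  fun_prop

namespace IsLPHSolutionOn

variable {ys a : ℝ} {ρ om : ℝ → ℝ}

/-- The density equation is linear in `ρ` with a continuous coefficient in the subsonic region, so
its exponential solution formula carries positivity over from near the sonic point. -/
lemma rho_pos_of_mem (hγ : γ ∈ Ioo (1 : ℝ) (4 / 3)) (H : IsLPHSolutionOn γ ys a ρ om) {y : ℝ}
    (hy : y ∈ Ioc a ys) : 0 < ρ y := by
  rcases hy.2.eq_or_lt with rfl | hlt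
  · exact H.rho_pos
  have hyI : y ∈ Ioo a ys := ⟨hy.1, hlt⟩
  have hcρ : ContinuousOn ρ (Ioo a ys) := HasDerivAt.continuousOn H.eq_rho
  have hco : ContinuousOn om (Ioo a ys) := HasDerivAt.continuousOn H.eq_omega
  have hcG := continuous_G_comp hγ hcρ hco
  set c : ℝ → ℝ := fun y => y * h γ (ρ y) (om y) / G γ y (ρ y) (om y) with hc
  have hcc : ContinuousOn c (Ioo a ys) := by
    refine ContinuousOn.div ?_ hcG fun y hy => (H.subsonic y hy).ne'
    unfold h
    fun_prop
  have hev : ∀ᶠ z in 𝓝[<] ys, 0 < ρ z ∧ z ∈ Ioo y ys :=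
    ((H.analyticAt_rho.continuousAt.eventually (lt_mem_nhds H.rho_pos)).filter_mono
      nhdsWithin_le_nhds).and (Ioo_mem_nhdsLT hlt)
  obtain ⟨z, hz, hzI⟩ := hev.exists
  have hzI' : z ∈ Ioo a ys := ⟨hy.1.trans hzI.1, hzI.2⟩
  have hE : ∀ x ∈ Ioo a ys, HasDerivAt (fun x => ∫ s in y..x, c s) (c x) x := by
    intro x hx
    have hs : uIcc y x ⊆ Ioo a ys := (ordConnected_Ioo).uIcc_subset hyI hx
    exact intervalIntegral.integral_hasDerivAt_right ((hcc.mono hs).intervalIntegrable)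
      (hcc.stronglyMeasurableAtFilter isOpen_Ioo x hx) (hcc.continuousAt (isOpen_Ioo.mem_nhds hx))
  have hconst : ∀ x ∈ Ioo a ys,
      HasDerivAt (fun x => ρ x * Real.exp (-∫ s in y..x, c s)) 0 x := by
    intro x hx
    refine ((H.eq_rho x hx).mul (hE x hx).neg.exp).congr_deriv ?_
    simp only [hc]
    ring
  have heq := isOpen_Ioo.is_const_of_deriv_eq_zero isPreconnected_Ioo
    (fun x hx => (hconst x hx).differentiableAt.differentiableWithinAt)
    (fun x hx => (hconst x hx).deriv) hzI' hyI
  simp only [intervalIntegral.integral_same, neg_zero, Real.exp_zero, mul_one] at heq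
  rw [← heq]
  positivity

lemma sonic_unique (hγ : γ ∈ Ioo (1 : ℝ) (4 / 3)) (hys : 0 < ys)
    (H : IsLPHSolutionOn γ ys a ρ om) :
    0 < om ys ∧ ρ ys = rho0 γ (om ys) ∧ ys = ystar γ (om ys) :=
  sonic_point_unique hγ hys H.rho_pos H.sonic H.h_eq_zero

/-- In logarithmic variables, a solution of Larson-Penston-Hunter type solves the normalized
system. -/
theorem isLogLPH (hγ : γ ∈ Ioo (1 : ℝ) (4 / 3)) (hys : 0 < ys) (H : IsLPHSolutionOn γ ys a ρ om)
    (hw : om ys ∈ Icc (omegaF γ) (2 - γ)) : ∃ r > 0, IsLogLPH γ (om ys) r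
      (fun x => ys * Real.exp x * deriv ρ (ys * Real.exp x) / ρ (ys * Real.exp x))
      (fun x => Real.log (ρ (ys * Real.exp x) / ρ ys)) (fun x => om (ys * Real.exp x)) := by
  obtain ⟨hw0, hρ0, hysw⟩ := H.sonic_unique hγ hys
  set v := om ys with hv
  have hρ0pos := H.rho_pos
  have hγ0 : 0 < γ := by linarith [hγ.1]
  -- the sonic function does not vanish near the sonic point
  have hGne : ∀ᶠ y in 𝓝[≠] ys, G γ y (ρ y) (om y) ≠ 0 := by
    have hdρ := H.analyticAt_rho.differentiableAt.hasDerivAt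
    have hdo := H.analyticAt_omega.differentiableAt.hasDerivAt
    rw [H.rho_one] at hdρ
    rw [H.omega_one] at hdo
    have hd := ((hdρ.rpow_const (p := γ - 1) (Or.inl hρ0pos.ne')).const_mul γ).sub
      (((hasDerivAt_id ys).pow 2).mul (hdo.pow 2))
    have := HasDerivAt.eventually_ne (c := 0) hd ?_
    · exact this
    have hsq := ystar_sq hγ hw0
    rw [← hysw, ← hρ0] at hsq
    have hl := lam_neg hγ hw
    have h1 : ρ ys ^ (γ - 1 - 1) * ρ ys = ρ ys ^ (γ - 1) := by
      rw [Real.rpow_sub_one hρ0pos.ne']; field_simp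
    intro h0
    apply hl.ne
    simp only [id, Pi.pow_apply] at h0
    have h2 : γ * (ρ ys * R₁ γ v / ys * (γ - 1) * ρ ys ^ (γ - 1 - 1))
        = ys * v ^ 2 * (γ - 1) * R₁ γ v := by
      have : γ * (ρ ys * R₁ γ v / ys * (γ - 1) * ρ ys ^ (γ - 1 - 1))
        = (γ * (ρ ys ^ (γ - 1 - 1) * ρ ys)) * (γ - 1) * R₁ γ v / ys := by ring
      rw [this, h1, ← hsq]
      field_simp
    rw [h2] at h0
    -- The derivative of `G` along the solution at the sonic point is `ys * lam γ v`, which is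
    -- nonzero by `lam_neg`; hence the zero of `G` is isolated.
    have h3 : ys * lam γ v = 0 := by
      rw [← h0, ← hv]
      unfold lam W₁
      field_simp
      norm_num
      ring
    exact (mul_eq_zero.1 h3).resolve_left hys.ne'
  -- At `ys` itself one cannot divide by `G`; there the kinematic relation comes from the prescribed
  -- first-order coefficients.
  have hE0 : deriv om ys = (4 - 3 * γ - 3 * om ys) / ys - om ys * (deriv ρ ys / ρ ys) := by
    rw [H.omega_one, H.rho_one, W₁]
    field_simp
  have hkin : ∀ᶠ y in 𝓝 ys,
      deriv om y = (4 - 3 * γ - 3 * om y) / y - om y * (deriv ρ y / ρ y) := by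
    rw [eventually_nhdsWithin_iff] at hGne
    filter_upwards [hGne, H.eq_rho_near, H.eq_omega_near, lt_mem_nhds hys,
      H.analyticAt_rho.continuousAt.eventually (lt_mem_nhds hρ0pos)] with y h1 h2 h3 hy hρy
    rcases eq_or_ne y ys with rfl | hne
    · exact hE0
    have hG := h1 hne
    apply mul_left_cancel₀ hG
    rw [h3]
    have : om y * (G γ y (ρ y) (om y) * deriv ρ y / ρ y) = y * om y * h γ (ρ y) (om y) := by
      rw [h2]; field_simp
    rw [← this]
    ring
  have hall : ∀ᶠ y in 𝓝 ys, 0 < y ∧ 0 < ρ y ∧ AnalyticAt ℝ ρ y ∧ AnalyticAt ℝ om y ∧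
      deriv om y = (4 - 3 * γ - 3 * om y) / y - om y * (deriv ρ y / ρ y) ∧
      G γ y (ρ y) (om y) * deriv ρ y = y * ρ y * h γ (ρ y) (om y) := by
    filter_upwards [lt_mem_nhds hys, H.analyticAt_rho.continuousAt.eventually (lt_mem_nhds hρ0pos),
      H.analyticAt_rho.eventually_analyticAt, H.analyticAt_omega.eventually_analyticAt, hkin,
      H.eq_rho_near] with y h1 h2 h3 h4 h5 h6 using ⟨h1, h2, h3, h4, h5, h6⟩
  have htend : Tendsto (fun x => ys * Real.exp x) (𝓝 0) (𝓝 ys) := by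
    apply Continuous.tendsto' (by fun_prop); simp
  obtain ⟨r, hr, hall⟩ := Metric.eventually_nhds_iff.1 (htend.eventually hall)
  have hall' : ∀ x ∈ Ioo (-r) r, _ := fun x hx => @hall x (by
    rw [Real.dist_eq, sub_zero, abs_lt]; exact hx)
  have hdexp : ∀ x, HasDerivAt (fun x => ys * Real.exp x) (ys * Real.exp x) x := fun x =>
    (Real.hasDerivAt_exp x).const_mul ys
  refine ⟨r, hr, ⟨⟨?_, ?_, ?_, ?_, ?_⟩, ?_, ?_⟩⟩
  · intro x hx
    obtain ⟨h1, h2, h3, h4, h5, h6⟩ := hall' x hx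
    have c1 : ContinuousAt (fun x => ys * Real.exp x) x := by fun_prop
    have c2 : ContinuousAt (fun x => deriv ρ (ys * Real.exp x)) x :=
      ContinuousAt.comp (f := fun x => ys * Real.exp x) h3.deriv.continuousAt c1
    have c3 : ContinuousAt (fun x => ρ (ys * Real.exp x)) x :=
      ContinuousAt.comp (f := fun x => ys * Real.exp x) h3.continuousAt c1
    exact ((c1.mul c2).div c3 h2.ne').continuousWithinAt
  · simp [hρ0pos.ne']
  · simp [hv]
  · intro x hx
    obtain ⟨h1, h2, h3, h4, h5, h6⟩ := hall' x hx
    have hd := (h3.differentiableAt.hasDerivAt.comp x (hdexp x)).div_const (ρ ys)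
    have := hd.log (by simp only [Function.comp]; positivity)
    refine this.congr_deriv ?_
    simp only [Function.comp]
    field_simp
  · intro x hx
    obtain ⟨h1, h2, h3, h4, h5, h6⟩ := hall' x hx
    refine (h4.differentiableAt.hasDerivAt.comp x (hdexp x)).congr_deriv ?_
    rw [h5]
    field_simp
  · simp only [Real.exp_zero, mul_one, H.rho_one]
    field_simp
    simp [hv]
  · intro x hx
    obtain ⟨h1, h2, h3, h4, h5, h6⟩ := hall' x hx
    have e1 : rho0 γ v * Real.exp (Real.log (ρ (ys * Real.exp x) / ρ ys)) = ρ (ys * Real.exp x) := by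
      rw [Real.exp_log (by positivity), ← hρ0]
      field_simp
    have eG := G_exp hγ hw0 x (Real.log (ρ (ys * Real.exp x) / ρ ys)) (om (ys * Real.exp x))
    have eh := h_exp hγ hw0 (Real.log (ρ (ys * Real.exp x) / ρ ys)) (om (ys * Real.exp x))
    rw [e1] at eG eh
    rw [← hysw] at eG
    rw [← eh]
    have : ys ^ 2 ≠ 0 := by positivity
    apply mul_left_cancel₀ this
    have e3 : ys ^ 2 * (v * (ys * Real.exp x * deriv ρ (ys * Real.exp x) / ρ (ys * Real.exp x)) *
        Gn γ v x (Real.log (ρ (ys * Real.exp x) / ρ ys)) (om (ys * Real.exp x)))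
        = v * ys * Real.exp x / ρ (ys * Real.exp x) *
          (G γ (ys * Real.exp x) (ρ (ys * Real.exp x)) (om (ys * Real.exp x))
            * deriv ρ (ys * Real.exp x)) := by
      rw [eG]; ring
    rw [e3, h6, two_mul x, Real.exp_add]
    field_simp

end IsLPHSolutionOn

/-- A solution of the normalized system gives rise to a solution of Larson-Penston-Hunter type. -/
theorem IsLogLPH.isLPHSolutionOn (hγ : γ ∈ Ioo (1 : ℝ) (4 / 3)) (hw : 0 < w) {r : ℝ}
    {k u om : ℝ → ℝ} (H : IsLogLPH γ w r k u om) (hr : 0 < r) (hu : AnalyticAt ℝ u 0)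
    (ho : AnalyticAt ℝ om 0) (hG : ∀ x ∈ Ioo (-r) 0, 0 < Gn γ w x (u x) (om x)) :
    IsLPHSolutionOn γ (ystar γ w) (ystar γ w * Real.exp (-r))
      (fun y => rho0 γ w * Real.exp (u (Real.log (y / ystar γ w))))
      (fun y => om (Real.log (y / ystar γ w))) := by
  set t := ystar γ w with ht
  have ht0 : 0 < t := ystar_pos hγ hw
  have hρ0 := rho0_pos hγ hw
  have hlog0 : Real.log (t / t) = 0 := by rw [div_self ht0.ne', Real.log_one]
  have hlog : ∀ y, 0 < y → HasDerivAt (fun y => Real.log (y / t)) (1 / y) y := by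
    intro y hy
    refine (((hasDerivAt_id y).div_const t).log (by simp only [id]; positivity)).congr_deriv ?_
    simp only [id]
    field_simp
  have hexp : ∀ y, 0 < y → t * Real.exp (Real.log (y / t)) = y := by
    intro y hy
    rw [Real.exp_log (by positivity)]; field_simp
  have hmem : ∀ y ∈ Ioo (t * Real.exp (-r)) t, 0 < y ∧ Real.log (y / t) ∈ Ioo (-r) 0 := by
    intro y hy
    have hy0 : 0 < y := lt_trans (by positivity) hy.1
    refine ⟨hy0, ?_, ?_⟩
    · rw [Real.lt_log_iff_exp_lt (by positivity), lt_div_iff₀ ht0, mul_comm]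
      exact hy.1
    · exact Real.log_neg (by positivity) ((div_lt_one ht0).2 hy.2)
  have hanl : AnalyticAt ℝ (fun y => Real.log (y / t)) t :=
    (analyticAt_id.div analyticAt_const ht0.ne').log (by simp [ht0.ne'])
  have hnear : ∀ᶠ y in 𝓝 t, 0 < y ∧ Real.log (y / t) ∈ Ioo (-r) r := by
    refine (lt_mem_nhds ht0).and ?_
    refine hanl.continuousAt.eventually (isOpen_Ioo.mem_nhds ?_)
    simp only [hlog0]
    constructor <;> linarith
  have hderρ : ∀ y, 0 < y → Real.log (y / t) ∈ Ioo (-r) r →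
      HasDerivAt (fun y => rho0 γ w * Real.exp (u (Real.log (y / t))))
        (rho0 γ w * Real.exp (u (Real.log (y / t))) * k (Real.log (y / t)) / y) y := by
    intro y hy hl
    refine (((H.deriv_u _ hl).comp y (hlog y hy)).exp.const_mul (rho0 γ w)).congr_deriv ?_
    simp only [Function.comp]
    ring
  have hdero : ∀ y, 0 < y → Real.log (y / t) ∈ Ioo (-r) r →
      HasDerivAt (fun y => om (Real.log (y / t)))
        ((4 - 3 * γ - 3 * om (Real.log (y / t))
          - om (Real.log (y / t)) * k (Real.log (y / t))) / y) y := by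
    intro y hy hl
    refine ((H.deriv_om _ hl).comp y (hlog y hy)).congr_deriv ?_
    ring
  have heqn : ∀ y, 0 < y → Real.log (y / t) ∈ Ioo (-r) r →
      k (Real.log (y / t)) * G γ y (rho0 γ w * Real.exp (u (Real.log (y / t))))
          (om (Real.log (y / t)))
        = y ^ 2 * h γ (rho0 γ w * Real.exp (u (Real.log (y / t)))) (om (Real.log (y / t))) := by
    intro y hy hl
    have e1 := H.eqn _ hl
    have eG := G_exp hγ hw (Real.log (y / t)) (u (Real.log (y / t))) (om (Real.log (y / t)))
    rw [← ht, hexp y hy] at eG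
    rw [← h_exp hγ hw, two_mul, Real.exp_add, Real.exp_log (by positivity)] at e1
    rw [eG]
    apply mul_left_cancel₀ hw.ne'
    calc _ = t ^ 2 * (w * k (Real.log (y / t)) * Gn γ w (Real.log (y / t))
          (u (Real.log (y / t))) (om (Real.log (y / t)))) := by ring
      _ = _ := by rw [e1]; field_simp
  have hGpos : ∀ y ∈ Ioo (t * Real.exp (-r)) t, 0 < G γ y
      (rho0 γ w * Real.exp (u (Real.log (y / t)))) (om (Real.log (y / t))) := by
    intro y hy
    obtain ⟨hy0, hl⟩ := hmem y hy
    have eG := G_exp hγ hw (Real.log (y / t)) (u (Real.log (y / t))) (om (Real.log (y / t)))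
    rw [← ht, hexp y hy0] at eG
    rw [eG]
    have := hG _ hl
    positivity
  have hloc0 : Real.log (t / t) ∈ Ioo (-r) r := by rw [hlog0]; constructor <;> linarith
  refine ⟨?_, ?_, by positivity, ?_, ?_, ?_, ?_, ?_, ?_, hGpos, ?_, ?_⟩
  · exact analyticAt_const.mul (AnalyticAt.rexp (AnalyticAt.comp (g := u)
      (f := fun y => Real.log (y / t)) (by rw [hlog0]; exact hu) hanl))
  · exact AnalyticAt.comp (g := om) (f := fun y => Real.log (y / t)) (by rw [hlog0]; exact ho) hanl
  · simp only [hlog0, H.u_zero, H.om_zero, Real.exp_zero, mul_one]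
    exact G_rho0 hγ hw
  · simp only [hlog0, H.u_zero, H.om_zero, Real.exp_zero, mul_one]
    exact h_rho0 hγ hw
  · rw [(hderρ t ht0 hloc0).deriv]
    simp only [hlog0, H.k_zero, H.om_zero]
  · rw [(hdero t ht0 hloc0).deriv]
    simp only [hlog0, H.k_zero, H.om_zero, W₁]
  · filter_upwards [hnear] with y hy
    rw [(hderρ y hy.1 hy.2).deriv]
    have := heqn y hy.1 hy.2
    have hy0 := hy.1
    field_simp
    linear_combination this
  · filter_upwards [hnear] with y hy
    rw [(hdero y hy.1 hy.2).deriv]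
    have := heqn y hy.1 hy.2
    have hy0 := hy.1
    field_simp
    linear_combination (-om (Real.log (y / t))) * this
  · intro y hy
    obtain ⟨hy0, hl⟩ := hmem y hy
    have hl' : Real.log (y / t) ∈ Ioo (-r) r := ⟨hl.1, hl.2.trans hr⟩
    refine (hderρ y hy0 hl').congr_deriv ?_
    have := heqn y hy0 hl'
    have := hGpos y hy
    field_simp
    linear_combination heqn y hy0 hl'
  · intro y hy
    obtain ⟨hy0, hl⟩ := hmem y hy
    have hl' : Real.log (y / t) ∈ Ioo (-r) r := ⟨hl.1, hl.2.trans hr⟩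
    refine (hdero y hy0 hl').congr_deriv ?_
    have := heqn y hy0 hl'
    have := hGpos y hy
    field_simp
    linear_combination (-om (Real.log (y / t))) * heqn y hy0 hl'

end

section

/-! ### The maximal solution of Larson-Penston-Hunter type -/

variable {γ : ℝ}

/-- The right-hand side of the self-similar Euler-Poisson system. -/
def field (γ : ℝ) (p : ℝ × (ℝ × ℝ)) : ℝ × ℝ :=
  (p.1 * p.2.1 * h γ p.2.1 p.2.2 / G γ p.1 p.2.1 p.2.2,
    (4 - 3 * γ - 3 * p.2.2) / p.1 - p.1 * p.2.2 * h γ p.2.1 p.2.2 / G γ p.1 p.2.1 p.2.2)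

/-- The subsonic region. -/
def subsonicRegion (γ : ℝ) : Set (ℝ × (ℝ × ℝ)) :=
  {p | 0 < p.1 ∧ 0 < p.2.1 ∧ 0 < G γ p.1 p.2.1 p.2.2}

lemma isOpen_subsonicRegion (hγ : γ ∈ Ioo (1 : ℝ) (4 / 3)) : IsOpen (subsonicRegion γ) := by
  have hc : Continuous fun p : ℝ × (ℝ × ℝ) => G γ p.1 p.2.1 p.2.2 := by
    unfold G
    have : Continuous fun p : ℝ × (ℝ × ℝ) => p.2.1 ^ (γ - 1) :=
      (continuous_fst.comp continuous_snd).rpow_const fun p => Or.inr (by linarith [hγ.1])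
    fun_prop
  exact (isOpen_lt continuous_const continuous_fst).inter
    ((isOpen_lt continuous_const (continuous_fst.comp continuous_snd)).inter
      (isOpen_lt continuous_const hc))

lemma contDiffAt_field {p : ℝ × (ℝ × ℝ)} (hp : p ∈ subsonicRegion γ) :
    ContDiffAt ℝ 1 (field γ) p := by
  obtain ⟨h1, h2, h3⟩ := hp
  have hG : ContDiffAt ℝ 1 (fun p : ℝ × (ℝ × ℝ) => G γ p.1 p.2.1 p.2.2) p := by
    unfold G
    have : ContDiffAt ℝ 1 (fun p : ℝ × (ℝ × ℝ) => p.2.1 ^ (γ - 1)) p :=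
      ContDiffAt.rpow_const_of_ne (by fun_prop) h2.ne'
    fun_prop
  have hh : ContDiffAt ℝ 1 (fun p : ℝ × (ℝ × ℝ) => h γ p.2.1 p.2.2) p := by
    unfold h
    fun_prop
  unfold field
  refine ContDiffAt.prodMk ?_ (ContDiffAt.sub ?_ ?_)
  · exact ContDiffAt.div (by fun_prop) hG h3.ne'
  · exact ContDiffAt.div (by fun_prop) (by fun_prop) h1.ne'
  · exact ContDiffAt.div (by fun_prop) hG h3.ne'

namespace IsLPHSolutionOn

variable {ys a a₁ a₂ : ℝ} {ρ om ρ₁ om₁ ρ₂ om₂ : ℝ → ℝ}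

lemma hasDerivAt_pair (hγ : γ ∈ Ioo (1 : ℝ) (4 / 3)) (H : IsLPHSolutionOn γ ys a ρ om)
    (ha : 0 ≤ a) {y : ℝ} (hy : y ∈ Ioo a ys) :
    HasDerivAt (fun y => (ρ y, om y)) (field γ (y, (ρ y, om y))) y ∧
      (y, (ρ y, om y)) ∈ subsonicRegion γ :=
  ⟨(H.eq_rho y hy).prodMk (H.eq_omega y hy),
    ha.trans_lt hy.1, H.rho_pos_of_mem hγ (Ioo_subset_Ioc_self hy), H.subsonic y hy⟩

lemma omega_sonic (hγ : γ ∈ Ioo (1 : ℝ) (4 / 3)) (hys : ys ∈ Icc (yf γ) (yF γ))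
    (H : IsLPHSolutionOn γ ys a ρ om) : om ys = omega0 γ ys ∧ ρ ys = rho0 γ (omega0 γ ys) := by
  obtain ⟨h1, h2, h3⟩ := H.sonic_unique hγ ((yf_pos hγ).trans_le hys.1)
  have := omega0_ystar hγ hys h1 h3.symm
  exact ⟨this.symm, this ▸ h2⟩

lemma eventually_eq (hγ : γ ∈ Ioo (1 : ℝ) (4 / 3)) (hys : ys ∈ Icc (yf γ) (yF γ))
    (H₁ : IsLPHSolutionOn γ ys a₁ ρ₁ om₁) (H₂ : IsLPHSolutionOn γ ys a₂ ρ₂ om₂) :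
    ∀ᶠ y in 𝓝 ys, ρ₁ y = ρ₂ y ∧ om₁ y = om₂ y := by
  have hys0 := (yf_pos hγ).trans_le hys.1
  obtain ⟨e1, f1⟩ := H₁.omega_sonic hγ hys
  obtain ⟨e2, f2⟩ := H₂.omega_sonic hγ hys
  have hw := (omega0_spec hγ hys).1
  obtain ⟨r₁, hr₁, L₁⟩ := H₁.isLogLPH hγ hys0 (e1 ▸ hw)
  obtain ⟨r₂, hr₂, L₂⟩ := H₂.isLogLPH hγ hys0 (e2 ▸ hw)
  rw [e1] at L₁
  rw [e2] at L₂
  have hev := L₁.eventually_eq hγ hw hr₁ hr₂ L₂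
  have htend : Tendsto (fun y => Real.log (y / ys)) (𝓝 ys) (𝓝 0) := by
    have : ContinuousAt (fun y => Real.log (y / ys)) ys :=
      (continuousAt_id.div_const ys).log (by simp [hys0.ne'])
    simpa [ContinuousAt, div_self hys0.ne'] using this
  filter_upwards [htend.eventually hev, lt_mem_nhds hys0,
    H₁.analyticAt_rho.continuousAt.eventually (lt_mem_nhds H₁.rho_pos),
    H₂.analyticAt_rho.continuousAt.eventually (lt_mem_nhds H₂.rho_pos)] with y hy hy0 h1 h2
  have hexp : ys * Real.exp (Real.log (y / ys)) = y := by
    rw [Real.exp_log (by positivity)]; field_simp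
  rw [hexp] at hy
  have hp1 := H₁.rho_pos
  have hp2 := H₂.rho_pos
  refine ⟨?_, hy.2.2⟩
  have := Real.log_injOn_pos (show ρ₁ y / ρ₁ ys ∈ Ioi 0 from div_pos h1 hp1)
    (show ρ₂ y / ρ₂ ys ∈ Ioi 0 from div_pos h2 hp2) hy.2.1
  rw [f1, ← f2] at this
  exact (div_left_inj' hp2.ne').1 this

theorem eqOn (hγ : γ ∈ Ioo (1 : ℝ) (4 / 3)) (hys : ys ∈ Icc (yf γ) (yF γ))
    (ha₁ : 0 ≤ a₁) (ha₂ : 0 ≤ a₂) (H₁ : IsLPHSolutionOn γ ys a₁ ρ₁ om₁)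
    (H₂ : IsLPHSolutionOn γ ys a₂ ρ₂ om₂) {y : ℝ} (hy : y ∈ Ioo (max a₁ a₂) ys) :
    ρ₁ y = ρ₂ y ∧ om₁ y = om₂ y := by
  have hlt : max a₁ a₂ < ys := hy.1.trans hy.2
  have hev := ((H₁.eventually_eq hγ hys H₂).filter_mono (nhdsWithin_le_nhds (s := Iio ys))).and
    (Ioo_mem_nhdsLT hlt)
  obtain ⟨z, hz, hzI⟩ := hev.exists
  have h := eqOn_of_hasDerivAt (U := subsonicRegion γ) (f := field γ)
    (fun p hp => contDiffAt_field hp) hzI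
    (fun x hx => H₁.hasDerivAt_pair hγ ha₁ ⟨(le_max_left _ _).trans_lt hx.1, hx.2⟩)
    (fun x hx => H₂.hasDerivAt_pair hγ ha₂ ⟨(le_max_right _ _).trans_lt hx.1, hx.2⟩)
    (Prod.ext hz.1 hz.2) hy
  exact Prod.ext_iff.1 h

end IsLPHSolutionOn

lemma exists_isLPHSolutionOn (hγ : γ ∈ Ioo (1 : ℝ) (4 / 3)) {t : ℝ} (ht : t ∈ Icc (yf γ) (yF γ)) :
    ∃ a ∈ Ioo 0 t, ∃ ρ om : ℝ → ℝ, IsLPHSolutionOn γ t a ρ om := by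
  obtain ⟨hw, hwt⟩ := omega0_spec hγ ht
  have hw0 := omega0_pos hγ ht
  obtain ⟨K, U, Om, r, hr, hA, hfam⟩ := exists_isLogLPH_family hγ hw
  have hwI : omega0 γ t ∈ Ioo (omega0 γ t - r) (omega0 γ t + r) := by constructor <;> linarith
  obtain ⟨H, hG⟩ := hfam _ hwI
  obtain ⟨-, hAU, hAO⟩ := hA (0, omega0 γ t) ⟨by constructor <;> linarith, hwI⟩
  have hp : AnalyticAt ℝ (fun x : ℝ => (x, omega0 γ t)) 0 := analyticAt_id.prod analyticAt_const
  have hL := H.isLPHSolutionOn hγ hw0 hr (AnalyticAt.comp (g := U) hAU hp)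
    (AnalyticAt.comp (g := Om) hAO hp) hG
  rw [hwt] at hL
  have ht0 := (yf_pos hγ).trans_le ht.1
  refine ⟨t * Real.exp (-r), ⟨by positivity, ?_⟩, _, _, hL⟩
  exact mul_lt_of_lt_one_right ht0 (by simpa using hr)

lemma sonicTime_nonneg (γ t : ℝ) : 0 ≤ sonicTime γ t :=
  Real.sInf_nonneg fun _ ha => ha.1.1.le

lemma sonicTime_le {t a : ℝ} (ha : a ∈ Ioo 0 t) {ρ om : ℝ → ℝ} (H : IsLPHSolutionOn γ t a ρ om) :
    sonicTime γ t ≤ a :=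
  csInf_le ⟨0, fun _ hb => hb.1.1.le⟩ ⟨ha, ρ, om, H⟩

lemma sonicTime_lt (hγ : γ ∈ Ioo (1 : ℝ) (4 / 3)) {t : ℝ} (ht : t ∈ Icc (yf γ) (yF γ)) :
    sonicTime γ t < t := by
  obtain ⟨a, ha, ρ, om, H⟩ := exists_isLPHSolutionOn hγ ht
  exact (sonicTime_le ha H).trans_lt ha.2

/-- The local solutions glue to a solution on the maximal interval. -/
lemma exists_maximal (hγ : γ ∈ Ioo (1 : ℝ) (4 / 3)) {t : ℝ} (ht : t ∈ Icc (yf γ) (yF γ)) :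
    ∃ p : (ℝ → ℝ) × (ℝ → ℝ), IsLPHSolutionOn γ t (sonicTime γ t) p.1 p.2 := by
  obtain ⟨b, hb, ρ₀, om₀, H₀⟩ := exists_isLPHSolutionOn hγ ht
  have hne : {a | a ∈ Ioo 0 t ∧ ∃ ρ ω : ℝ → ℝ, IsLPHSolutionOn γ t a ρ ω}.Nonempty :=
    ⟨b, hb, ρ₀, om₀, H₀⟩
  -- The infimum defining the sonic time need not be attained, so each `y` gets its own solution
  -- reaching past `y`. The glued function takes its value at `y` from that solution, and uniqueness
  -- makes the choices compatible.
  have hex : ∀ y, ∃ a, ∃ ρ om : ℝ → ℝ, a ∈ Ioo 0 t ∧ IsLPHSolutionOn γ t a ρ om ∧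
      (y ∈ Ioo (sonicTime γ t) t → a < y) := by
    intro y
    by_cases hy : y ∈ Ioo (sonicTime γ t) t
    · obtain ⟨a, ⟨ha, ρ, om, H⟩, hay⟩ := exists_lt_of_csInf_lt hne hy.1
      exact ⟨a, ρ, om, ha, H, fun _ => hay⟩
    · exact ⟨b, ρ₀, om₀, hb, H₀, fun h => absurd h hy⟩
  choose a ρ om ha H hay using hex
  set R : ℝ → ℝ := fun y => if y < t then ρ y y else ρ₀ y with hR
  set O : ℝ → ℝ := fun y => if y < t then om y y else om₀ y with hO
  have hagree : ∀ c ∈ Ioo 0 t, ∀ ρ' om' : ℝ → ℝ, IsLPHSolutionOn γ t c ρ' om' →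
      ∀ y ∈ Ioo c t, R y = ρ' y ∧ O y = om' y := by
    intro c hc ρ' om' H' y hy
    have hyI : y ∈ Ioo (sonicTime γ t) t := ⟨(sonicTime_le hc H').trans_lt hy.1, hy.2⟩
    simp only [hR, hO, if_pos hy.2]
    exact (H y).eqOn hγ ht (ha y).1.le hc.1.le H' ⟨max_lt (hay y hyI) hy.1, hy.2⟩
  have hnear : ∀ᶠ y in 𝓝 t, R y = ρ₀ y ∧ O y = om₀ y := by
    filter_upwards [lt_mem_nhds hb.2] with y hy
    by_cases hyt : y < t
    · exact hagree b hb ρ₀ om₀ H₀ y ⟨hy, hyt⟩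
    · simp [hR, hO, hyt]
  have hRn : R =ᶠ[𝓝 t] ρ₀ := hnear.mono fun y h => h.1
  have hOn : O =ᶠ[𝓝 t] om₀ := hnear.mono fun y h => h.2
  have hRt := hRn.eq_of_nhds
  have hOt := hOn.eq_of_nhds
  have hloc : ∀ y ∈ Ioo (sonicTime γ t) t, R =ᶠ[𝓝 y] ρ y ∧ O =ᶠ[𝓝 y] om y := by
    intro y hy
    have : ∀ᶠ z in 𝓝 y, R z = ρ y z ∧ O z = om y z := by
      filter_upwards [Ioo_mem_nhds (hay y hy) hy.2] with z hz
      exact hagree (a y) (ha y) _ _ (H y) z hz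
    exact ⟨this.mono fun z h => h.1, this.mono fun z h => h.2⟩
  refine ⟨(R, O), H₀.analyticAt_rho.congr hRn.symm, H₀.analyticAt_omega.congr hOn.symm, ?_, ?_, ?_,
    ?_, ?_, ?_, ?_, fun y hy => ?_, fun y hy => ?_, fun y hy => ?_⟩
  · simpa only [hRt] using H₀.rho_pos
  · simpa only [hRt, hOt] using H₀.sonic
  · simpa only [hRt, hOt] using H₀.h_eq_zero
  · simpa only [hRt, hOt, hRn.deriv_eq] using H₀.rho_one
  · simpa only [hRt, hOt, hOn.deriv_eq] using H₀.omega_one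
  · filter_upwards [hRn, hOn, hRn.deriv, H₀.eq_rho_near] with y h1 h2 h3 h4
    simpa only [h1, h2, h3] using h4
  · filter_upwards [hRn, hOn, hOn.deriv, H₀.eq_omega_near] with y h1 h2 h3 h4
    simpa only [h1, h2, h3] using h4
  · obtain ⟨h1, h2⟩ := hloc y hy
    simpa only [h1.eq_of_nhds, h2.eq_of_nhds] using (H y).subsonic y ⟨hay y hy, hy.2⟩
  · obtain ⟨h1, h2⟩ := hloc y hy
    simp only [h1.eq_of_nhds, h2.eq_of_nhds]
    exact ((H y).eq_rho y ⟨hay y hy, hy.2⟩).congr_of_eventuallyEq h1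
  · obtain ⟨h1, h2⟩ := hloc y hy
    simp only [h1.eq_of_nhds, h2.eq_of_nhds]
    exact ((H y).eq_omega y ⟨hay y hy, hy.2⟩).congr_of_eventuallyEq h2

theorem isLPHSolutionOn_lphSolution (hγ : γ ∈ Ioo (1 : ℝ) (4 / 3)) {t : ℝ}
    (ht : t ∈ Icc (yf γ) (yF γ)) :
    IsLPHSolutionOn γ t (sonicTime γ t) (rho γ t) (omega γ t) := by
  have H := exists_maximal hγ ht
  have h : lphSolution γ t = H.choose := dif_pos H
  rw [rho, omega, h]
  exact H.choose_spec

/-- Any concrete solution computes the chosen maximal one; this gives access to `rho` and `omega`,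
which are defined by choice. -/
lemma lphSolution_eq (hγ : γ ∈ Ioo (1 : ℝ) (4 / 3)) {t a : ℝ} (ht : t ∈ Icc (yf γ) (yF γ))
    (ha : a ∈ Ioo 0 t) {ρ om : ℝ → ℝ} (H : IsLPHSolutionOn γ t a ρ om) {y : ℝ}
    (hy : y ∈ Ioc a t) : rho γ t y = ρ y ∧ omega γ t y = om y := by
  have H' := isLPHSolutionOn_lphSolution hγ ht
  rcases hy.2.eq_or_lt with rfl | hlt
  · exact (H'.eventually_eq hγ ht H).self_of_nhds
  · refine H'.eqOn hγ ht (sonicTime_nonneg _ _) ha.1.le H ⟨?_, hlt⟩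
    rw [max_eq_right (sonicTime_le ha H)]
    exact hy.1

end

section

/-! ### Degenerate critical points of the relative velocity -/

variable {γ : ℝ}

/-- The logarithmic derivative of the density with respect to `log y`. -/
def kap (γ y ρ om : ℝ) : ℝ := y ^ 2 * h γ ρ om / G γ y ρ om

/-- The derivative of the relative velocity with respect to `log y`. -/
def domega (γ y ρ om : ℝ) : ℝ := 4 - 3 * γ - 3 * om - om * kap γ y ρ om

/-- The sign of the second derivative of `kap` at a degenerate critical point of `ω`. -/
lemma degenerate_sign {y P κ om r a G₀ k₂ : ℝ} (hγ : γ ∈ Ioo (1 : ℝ) (4 / 3)) (hP : 0 < P)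
    (hG : G₀ = P - y ^ 2 * om ^ 2) (hG0 : 0 < G₀)
    (hom : om ∈ Ioo (omegaF γ) (2 - γ)) (hκ : 4 - 3 * γ - 3 * om - om * κ = 0)
    (h0 : κ * G₀ = y ^ 2 * a - r)
    (h1 : 2 * (y ^ 2 * a - r) - r * κ = κ * ((γ - 1) * P * κ - 2 * y ^ 2 * om ^ 2))
    (h2 : G₀ * k₂ = 2 * (y ^ 2 * a - r) - 3 * (r * κ) - r * κ ^ 2
      - κ * ((γ - 1) ^ 2 * P * κ ^ 2 - (γ - 1) * P * κ - 2 * y ^ 2 * om ^ 2)) : 0 < k₂ := by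
  obtain ⟨hγ1, hγ2⟩ := hγ
  obtain ⟨ho1, ho2⟩ := hom
  have hF : 0 < omegaF γ := by unfold omegaF; linarith
  have hom0 : 0 < om := hF.trans ho1
  unfold omegaF at ho1
  have hκ0 : κ < 0 := by
    have : om * κ < 0 := by linarith
    exact (pos_iff_neg_of_mul_neg this).1 hom0
  have hκ1 : 0 < (2 - γ) * κ + 2 := by
    have : 0 < om * ((2 - γ) * κ + 2) := by
      have : om * ((2 - γ) * κ + 2) = (2 - γ) * (4 - 3 * γ - 3 * om) + 2 * om := by
        linear_combination (-(2 - γ)) * hκ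
      rw [this]
      nlinarith
    exact pos_of_mul_pos_right this hom0.le
  have hr : r = (2 - (γ - 1) * κ) * P := by
    apply mul_left_cancel₀ hκ0.ne
    rw [hG] at h0
    linear_combination (-1) * h1 - 2 * h0
  have key : G₀ * k₂ = (-κ) * P * ((2 - γ) * κ + 2) * (2 - (γ - 1) * κ) := by
    rw [hr] at h1 h2
    linear_combination h2 + h1
  have hpos : 0 < G₀ * k₂ := by
    rw [key]
    have h3 : 0 < 2 - (γ - 1) * κ := by nlinarith
    have h4 : 0 < -κ := by linarith
    positivity
  exact pos_of_mul_pos_right hpos hG0.le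

/-- The first three derivatives of the relative velocity, and the sign of the third one where the
first two vanish. -/
theorem IsLPHSolutionOn.exists_derivs (hγ : γ ∈ Ioo (1 : ℝ) (4 / 3)) {ys a : ℝ} {ρ om : ℝ → ℝ}
    (H : IsLPHSolutionOn γ ys a ρ om) (ha : 0 ≤ a) :
    ∃ w₂ w₃ : ℝ → ℝ, ∀ y ∈ Ioo a ys,
      HasDerivAt om (domega γ y (ρ y) (om y) / y) y ∧
      HasDerivAt (fun y => domega γ y (ρ y) (om y) / y) (w₂ y) y ∧
      HasDerivAt w₂ (w₃ y) y ∧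
      (om y ∈ Ioo (omegaF γ) (2 - γ) → domega γ y (ρ y) (om y) = 0 → w₂ y = 0 → w₃ y < 0) := by
  have hy0 : ∀ y ∈ Ioo a ys, 0 < y := fun y hy => ha.trans_lt hy.1
  have hρp : ∀ y ∈ Ioo a ys, 0 < ρ y := fun y hy => H.rho_pos_of_mem hγ (Ioo_subset_Ioc_self hy)
  set κ : ℝ → ℝ := fun y => kap γ y (ρ y) (om y) with hκ
  set w₁ : ℝ → ℝ := fun y => domega γ y (ρ y) (om y) / y with hw₁
  set P : ℝ → ℝ := fun y => γ * ρ y ^ (γ - 1) with hP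
  set B' := 4 * Real.pi / (4 - 3 * γ) with hB'
  have hdρ : ∀ y ∈ Ioo a ys, HasDerivAt ρ (ρ y * κ y / y) y := by
    intro y hy
    refine (H.eq_rho y hy).congr_deriv ?_
    have := hy0 y hy
    have := H.subsonic y hy
    simp only [hκ, kap]
    field_simp
  have hdo : ∀ y ∈ Ioo a ys, HasDerivAt om (w₁ y) y := by
    intro y hy
    refine (H.eq_omega y hy).congr_deriv ?_
    have := hy0 y hy
    have := H.subsonic y hy
    simp only [hw₁, domega, kap]
    field_simp
  have hdP : ∀ y ∈ Ioo a ys, HasDerivAt P ((γ - 1) * P y * κ y / y) y := by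
    intro y hy
    have hp := hρp y hy
    refine (((hdρ y hy).rpow_const (p := γ - 1) (Or.inl hp.ne')).const_mul γ).congr_deriv ?_
    simp only [hP]
    rw [Real.rpow_sub_one hp.ne']
    field_simp
  set G₁ : ℝ → ℝ := fun y => (γ - 1) * P y * κ y / y - (2 * y * om y ^ 2 + y ^ 2 * (2 * om y * w₁ y))
    with hG₁
  have hdG : ∀ y ∈ Ioo a ys, HasDerivAt (fun y => G γ y (ρ y) (om y)) (G₁ y) y := by
    intro y hy
    have := (hdP y hy).sub (((hasDerivAt_id y).pow 2).mul ((hdo y hy).pow 2))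
    refine this.congr_deriv ?_
    simp [hG₁]
  set B₁ : ℝ → ℝ := fun y => 2 * y * h γ (ρ y) (om y) + y ^ 2 * ((4 * om y + (γ - 1)) * w₁ y
    - B' * (ρ y * κ y / y * om y + ρ y * w₁ y)) with hB₁
  have hdh : ∀ y ∈ Ioo a ys, HasDerivAt (fun y => h γ (ρ y) (om y))
      ((4 * om y + (γ - 1)) * w₁ y - B' * (ρ y * κ y / y * om y + ρ y * w₁ y)) y := by
    intro y hy
    have h1 := ((((hdo y hy).pow 2).const_mul 2).add ((hdo y hy).const_mul (γ - 1))).sub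
      (((hdρ y hy).mul (hdo y hy)).const_mul B')
    have h2 := h1.add_const ((γ - 1) * (2 - γ))
    have h4 : (fun y => h γ (ρ y) (om y)) = fun x =>
        (((fun y => 2 * (om ^ 2) y) + fun y => (γ - 1) * om y) - fun y => B' * (ρ * om) y) x
          + (γ - 1) * (2 - γ) := by
      funext z
      simp [h, hB']
      ring
    rw [h4]
    refine h2.congr_deriv ?_
    simp
    ring
  have hdB : ∀ y ∈ Ioo a ys, HasDerivAt (fun y => y ^ 2 * h γ (ρ y) (om y)) (B₁ y) y := by
    intro y hy
    refine (((hasDerivAt_id y).pow 2).mul (hdh y hy)).congr_deriv ?_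
    simp [hB₁]
  set κ₁ : ℝ → ℝ := fun y => (B₁ y - κ y * G₁ y) / G γ y (ρ y) (om y) with hκ₁
  have hdκ : ∀ y ∈ Ioo a ys, HasDerivAt κ (κ₁ y) y := by
    intro y hy
    have hG := (H.subsonic y hy).ne'
    refine ((hdB y hy).div (hdG y hy) hG).congr_deriv ?_
    simp only [hκ₁, hκ, kap]
    field_simp
  set w₂ : ℝ → ℝ := fun y => (-3 * w₁ y - (w₁ y * κ y + om y * κ₁ y) - w₁ y) / y with hw₂
  have hdw : ∀ y ∈ Ioo a ys, HasDerivAt w₁ (w₂ y) y := by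
    intro y hy
    have h1 := ((((hdo y hy).const_mul 3).const_sub (4 - 3 * γ)).sub
      ((hdo y hy).mul (hdκ y hy))).div (hasDerivAt_id y) (hy0 y hy).ne'
    refine h1.congr_deriv ?_
    have := hy0 y hy
    simp only [hw₂, hw₁, domega, id]
    field_simp
    simp only [Pi.sub_apply, Pi.mul_apply, hκ]
  -- derivatives of the derivatives of the numerator and the denominator of `κ`
  set G₂ : ℝ → ℝ := fun y => ((γ - 1) * (((γ - 1) * P y * κ y / y) * κ y + P y * κ₁ y) * y
      - (γ - 1) * P y * κ y) / y ^ 2 - (2 * om y ^ 2 + 2 * y * (2 * om y * w₁ y)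
      + (2 * y * (2 * om y * w₁ y) + y ^ 2 * (2 * (w₁ y * w₁ y + om y * w₂ y)))) with hG₂
  have hdG₁ : ∀ y ∈ Ioo a ys, HasDerivAt G₁ (G₂ y) y := by
    intro y hy
    have hy' := (hy0 y hy).ne'
    have h1 := (((hdP y hy).const_mul (γ - 1)).mul (hdκ y hy)).div (hasDerivAt_id y) hy'
    have h2 := ((hasDerivAt_id y).const_mul 2).mul ((hdo y hy).pow 2)
    have h3 := ((hasDerivAt_id y).pow 2).mul (((hdo y hy).const_mul 2).mul (hdw y hy))
    refine (h1.sub (h2.add h3)).congr_deriv ?_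
    simp [hG₂]
    ring
  set B₂ : ℝ → ℝ := fun y =>
      2 * h γ (ρ y) (om y) + 4 * y * ((4 * om y + (γ - 1)) * w₁ y
        - B' * (ρ y * κ y / y * om y + ρ y * w₁ y))
      + y ^ 2 * (4 * w₁ y * w₁ y + (4 * om y + (γ - 1)) * w₂ y
        - B' * (((ρ y * κ y / y * κ y + ρ y * κ₁ y) * y - ρ y * κ y) / y ^ 2 * om y
          + ρ y * κ y / y * w₁ y + (ρ y * κ y / y * w₁ y + ρ y * w₂ y))) with hB₂
  have hdB₁ : ∀ y ∈ Ioo a ys, HasDerivAt B₁ (B₂ y) y := by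
    intro y hy
    have hy' := (hy0 y hy).ne'
    have h1 := ((hasDerivAt_id y).const_mul 2).mul (hdh y hy)
    have h2 := (((hdo y hy).const_mul 4).add_const (γ - 1)).mul (hdw y hy)
    have h3 := ((((hdρ y hy).mul (hdκ y hy)).div (hasDerivAt_id y) hy').mul (hdo y hy)).add
      ((hdρ y hy).mul (hdw y hy))
    have h4 := ((hasDerivAt_id y).pow 2).mul (h2.sub (h3.const_mul B'))
    refine (h1.add h4).congr_deriv ?_
    simp [hB₂]
    ring
  set κ₂ : ℝ → ℝ := fun y => ((B₂ y - (κ₁ y * G₁ y + κ y * G₂ y)) * G γ y (ρ y) (om y)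
    - (B₁ y - κ y * G₁ y) * G₁ y) / G γ y (ρ y) (om y) ^ 2 with hκ₂
  have hdκ₁ : ∀ y ∈ Ioo a ys, HasDerivAt κ₁ (κ₂ y) y := by
    intro y hy
    exact ((hdB₁ y hy).sub ((hdκ y hy).mul (hdG₁ y hy))).div (hdG y hy) (H.subsonic y hy).ne'
  refine ⟨w₂, fun y => ((-3 * w₂ y - ((w₂ y * κ y + w₁ y * κ₁ y) + (w₁ y * κ₁ y + om y * κ₂ y))
    - w₂ y) * y - (-3 * w₁ y - (w₁ y * κ y + om y * κ₁ y) - w₁ y)) / y ^ 2, fun y hy =>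
    ⟨hdo y hy, hdw y hy, ?_, fun hom hd hw => ?_⟩⟩
  · have h1 := (((hdw y hy).const_mul (-3)).sub (((hdw y hy).mul (hdκ y hy)).add
      ((hdo y hy).mul (hdκ₁ y hy)))).sub (hdw y hy)
    refine (h1.div (hasDerivAt_id y) (hy0 y hy).ne').congr_deriv ?_
    simp
  · have hyp := hy0 y hy
    have hom0 : 0 < om y := (omegaF_pos hγ).trans hom.1
    have hw1 : w₁ y = 0 := by simp only [hw₁, hd, zero_div]
    have hk1 : κ₁ y = 0 := by
      have h1 := hw
      simp only [hw₂, hw1] at h1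
      simp only [mul_zero, zero_mul, zero_add, sub_zero, zero_sub, div_eq_zero_iff, neg_eq_zero,
        mul_eq_zero, hyp.ne', hom0.ne', false_or, or_false] at h1
      exact h1
    have hGp := H.subsonic y hy
    have hBG : B₁ y = κ y * G₁ y := by
      have h1 := hk1
      simp only [hκ₁, div_eq_zero_iff, hGp.ne', or_false] at h1
      linarith
    have hk2 : G γ y (ρ y) (om y) * κ₂ y = B₂ y - κ y * G₂ y := by
      simp only [hκ₂, hk1, hBG]
      field_simp
      ring
    have hkG : κ y * G γ y (ρ y) (om y) = y ^ 2 * h γ (ρ y) (om y) := by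
      simp only [hκ, kap]
      field_simp
    have hh : h γ (ρ y) (om y) = aF γ (om y) - B' * ρ y * om y := by
      rw [h_eq, hB']; ring
    have hPp : 0 < P y := by
      have := hρp y hy
      have : 0 < γ := by linarith [hγ.1]
      simp only [hP]; positivity
    have hpos : 0 < y ^ 2 * κ₂ y := by
      -- Here `r` is the density term of `y² h`. The remaining goals are the identity `κ G = y² h`
      -- and its first two derivatives times `y` and `y²`, taken where `ω' = ω'' = κ' = 0`.
      refine degenerate_sign (y := y) (P := P y) (κ := κ y) (om := om y)
        (r := y ^ 2 * (B' * ρ y * om y)) (a := aF γ (om y)) (G₀ := G γ y (ρ y) (om y)) hγ hPp rfl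
        hGp hom hd ?_ ?_ ?_
      · rw [hkG, hh]; ring
      · have h1 := hBG
        simp only [hB₁, hG₁, hw1, hh] at h1
        have h2 := congrArg (fun z => y * z) h1
        field_simp at h2
        linear_combination h2
      · have h1 := congrArg (fun z => y ^ 2 * z) hk2
        simp only [hB₂, hG₂, hw1, hw, hk1, hh] at h1
        field_simp at h1
        linear_combination h1
    have hk2p : 0 < κ₂ y := pos_of_mul_pos_right hpos (by positivity)
    simp only [hw1, hw, hk1]
    have : 0 < om y * κ₂ y * y := by positivity
    apply div_neg_of_neg_of_pos _ (by positivity)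
    linarith

/-- At a degenerate critical point of the relative velocity, its third derivative is negative. -/
theorem IsLPHSolutionOn.iteratedDeriv_three_neg (hγ : γ ∈ Ioo (1 : ℝ) (4 / 3)) {ys a : ℝ}
    {ρ om : ℝ → ℝ} (H : IsLPHSolutionOn γ ys a ρ om) (ha : 0 ≤ a) {y : ℝ} (hy : y ∈ Ioo a ys)
    (hom : om y ∈ Ioo (omegaF γ) (2 - γ)) (h1 : deriv om y = 0) (h2 : iteratedDeriv 2 om y = 0) :
    iteratedDeriv 3 om y < 0 := by
  obtain ⟨w₂, w₃, hw⟩ := H.exists_derivs hγ ha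
  have hI := isOpen_Ioo.mem_nhds hy
  have e1 : deriv om =ᶠ[𝓝 y] fun y => domega γ y (ρ y) (om y) / y := by
    filter_upwards [hI] with z hz using (hw z hz).1.deriv
  have e2 : iteratedDeriv 2 om =ᶠ[𝓝 y] w₂ := by
    filter_upwards [e1.eventuallyEq_nhds, hI] with z hz hzI
    rw [iteratedDeriv_succ, iteratedDeriv_one, hz.deriv_eq, (hw z hzI).2.1.deriv]
  have e3 : iteratedDeriv 3 om y = w₃ y := by
    rw [iteratedDeriv_succ, e2.deriv_eq, (hw y hy).2.2.1.deriv]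
  rw [e3]
  have hy0 : y ≠ 0 := (ha.trans_lt hy.1).ne'
  refine (hw y hy).2.2.2 hom ?_ ?_
  · rw [e1.eq_of_nhds] at h1
    exact (div_eq_zero_iff.1 h1).resolve_right hy0
  · rw [← e2.eq_of_nhds]; exact h2

/-- A nonnegative derivative of the relative velocity does not vanish in the interior. -/
theorem IsLPHSolutionOn.domega_pos_of_nonneg (hγ : γ ∈ Ioo (1 : ℝ) (4 / 3)) {ys a : ℝ}
    {ρ om : ℝ → ℝ} (H : IsLPHSolutionOn γ ys a ρ om) (ha : 0 ≤ a) {y : ℝ} (hy : y ∈ Ioo a ys)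
    (hom : om y ∈ Ioo (omegaF γ) (2 - γ))
    (hnn : ∀ᶠ z in 𝓝 y, 0 ≤ domega γ z (ρ z) (om z)) : 0 < domega γ y (ρ y) (om y) := by
  obtain ⟨w₂, w₃, hw⟩ := H.exists_derivs hγ ha
  refine hnn.self_of_nhds.lt_of_ne' fun h0 => ?_
  have hI := isOpen_Ioo.mem_nhds hy
  set f : ℝ → ℝ := fun y => domega γ y (ρ y) (om y) / y with hf
  have hf0 : f y = 0 := by simp only [hf, h0, zero_div]
  have hfn : ∀ᶠ z in 𝓝 y, 0 ≤ f z := by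
    filter_upwards [hnn, hI] with z hz hzI using div_nonneg hz (ha.trans_lt hzI.1).le
  have hmin : IsLocalMin f y := by
    filter_upwards [hfn] with z hz
    rwa [hf0]
  have hd : deriv f =ᶠ[𝓝 y] w₂ := by
    filter_upwards [hI] with z hz using (hw z hz).2.1.deriv
  have h2 : w₂ y = 0 := by rw [← hd.eq_of_nhds]; exact hmin.deriv_eq_zero
  have h3 := (hw y hy).2.2.2 hom h0 h2
  -- A point that is both a local minimum and a local maximum of `ω'` makes it locally constant,
  -- contradicting `ω''' < 0`.
  have hmax : IsLocalMax f y := by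
    refine isLocalMax_of_deriv_deriv_neg ?_ (hd.eq_of_nhds.trans h2)
      (hw y hy).2.1.continuousAt
    rw [hd.deriv_eq, (hw y hy).2.2.1.deriv]
    exact h3
  have hzero : f =ᶠ[𝓝 y] fun _ => 0 := by
    filter_upwards [hfn, hmax] with z h1 h2
    exact le_antisymm (h2.trans hf0.le) h1
  have h4 : deriv (deriv f) y = 0 := by
    rw [hzero.deriv.deriv_eq]; simp
  rw [hd.deriv_eq, (hw y hy).2.2.1.deriv] at h4
  exact h3.ne h4

end

section

/-! ### Continuous dependence on the sonic point -/

variable {γ : ℝ}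

lemma isLPH (hγ : γ ∈ Ioo (1 : ℝ) (4 / 3)) {t : ℝ} (ht : t ∈ Icc (yf γ) (yF γ)) :
    IsLPHSolutionOn γ t (sonicTime γ t) (rho γ t) (omega γ t) :=
  isLPHSolutionOn_lphSolution hγ ht

/-- The family of solutions near a sonic point, in logarithmic variables. -/
lemma exists_local_family (hγ : γ ∈ Ioo (1 : ℝ) (4 / 3)) {t₀ : ℝ} (ht₀ : t₀ ∈ Icc (yf γ) (yF γ)) :
    ∃ K U Om : ℝ × ℝ → ℝ, ∃ r > 0,
      (∀ p ∈ Ioo (-r) r ×ˢ Ioo (omega0 γ t₀ - r) (omega0 γ t₀ + r),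
        ContinuousAt K p ∧ ContinuousAt U p ∧ ContinuousAt Om p) ∧
      ∀ t ∈ Icc (yf γ) (yF γ), omega0 γ t ∈ Ioo (omega0 γ t₀ - r) (omega0 γ t₀ + r) →
        sonicTime γ t ≤ t * Real.exp (-r) ∧ ∀ x ∈ Ioc (-r) 0,
          rho γ t (t * Real.exp x) = rho0 γ (omega0 γ t) * Real.exp (U (x, omega0 γ t)) ∧
          omega γ t (t * Real.exp x) = Om (x, omega0 γ t) ∧
          t * Real.exp x * deriv (omega γ t) (t * Real.exp x)
            = 4 - 3 * γ - 3 * Om (x, omega0 γ t) - Om (x, omega0 γ t) * K (x, omega0 γ t) := by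
  obtain ⟨K, U, Om, r, hr, hA, hfam⟩ := exists_isLogLPH_family hγ (omega0_spec hγ ht₀).1
  refine ⟨K, U, Om, r, hr, fun p hp => ?_, fun t ht hw => ?_⟩
  · obtain ⟨h1, h2, h3⟩ := hA p hp
    exact ⟨h1.continuousAt, h2.continuousAt, h3.continuousAt⟩
  have ht0 := (yf_pos hγ).trans_le ht.1
  have hwt := (omega0_spec hγ ht).2
  obtain ⟨H, hG⟩ := hfam _ hw
  obtain ⟨-, hAU, hAO⟩ := hA (0, omega0 γ t) ⟨by constructor <;> linarith, hw⟩
  have hp : AnalyticAt ℝ (fun x : ℝ => (x, omega0 γ t)) 0 := analyticAt_id.prod analyticAt_const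
  have hL := H.isLPHSolutionOn hγ (omega0_pos hγ ht) hr (AnalyticAt.comp (g := U) hAU hp)
    (AnalyticAt.comp (g := Om) hAO hp) hG
  rw [hwt] at hL
  have hlt : t * Real.exp (-r) < t := mul_lt_of_lt_one_right ht0 (by simpa using hr)
  have hmem : t * Real.exp (-r) ∈ Ioo 0 t := ⟨by positivity, hlt⟩
  refine ⟨sonicTime_le hmem hL, fun x hx => ?_⟩
  have hlog : Real.log (t * Real.exp x / t) = x := by
    rw [mul_div_cancel_left₀ _ ht0.ne', Real.log_exp]
  have hy : t * Real.exp x ∈ Ioc (t * Real.exp (-r)) t :=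
    ⟨by gcongr; exact hx.1, mul_le_of_le_one_right ht0.le (by simpa using hx.2)⟩
  obtain ⟨e1, e2⟩ := lphSolution_eq hγ ht hmem hL hy
  rw [hlog] at e1 e2
  refine ⟨e1, e2, ?_⟩
  have hev : omega γ t =ᶠ[𝓝 (t * Real.exp x)] fun y => Om (Real.log (y / t), omega0 γ t) := by
    rcases hy.2.eq_or_lt with heq | hlt'
    · rw [heq]
      exact ((isLPH hγ ht).eventually_eq hγ ht hL).mono fun y h => h.2
    · filter_upwards [Ioo_mem_nhds hy.1 hlt'] with y hyI
      exact (lphSolution_eq hγ ht hmem hL (Ioo_subset_Ioc_self hyI)).2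
  have hd1 := H.deriv_om x ⟨hx.1, hx.2.trans_lt hr⟩
  have hd2 : HasDerivAt (fun y => Real.log (y / t)) (1 / (t * Real.exp x)) (t * Real.exp x) := by
    refine (((hasDerivAt_id _).div_const t).log (by positivity)).congr_deriv ?_
    field_simp
  rw [← hlog] at hd1
  have hd3 := hd1.comp (t * Real.exp x) hd2
  rw [hev.deriv_eq]
  have hd4 := hd3.deriv
  simp only [Function.comp_def] at hd4
  rw [hd4, hlog]
  field_simp

lemma mul_deriv_omega (hγ : γ ∈ Ioo (1 : ℝ) (4 / 3)) {t y : ℝ} (ht : t ∈ Icc (yf γ) (yF γ))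
    (hy : y ∈ Ioo (sonicTime γ t) t) :
    y * deriv (omega γ t) y = domega γ y (rho γ t y) (omega γ t y) := by
  have H := isLPH hγ ht
  have hy0 : 0 < y := (sonicTime_nonneg γ t).trans_lt hy.1
  have := H.subsonic y hy
  rw [(H.eq_omega y hy).deriv, domega, kap]
  field_simp

/-- Gluing a solution of the system to the left end of a solution of Larson-Penston-Hunter type. -/
lemma IsLPHSolutionOn.glue {t a b s : ℝ} {ρ om : ℝ → ℝ}
    (H : IsLPHSolutionOn γ t s ρ om) (hab : a < b) (hsb : s < b) (hbt : b < t) {v : ℝ → ℝ × ℝ}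
    (hvb : v b = (ρ b, om b))
    (hv : ∀ y ∈ Icc a b, HasDerivWithinAt v (field γ (y, v y)) (Icc a b) y ∧
      (y, v y) ∈ subsonicRegion γ) :
    ∃ ρ' om' : ℝ → ℝ, IsLPHSolutionOn γ t a ρ' om' ∧ ∀ y ∈ Ioo a b, ρ' y = (v y).1 ∧
      om' y = (v y).2 := by
  set p : ℝ → ℝ × ℝ := fun y => if y < b then v y else (ρ y, om y) with hp
  have hpl : ∀ y, y ≤ b → p y = v y := by
    intro y hy
    rcases hy.eq_or_lt with rfl | hlt
    · simp [hp, hvb]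
    · simp [hp, hlt]
  have hpr : ∀ y, b ≤ y → p y = (ρ y, om y) := fun y hy => by simp [hp, not_lt.2 hy]
  have hpair : ∀ y ∈ Ioo s t, HasDerivAt (fun y => (ρ y, om y)) (field γ (y, (ρ y, om y))) y :=
    fun y hy => (H.eq_rho y hy).prodMk (H.eq_omega y hy)
  have hderiv : ∀ y ∈ Ioo a t, HasDerivAt p (field γ (y, p y)) y := by
    intro y hy
    rcases lt_trichotomy y b with hlt | rfl | hgt
    · rw [hpl y hlt.le]
      have h1 := (hv y ⟨hy.1.le, hlt.le⟩).1.hasDerivAt (Icc_mem_nhds hy.1 hlt)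
      refine h1.congr_of_eventuallyEq ?_
      filter_upwards [gt_mem_nhds hlt] with z hz using hpl z (le_of_lt hz)
    · have h1 : HasDerivWithinAt p (field γ (y, p y)) (Iic y) y := by
        rw [hpl y le_rfl]
        have : HasDerivWithinAt v (field γ (y, v y)) (Iic y) y :=
          (hv y ⟨hab.le, le_rfl⟩).1.mono_of_mem_nhdsWithin (Icc_mem_nhdsLE hab)
        exact this.congr (fun z hz => hpl z hz) (hpl y le_rfl)
      have h2 : HasDerivWithinAt p (field γ (y, p y)) (Ici y) y := by
        rw [hpr y le_rfl]
        exact (hpair y ⟨hsb, hbt⟩).hasDerivWithinAt.congr (fun z hz => hpr z hz) (hpr y le_rfl)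
      have := h1.union h2
      rwa [Iic_union_Ici, hasDerivWithinAt_univ] at this
    · rw [hpr y hgt.le]
      refine (hpair y ⟨hsb.trans hgt, hy.2⟩).congr_of_eventuallyEq ?_
      filter_upwards [lt_mem_nhds hgt] with z hz using hpr z (le_of_lt hz)
  have hnear : p =ᶠ[𝓝 t] fun y => (ρ y, om y) := by
    filter_upwards [lt_mem_nhds hbt] with z hz using hpr z (le_of_lt hz)
  have hρ : (fun y => (p y).1) =ᶠ[𝓝 t] ρ := hnear.mono fun y h => congrArg Prod.fst h
  have ho : (fun y => (p y).2) =ᶠ[𝓝 t] om := hnear.mono fun y h => congrArg Prod.snd h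
  have hρt : (p t).1 = ρ t := hρ.eq_of_nhds
  have hot : (p t).2 = om t := ho.eq_of_nhds
  refine ⟨fun y => (p y).1, fun y => (p y).2, ⟨H.analyticAt_rho.congr hρ.symm,
    H.analyticAt_omega.congr ho.symm, ?_, ?_, ?_, ?_, ?_, ?_, ?_, fun y hy => ?_, fun y hy => ?_,
    fun y hy => ?_⟩, fun y hy => ⟨congrArg Prod.fst (hpl y hy.2.le), congrArg Prod.snd (hpl y hy.2.le)⟩⟩
  · simpa only [hρt] using H.rho_pos
  · simpa only [hρt, hot] using H.sonic
  · simpa only [hρt, hot] using H.h_eq_zero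
  · simpa only [hρt, hot, hρ.deriv_eq] using H.rho_one
  · simpa only [hρt, hot, ho.deriv_eq] using H.omega_one
  · filter_upwards [hρ, ho, hρ.deriv, H.eq_rho_near] with y h1 h2 h3 h4
    simpa only [h1, h2, h3] using h4
  · filter_upwards [hρ, ho, ho.deriv, H.eq_omega_near] with y h1 h2 h3 h4
    simpa only [h1, h2, h3] using h4
  · rcases le_or_gt y b with hle | hgt
    · rw [hpl y hle]
      exact (hv y ⟨hy.1.le, hle⟩).2.2.2
    · rw [hpr y hgt.le]
      exact H.subsonic y ⟨hsb.trans hgt, hy.2⟩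
  · exact hasFDerivAt_fst.comp_hasDerivAt y (hderiv y hy)
  · exact hasFDerivAt_snd.comp_hasDerivAt y (hderiv y hy)

/-- Locally uniform dependence on the sonic point, away from the sonic point. -/
lemma eventually_dist_lt (hγ : γ ∈ Ioo (1 : ℝ) (4 / 3)) {t₀ a y₀ : ℝ}
    (ht₀ : t₀ ∈ Icc (yf γ) (yF γ)) (ha : sonicTime γ t₀ < a) (hay : a < y₀) (hyt : y₀ < t₀) :
    ∃ b ∈ Ioo y₀ t₀, ∀ ε > 0, ∀ᶠ t in 𝓝[Icc (yf γ) (yF γ)] t₀, b < t ∧ sonicTime γ t ≤ a ∧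
      ∀ y ∈ Ioo a b, dist (rho γ t y, omega γ t y) (rho γ t₀ y, omega γ t₀ y) < ε := by
  obtain ⟨K, U, Om, r, hr, hc, hfam⟩ := exists_local_family hγ ht₀
  have ht₀0 := (yf_pos hγ).trans_le ht₀.1
  have hy₀0 : 0 < y₀ := ((sonicTime_nonneg γ t₀).trans_lt ha).trans hay
  -- The point `b` lies right of `y₀` but within the range of the local analytic family: that family
  -- controls the data at `b`, and ODE stability carries the control down to `a`.
  obtain ⟨b, hb1, hb2⟩ := exists_between (max_lt hyt
    (mul_lt_of_lt_one_right ht₀0 (by simpa using hr) : t₀ * Real.exp (-r) < t₀))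
  obtain ⟨hb1, hb3⟩ := max_lt_iff.1 hb1
  have hb0 : 0 < b := hy₀0.trans hb1
  refine ⟨b, ⟨hb1, hb2⟩, fun ε hε => ?_⟩
  have H₀ := isLPH hγ ht₀
  have hs0 := sonicTime_nonneg γ t₀
  obtain ⟨δ, hδ, hnear⟩ := exists_solution_near (isOpen_subsonicRegion hγ)
    (fun p hp => contDiffAt_field hp) (hay.trans hb1).le
    (v₀ := fun y => (rho γ t₀ y, omega γ t₀ y))
    (fun y hy => ⟨(H₀.hasDerivAt_pair hγ hs0 ⟨ha.trans_le hy.1, hy.2.trans_lt hb2⟩).1.hasDerivWithinAt,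
      (H₀.hasDerivAt_pair hγ hs0 ⟨ha.trans_le hy.1, hy.2.trans_lt hb2⟩).2⟩) hε
  -- the values at `b` depend continuously on the sonic point
  have hco := continuousOn_omega0 hγ t₀ ht₀
  have hw₀ : omega0 γ t₀ ∈ Ioo (omega0 γ t₀ - r) (omega0 γ t₀ + r) := by constructor <;> linarith
  have hlogc : ContinuousWithinAt (fun t => Real.log (b / t)) (Icc (yf γ) (yF γ)) t₀ :=
    ((continuousAt_const.div continuousAt_id ht₀0.ne').log
      (div_pos hb0 ht₀0).ne').continuousWithinAt
  have hx₀ : Real.log (b / t₀) ∈ Ioo (-r) 0 := by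
    constructor
    · rw [Real.lt_log_iff_exp_lt (by positivity), lt_div_iff₀ ht₀0, mul_comm]
      exact hb3
    · exact Real.log_neg (by positivity) ((div_lt_one ht₀0).2 hb2)
  have hpc : ContinuousWithinAt (fun t => (Real.log (b / t), omega0 γ t)) (Icc (yf γ) (yF γ)) t₀ :=
    hlogc.prodMk hco
  obtain ⟨-, cU, cO⟩ := hc (Real.log (b / t₀), omega0 γ t₀) ⟨⟨hx₀.1, hx₀.2.trans hr⟩, hw₀⟩
  have cU' : ContinuousWithinAt (fun t => U (Real.log (b / t), omega0 γ t))
      (Icc (yf γ) (yF γ)) t₀ := ContinuousAt.comp_continuousWithinAt (g := U) cU hpc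
  have cO' : ContinuousWithinAt (fun t => Om (Real.log (b / t), omega0 γ t))
      (Icc (yf γ) (yF γ)) t₀ := ContinuousAt.comp_continuousWithinAt (g := Om) cO hpc
  have cρ : ContinuousWithinAt (fun t => rho0 γ (omega0 γ t)) (Icc (yf γ) (yF γ)) t₀ :=
    ContinuousAt.comp_continuousWithinAt (g := rho0 γ)
      (continuousOn_rho0.continuousAt (isOpen_Ioi.mem_nhds (omega0_pos hγ ht₀))) hco
  have hq : ContinuousWithinAt (fun t => (rho0 γ (omega0 γ t) *
      Real.exp (U (Real.log (b / t), omega0 γ t)), Om (Real.log (b / t), omega0 γ t)))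
      (Icc (yf γ) (yF γ)) t₀ := (cρ.mul cU'.rexp).prodMk cO'
  have hval : ∀ t ∈ Icc (yf γ) (yF γ), omega0 γ t ∈ Ioo (omega0 γ t₀ - r) (omega0 γ t₀ + r) →
      Real.log (b / t) ∈ Ioo (-r) 0 → (rho γ t b, omega γ t b) = (rho0 γ (omega0 γ t) *
      Real.exp (U (Real.log (b / t), omega0 γ t)), Om (Real.log (b / t), omega0 γ t)) := by
    intro t ht hw hx
    have ht0 := (yf_pos hγ).trans_le ht.1
    obtain ⟨e1, e2, -⟩ := (hfam t ht hw).2 _ (Ioo_subset_Ioc_self hx)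
    have hexp : t * Real.exp (Real.log (b / t)) = b := by
      rw [Real.exp_log (by positivity)]; field_simp
    rw [hexp] at e1 e2
    rw [e1, e2]
  have hqnear := hq.eventually (Metric.ball_mem_nhds _ hδ)
  filter_upwards [hqnear, self_mem_nhdsWithin, hco.eventually (isOpen_Ioo.mem_nhds hw₀),
    hlogc.eventually (isOpen_Ioo.mem_nhds hx₀)] with t h1 ht hw hx
  have ht0 := (yf_pos hγ).trans_le ht.1
  simp only [← hval t ht hw hx, ← hval t₀ ht₀ hw₀ hx₀] at h1
  have hbt : b < t := by
    rw [← div_lt_one ht0]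
    by_contra hcon
    exact absurd hx.2 (not_lt.2 (Real.log_nonneg (not_lt.1 hcon)))
  obtain ⟨v, hvb, hv⟩ := hnear _ h1
  have hsb : sonicTime γ t < b := by
    refine (hfam t ht hw).1.trans_lt ?_
    have := hx.1
    rw [Real.lt_log_iff_exp_lt (by positivity), lt_div_iff₀ ht0, mul_comm] at this
    exact this
  -- The nearby ODE solution is glued on at `b`, giving an LPH-type solution reaching down to `a`;
  -- this also bounds the sonic time.
  obtain ⟨ρ', om', H', heq⟩ := (isLPH hγ ht).glue (hay.trans hb1) hsb hbt hvb
    fun y hy => ⟨(hv y hy).1, (hv y hy).2.1⟩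
  have ha' : a ∈ Ioo 0 t := ⟨hs0.trans_lt ha, (hay.trans hb1).trans hbt⟩
  refine ⟨hbt, sonicTime_le ha' H', fun y hy => ?_⟩
  obtain ⟨e1, e2⟩ := lphSolution_eq hγ ht ha' H' ⟨hy.1, (hy.2.trans hbt).le⟩
  obtain ⟨e3, e4⟩ := heq y hy
  rw [e1, e2, e3, e4]
  exact (hv y (Ioo_subset_Icc_self hy)).2.2

lemma continuousAt_domega (hγ : γ ∈ Ioo (1 : ℝ) (4 / 3)) {p : ℝ × (ℝ × ℝ)}
    (hp : p ∈ subsonicRegion γ) :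
    ContinuousAt (fun p : ℝ × (ℝ × ℝ) => domega γ p.1 p.2.1 p.2.2) p := by
  have hG : ContinuousAt (fun p : ℝ × (ℝ × ℝ) => G γ p.1 p.2.1 p.2.2) p := by
    unfold G
    have : ContinuousAt (fun p : ℝ × (ℝ × ℝ) => p.2.1 ^ (γ - 1)) p :=
      ContinuousAt.rpow_const (by fun_prop) (Or.inr (by linarith [hγ.1]))
    fun_prop
  have hk : ContinuousAt (fun p : ℝ × (ℝ × ℝ) => kap γ p.1 p.2.1 p.2.2) p := by
    unfold kap h
    exact ContinuousAt.div (by fun_prop) hG hp.2.2.ne'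
  unfold domega
  fun_prop

/-- The relative velocity and its derivative depend continuously on the sonic point and on the
independent variable, and the maximal interval depends lower semicontinuously on the sonic point. -/
theorem continuous_dependence (hγ : γ ∈ Ioo (1 : ℝ) (4 / 3)) {t₀ x₀ : ℝ}
    (ht₀ : t₀ ∈ Icc (yf γ) (yF γ)) (hx₀ : x₀ ≤ 0) (hs : sonicTime γ t₀ < t₀ * Real.exp x₀) :
    (∀ᶠ p : ℝ × ℝ in 𝓝[Iic 0 ×ˢ Icc (yf γ) (yF γ)] (x₀, t₀),
      sonicTime γ p.2 < p.2 * Real.exp p.1) ∧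
    Tendsto (fun p : ℝ × ℝ => omega γ p.2 (p.2 * Real.exp p.1))
      (𝓝[Iic 0 ×ˢ Icc (yf γ) (yF γ)] (x₀, t₀)) (𝓝 (omega γ t₀ (t₀ * Real.exp x₀))) ∧
    Tendsto (fun p : ℝ × ℝ => p.2 * Real.exp p.1 * deriv (omega γ p.2) (p.2 * Real.exp p.1))
      (𝓝[Iic 0 ×ˢ Icc (yf γ) (yF γ)] (x₀, t₀))
      (𝓝 (t₀ * Real.exp x₀ * deriv (omega γ t₀) (t₀ * Real.exp x₀))) := by
  have ht₀0 := (yf_pos hγ).trans_le ht₀.1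
  have htend1 : Tendsto (fun p : ℝ × ℝ => p.1) (𝓝[Iic 0 ×ˢ Icc (yf γ) (yF γ)] (x₀, t₀)) (𝓝 x₀) :=
    continuousAt_fst.continuousWithinAt
  have htend2 : Tendsto (fun p : ℝ × ℝ => p.2) (𝓝[Iic 0 ×ˢ Icc (yf γ) (yF γ)] (x₀, t₀))
      (𝓝[Icc (yf γ) (yF γ)] t₀) := by
    refine tendsto_nhdsWithin_iff.2 ⟨continuousAt_snd.continuousWithinAt, ?_⟩
    filter_upwards [self_mem_nhdsWithin] with p hp using hp.2
  rcases hx₀.eq_or_lt with rfl | hneg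
  · obtain ⟨K, U, Om, r, hr, hc, hfam⟩ := exists_local_family hγ ht₀
    have hw₀ : omega0 γ t₀ ∈ Ioo (omega0 γ t₀ - r) (omega0 γ t₀ + r) := by
      constructor <;> linarith
    have h0r : (0 : ℝ) ∈ Ioo (-r) r := by constructor <;> linarith
    have hco : Tendsto (fun p : ℝ × ℝ => omega0 γ p.2) (𝓝[Iic 0 ×ˢ Icc (yf γ) (yF γ)] (0, t₀))
        (𝓝 (omega0 γ t₀)) := (continuousOn_omega0 hγ t₀ ht₀).tendsto.comp htend2
    have hpc := htend1.prodMk_nhds hco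
    obtain ⟨cK, -, cO⟩ := hc (0, omega0 γ t₀) ⟨h0r, hw₀⟩
    have hev : ∀ᶠ p : ℝ × ℝ in 𝓝[Iic 0 ×ˢ Icc (yf γ) (yF γ)] (0, t₀), p.1 ∈ Ioc (-r) 0 ∧
        p.2 ∈ Icc (yf γ) (yF γ) ∧ omega0 γ p.2 ∈ Ioo (omega0 γ t₀ - r) (omega0 γ t₀ + r) := by
      filter_upwards [self_mem_nhdsWithin, htend1.eventually (lt_mem_nhds h0r.1),
        hco.eventually (isOpen_Ioo.mem_nhds hw₀)] with p hp h1 h2 using ⟨⟨h1, hp.1⟩, hp.2, h2⟩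
    obtain ⟨-, e2, e3⟩ := (hfam t₀ ht₀ hw₀).2 0 ⟨by linarith, le_rfl⟩
    refine ⟨?_, ?_, ?_⟩
    · filter_upwards [hev] with p hp
      have ht0 := (yf_pos hγ).trans_le hp.2.1.1
      refine (hfam p.2 hp.2.1 hp.2.2).1.trans_lt ?_
      gcongr
      exact hp.1.1
    · rw [e2]
      refine Tendsto.congr' ?_ (cO.tendsto.comp hpc)
      filter_upwards [hev] with p hp
      exact ((hfam p.2 hp.2.1 hp.2.2).2 p.1 hp.1).2.1.symm
    · rw [e3]
      have h1 := cO.tendsto.comp hpc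
      have h2 := (((h1.const_mul 3).const_sub (4 - 3 * γ)).sub (h1.mul (cK.tendsto.comp hpc)))
      refine Tendsto.congr' ?_ h2
      filter_upwards [hev] with p hp
      exact ((hfam p.2 hp.2.1 hp.2.2).2 p.1 hp.1).2.2.symm
  · set y₀ := t₀ * Real.exp x₀ with hy₀
    have hyt : y₀ < t₀ := mul_lt_of_lt_one_right ht₀0 (by simpa using hneg)
    obtain ⟨a, ha1, ha2⟩ := exists_between hs
    obtain ⟨b, hb, hnear⟩ := eventually_dist_lt hγ ht₀ ha1 ha2 hyt
    have hty : Tendsto (fun p : ℝ × ℝ => p.2 * Real.exp p.1)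
        (𝓝[Iic 0 ×ˢ Icc (yf γ) (yF γ)] (x₀, t₀)) (𝓝 y₀) :=
      (htend2.mono_right nhdsWithin_le_nhds).mul (htend1.rexp)
    have hyI := hty.eventually (Ioo_mem_nhds ha2 hb.1)
    have H₀ := isLPH hγ ht₀
    have hp₀ := H₀.hasDerivAt_pair hγ (sonicTime_nonneg _ _) ⟨hs, hyt⟩
    have hcv : Tendsto (fun p : ℝ × ℝ => (rho γ t₀ (p.2 * Real.exp p.1),
        omega γ t₀ (p.2 * Real.exp p.1))) (𝓝[Iic 0 ×ˢ Icc (yf γ) (yF γ)] (x₀, t₀))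
        (𝓝 (rho γ t₀ y₀, omega γ t₀ y₀)) := hp₀.1.continuousAt.tendsto.comp hty
    have hpair : Tendsto (fun p : ℝ × ℝ => (rho γ p.2 (p.2 * Real.exp p.1),
        omega γ p.2 (p.2 * Real.exp p.1))) (𝓝[Iic 0 ×ˢ Icc (yf γ) (yF γ)] (x₀, t₀))
        (𝓝 (rho γ t₀ y₀, omega γ t₀ y₀)) := by
      rw [Metric.tendsto_nhds]
      intro ε hε
      have h1 := (Metric.tendsto_nhds.1 hcv) (ε / 2) (by positivity)
      filter_upwards [h1, hyI, htend2.eventually (hnear (ε / 2) (by positivity))] with p h1 h2 h3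
      refine (dist_triangle _ (rho γ t₀ (p.2 * Real.exp p.1), omega γ t₀ (p.2 * Real.exp p.1))
        _).trans_lt ?_
      have := add_lt_add (h3.2.2 _ h2) h1
      rwa [add_halves] at this
    have hsub : ∀ᶠ p : ℝ × ℝ in 𝓝[Iic 0 ×ˢ Icc (yf γ) (yF γ)] (x₀, t₀),
        p.2 ∈ Icc (yf γ) (yF γ) ∧ p.2 * Real.exp p.1 ∈ Ioo (sonicTime γ p.2) p.2 := by
      filter_upwards [self_mem_nhdsWithin, hyI, htend2.eventually (hnear 1 one_pos)] with p hp h2 h3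
      exact ⟨hp.2, h3.2.1.trans_lt h2.1, h2.2.trans h3.1⟩
    refine ⟨hsub.mono fun p hp => hp.2.1, ?_, ?_⟩
    · exact (continuous_snd.tendsto _).comp hpair
    · rw [mul_deriv_omega hγ ht₀ ⟨hs, hyt⟩]
      have h1 := (continuousAt_domega hγ hp₀.2).tendsto.comp (hty.prodMk_nhds hpair)
      refine Tendsto.congr' ?_ h1
      filter_upwards [hsub] with p hp
      exact (mul_deriv_omega hγ hp.1 hp.2).symm

end

section

/-! ### Regularity of the relative velocity and the critical time -/

variable {γ t : ℝ}

lemma hasDerivAt_omega (hγ : γ ∈ Ioo (1 : ℝ) (4 / 3)) (ht : t ∈ Icc (yf γ) (yF γ)) {y : ℝ}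
    (hy : y ∈ Ioc (sonicTime γ t) t) : HasDerivAt (omega γ t) (deriv (omega γ t) y) y := by
  have H := isLPH hγ ht
  rcases hy.2.eq_or_lt with rfl | hlt
  · exact H.analyticAt_omega.differentiableAt.hasDerivAt
  · exact (H.eq_omega y ⟨hy.1, hlt⟩).differentiableAt.hasDerivAt

lemma continuousOn_omega (hγ : γ ∈ Ioo (1 : ℝ) (4 / 3)) (ht : t ∈ Icc (yf γ) (yF γ)) :
    ContinuousOn (omega γ t) (Ioc (sonicTime γ t) t) :=
  fun _ hy => (hasDerivAt_omega hγ ht hy).continuousAt.continuousWithinAt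

lemma continuousAt_deriv_omega (hγ : γ ∈ Ioo (1 : ℝ) (4 / 3)) (ht : t ∈ Icc (yf γ) (yF γ)) {y : ℝ}
    (hy : y ∈ Ioc (sonicTime γ t) t) : ContinuousAt (deriv (omega γ t)) y := by
  have H := isLPH hγ ht
  rcases hy.2.eq_or_lt with rfl | hlt
  · exact H.analyticAt_omega.deriv.continuousAt
  · have hI : y ∈ Ioo (sonicTime γ t) t := ⟨hy.1, hlt⟩
    have hy0 : y ≠ 0 := ((sonicTime_nonneg γ t).trans_lt hy.1).ne'
    obtain ⟨w₂, w₃, hw⟩ := H.exists_derivs hγ (sonicTime_nonneg γ t)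
    refine (hw y hI).2.1.continuousAt.congr ?_
    filter_upwards [isOpen_Ioo.mem_nhds hI] with z hz using (hw z hz).1.deriv.symm

lemma strictMonoOn_omega (hγ : γ ∈ Ioo (1 : ℝ) (4 / 3)) (ht : t ∈ Icc (yf γ) (yF γ)) {y₁ : ℝ}
    (hy₁ : sonicTime γ t < y₁) (hd : ∀ y ∈ Icc y₁ t, 0 < deriv (omega γ t) y) :
    StrictMonoOn (omega γ t) (Icc y₁ t) := by
  refine strictMonoOn_of_deriv_pos (convex_Icc _ _)
    ((continuousOn_omega hγ ht).mono fun y hy => ⟨hy₁.trans_le hy.1, hy.2⟩) fun y hy => ?_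
  rw [interior_Icc] at hy
  exact hd y (Ioo_subset_Icc_self hy)

lemma omega_self (hγ : γ ∈ Ioo (1 : ℝ) (4 / 3)) (ht : t ∈ Icc (yf γ) (yF γ)) :
    omega γ t t = omega0 γ t := ((isLPH hγ ht).omega_sonic hγ ht).1

lemma omega0_yF (hγ : γ ∈ Ioo (1 : ℝ) (4 / 3)) : omega0 γ (yF γ) = omegaF γ :=
  omega0_ystar hγ (right_mem_Icc.2 (yf_lt_yF hγ).le) (omegaF_pos hγ) (ystar_omegaF hγ)

lemma omega0_yf (hγ : γ ∈ Ioo (1 : ℝ) (4 / 3)) : omega0 γ (yf γ) = 2 - γ :=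
  omega0_ystar hγ (left_mem_Icc.2 (yf_lt_yF hγ).le) (by linarith [hγ.2]) (ystar_far hγ)

lemma omegaF_lt_omega_self (hγ : γ ∈ Ioo (1 : ℝ) (4 / 3)) (ht : t ∈ Ico (yf γ) (yF γ)) :
    omegaF γ < omega γ t t := by
  rw [omega_self hγ (Ico_subset_Icc_self ht), ← omega0_yF hγ]
  exact omega0_strictAntiOn hγ (Ico_subset_Icc_self ht) (right_mem_Icc.2 (yf_lt_yF hγ).le) ht.2

lemma omega_self_lt (hγ : γ ∈ Ioo (1 : ℝ) (4 / 3)) (ht : t ∈ Ioc (yf γ) (yF γ)) :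
    omega γ t t < 2 - γ := by
  rw [omega_self hγ (Ioc_subset_Icc_self ht), ← omega0_yf hγ]
  exact omega0_strictAntiOn hγ (left_mem_Icc.2 (yf_lt_yF hγ).le) (Ioc_subset_Icc_self ht) ht.1

lemma deriv_omega_self_pos (hγ : γ ∈ Ioo (1 : ℝ) (4 / 3)) (ht : t ∈ Ioc (yf γ) (yF γ)) :
    0 < deriv (omega γ t) t := by
  have ht' := Ioc_subset_Icc_self ht
  have hlt := omega_self_lt hγ ht
  rw [(isLPH hγ ht').omega_one]
  refine div_pos (W₁_pos hγ ⟨?_, hlt⟩) ((yf_pos hγ).trans ht.1)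
  rw [omega_self hγ ht']
  exact (omega0_spec hγ ht').1.1

lemma exists_last_crossing (hγ : γ ∈ Ioo (1 : ℝ) (4 / 3)) (ht : t ∈ Ico (yf γ) (yF γ))
    (hit : ∃ y ∈ Ioo (sonicTime γ t) t, omega γ t y = omegaF γ) :
    ∃ c ∈ Ioo (sonicTime γ t) t, omega γ t c = omegaF γ ∧ ∀ z ∈ Ioc c t, omegaF γ < omega γ t z := by
  obtain ⟨y, hy, hyF⟩ := hit
  have hco : ContinuousOn (omega γ t) (Icc y t) :=
    (continuousOn_omega hγ (Ico_subset_Icc_self ht)).mono fun z hz => ⟨hy.1.trans_le hz.1, hz.2⟩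
  have hcl : IsClosed (Icc y t ∩ omega γ t ⁻¹' {omegaF γ}) :=
    hco.preimage_isClosed_of_isClosed isClosed_Icc isClosed_singleton
  obtain ⟨c, ⟨hcI, hcF⟩, hcM⟩ := (isCompact_Icc.of_isClosed_subset hcl
    inter_subset_left).exists_isGreatest ⟨y, left_mem_Icc.2 hy.2.le, hyF⟩
  have htF := omegaF_lt_omega_self hγ ht
  have hct : c < t := hcI.2.lt_of_ne fun h => by
    rw [mem_preimage, h] at hcF
    exact htF.ne' hcF
  refine ⟨c, ⟨hy.1.trans_le hcI.1, hct⟩, hcF, fun z hz => ?_⟩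
  by_contra! hle
  have hsub : Icc z t ⊆ Icc y t := Icc_subset_Icc_left (hcI.1.trans hz.1.le)
  obtain ⟨x, hx, hxF⟩ := intermediate_value_Icc hz.2 (hco.mono hsub) ⟨hle, htF.le⟩
  exact absurd (hcM ⟨hsub hx, hxF⟩) (not_le.2 (hz.1.trans_le hx.1))

/-- No smaller point is admissible in the infimum, since its interval would contain the crossing
`c`. The critical time is therefore the last crossing. -/
lemma criticalTime_eq {c : ℝ} (hc : c ∈ Ioo (sonicTime γ t) t) (hcF : omega γ t c = omegaF γ)
    (hcp : ∀ z ∈ Ioc c t, omegaF γ < omega γ t z) : criticalTime γ t = c := by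
  have hmem : c ∈ {y | y ∈ Ioo (sonicTime γ t) t ∧ ∀ z ∈ Ioo y t, omegaF γ < omega γ t z} :=
    ⟨hc, fun z hz => hcp z (Ioo_subset_Ioc_self hz)⟩
  refine IsLeast.csInf_eq ⟨hmem, fun y hy => ?_⟩
  by_contra! hlt
  have := hy.2 c ⟨hlt, hc.2⟩
  rw [hcF] at this
  exact lt_irrefl _ this

/-! ### Transversal crossing of the Friedman value -/

/-- To the left of the sonic point, the relative velocity decreases strictly to a value below that
of the Friedman solution. -/
def CrossesMonotonically (γ t : ℝ) : Prop :=
  ∃ y₁ ∈ Ioo (sonicTime γ t) t, omega γ t y₁ < omegaF γ ∧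
    ∀ y ∈ Icc y₁ t, 0 < deriv (omega γ t) y

lemma CrossesMonotonically.exists_crossing (hγ : γ ∈ Ioo (1 : ℝ) (4 / 3))
    (ht : t ∈ Ico (yf γ) (yF γ)) (H : CrossesMonotonically γ t) :
    ∃ c ∈ Ioo (sonicTime γ t) t, omega γ t c = omegaF γ ∧
      (∀ z ∈ Ioc c t, omegaF γ < omega γ t z) ∧ ∀ y ∈ Icc c t, 0 < deriv (omega γ t) y := by
  obtain ⟨y₁, hy₁, hlt, hd⟩ := H
  have ht' := Ico_subset_Icc_self ht
  have hmono := strictMonoOn_omega hγ ht' hy₁.1 hd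
  have hco : ContinuousOn (omega γ t) (Icc y₁ t) :=
    (continuousOn_omega hγ ht').mono fun z hz => ⟨hy₁.1.trans_le hz.1, hz.2⟩
  have htF := omegaF_lt_omega_self hγ ht
  obtain ⟨c, hc, hcF⟩ := intermediate_value_Icc hy₁.2.le hco ⟨hlt.le, htF.le⟩
  have hct : c < t := hc.2.lt_of_ne fun h => by
    rw [h] at hcF
    exact htF.ne' hcF
  refine ⟨c, ⟨hy₁.1.trans_le hc.1, hct⟩, hcF, fun z hz => ?_, fun y hy => hd y ⟨hc.1.trans hy.1, hy.2⟩⟩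
  rw [← hcF]
  exact hmono hc ⟨hc.1.trans hz.1.le, hz.2⟩ hz.1

/-- A tube lemma in relative neighbourhoods: pointwise joint continuity becomes uniform over a
compact range of `x`. -/
lemma eventually_forall_mem_of_isCompact {A B K : Set ℝ} (hK : IsCompact K) (hKA : K ⊆ A)
    {Q : ℝ × ℝ → Prop} (hQ : ∀ x ∈ K, ∀ᶠ p in 𝓝[A ×ˢ B] (x, t), Q p) :
    ∀ᶠ s in 𝓝[B] t, ∀ x ∈ K, Q (x, s) := by
  rw [eventually_nhdsWithin_iff]
  have := hK.eventually_forall_of_forall_eventually (x₀ := t)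
    (P := fun s x => (x, s) ∈ A ×ˢ B → Q (x, s)) fun x hx =>
      (continuous_swap.tendsto (t, x)).eventually (eventually_nhdsWithin_iff.1 (hQ x hx))
  exact this.mono fun s hs hsB x hx => hs x hx ⟨hKA hx, hsB⟩

lemma mul_exp_mem {x x₁ : ℝ} (ht : 0 < t) (hx : x ∈ Icc x₁ 0) :
    t * Real.exp x ∈ Icc (t * Real.exp x₁) t :=
  ⟨by gcongr; exact hx.1, mul_le_of_le_one_right ht.le (by simpa using hx.2)⟩

lemma exists_mul_exp_eq {y y₁ : ℝ} (hy₁ : 0 < y₁) (hy : y ∈ Icc y₁ t) :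
    ∃ x ∈ Icc (Real.log (y₁ / t)) 0, t * Real.exp x = y := by
  have hy0 := hy₁.trans_le hy.1
  have ht0 := hy0.trans_le hy.2
  refine ⟨Real.log (y / t), ⟨Real.log_le_log (by positivity) (by gcongr; exact hy.1),
    Real.log_nonpos (by positivity) ((div_le_one ht0).2 hy.2)⟩, ?_⟩
  rw [Real.exp_log (by positivity)]
  field_simp

/-- Openness holds because all the inequalities are strict on the compact range `[x₁, 0]` of `log (y
/ t)`. In this variable the sonic point stays at `0` when `t` moves. -/
lemma CrossesMonotonically.eventually (hγ : γ ∈ Ioo (1 : ℝ) (4 / 3)) (ht : t ∈ Icc (yf γ) (yF γ))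
    (H : CrossesMonotonically γ t) :
    ∀ᶠ s in 𝓝[Icc (yf γ) (yF γ)] t, CrossesMonotonically γ s := by
  obtain ⟨y₁, hy₁, hlt, hd⟩ := H
  have ht0 := (yf_pos hγ).trans_le ht.1
  have hy₁0 := (sonicTime_nonneg γ t).trans_lt hy₁.1
  obtain ⟨x₁, hx₁, hxy⟩ := exists_mul_exp_eq hy₁0 ⟨le_rfl, hy₁.2.le⟩
  have hx₁0 : x₁ < 0 := hx₁.2.lt_of_ne fun h => by
    rw [h, Real.exp_zero, mul_one] at hxy
    exact hy₁.2.ne' hxy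
  have hs : ∀ x ∈ Icc x₁ 0, sonicTime γ t < t * Real.exp x := fun x hx =>
    hy₁.1.trans_le (hxy ▸ (mul_exp_mem ht0 hx).1)
  have hone : ∀ᶠ s in 𝓝[Icc (yf γ) (yF γ)] t, ∀ x ∈ ({x₁} : Set ℝ),
      sonicTime γ s < s * Real.exp x ∧ omega γ s (s * Real.exp x) < omegaF γ := by
    refine eventually_forall_mem_of_isCompact (Q := fun p => sonicTime γ p.2 < p.2 * Real.exp p.1 ∧
      omega γ p.2 (p.2 * Real.exp p.1) < omegaF γ) isCompact_singleton
      (singleton_subset_iff.2 (show x₁ ∈ Iic 0 from hx₁0.le)) fun x hx => ?_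
    rw [mem_singleton_iff.1 hx]
    obtain ⟨h1, h2, -⟩ := continuous_dependence hγ ht hx₁0.le (hs x₁ ⟨le_rfl, hx₁0.le⟩)
    rw [hxy] at h2
    exact h1.and (h2.eventually (gt_mem_nhds hlt))
  have hall : ∀ᶠ s in 𝓝[Icc (yf γ) (yF γ)] t, ∀ x ∈ Icc x₁ 0,
      0 < s * Real.exp x * deriv (omega γ s) (s * Real.exp x) := by
    refine eventually_forall_mem_of_isCompact
      (Q := fun p => 0 < p.2 * Real.exp p.1 * deriv (omega γ p.2) (p.2 * Real.exp p.1))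
      isCompact_Icc (fun x hx => hx.2) fun x hx => ?_
    refine (continuous_dependence hγ ht hx.2 (hs x hx)).2.2.eventually (lt_mem_nhds ?_)
    have hm := mul_exp_mem ht0 hx
    rw [hxy] at hm
    exact mul_pos (by positivity) (hd _ hm)
  filter_upwards [hone, hall, self_mem_nhdsWithin] with s h1 h2 hsI
  have hs0 := (yf_pos hγ).trans_le hsI.1
  have h1 := h1 x₁ rfl
  have hlt' : s * Real.exp x₁ < s := mul_lt_of_lt_one_right hs0 (by simpa using hx₁0)
  refine ⟨s * Real.exp x₁, ⟨h1.1, hlt'⟩, h1.2, fun y hy => ?_⟩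
  obtain ⟨x, hx, rfl⟩ := exists_mul_exp_eq (by positivity) hy
  rw [mul_div_cancel_left₀ _ hs0.ne', Real.log_exp] at hx
  exact pos_of_mul_pos_right (h2 x hx) (by positivity)

/-- Positivity of `ω'` at the crossing persists slightly to its left, where `ω` then drops strictly
below `ω_F`. The case `c = t` is allowed, as needed at `y_F`. -/
lemma crossesMonotonically_of_deriv_pos (hγ : γ ∈ Ioo (1 : ℝ) (4 / 3))
    (ht : t ∈ Icc (yf γ) (yF γ)) {c : ℝ} (hc : c ∈ Ioc (sonicTime γ t) t)
    (hcF : omega γ t c = omegaF γ) (hd : ∀ y ∈ Icc c t, 0 < deriv (omega γ t) y) :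
    CrossesMonotonically γ t := by
  have hev := (continuousAt_deriv_omega hγ ht hc).eventually
    (lt_mem_nhds (hd c (left_mem_Icc.2 hc.2)))
  obtain ⟨b, hbc, hb⟩ := mem_nhdsLT_iff_exists_Ico_subset.1 (hev.filter_mono nhdsWithin_le_nhds)
  rw [mem_Iio] at hbc
  obtain ⟨y₁, h1, h2⟩ := exists_between (max_lt hbc hc.1)
  obtain ⟨h1, h3⟩ := max_lt_iff.1 h1
  have hd' : ∀ y ∈ Icc y₁ t, 0 < deriv (omega γ t) y := by
    intro y hy
    rcases lt_or_ge y c with hlt | hge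
    · exact hb ⟨h1.le.trans hy.1, hlt⟩
    · exact hd y ⟨hge, hy.2⟩
  refine ⟨y₁, ⟨h3, h2.trans_le hc.2⟩, ?_, hd'⟩
  rw [← hcF]
  exact strictMonoOn_omega hγ ht h3 hd' ⟨le_rfl, h2.le.trans hc.2⟩ ⟨h2.le, hc.2⟩ h2

lemma crossesMonotonically_yF (hγ : γ ∈ Ioo (1 : ℝ) (4 / 3)) : CrossesMonotonically γ (yF γ) := by
  have ht : yF γ ∈ Icc (yf γ) (yF γ) := right_mem_Icc.2 (yf_lt_yF hγ).le
  refine crossesMonotonically_of_deriv_pos hγ ht ⟨sonicTime_lt hγ ht, le_rfl⟩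
    ((omega_self hγ ht).trans (omega0_yF hγ)) fun y hy => ?_
  rw [Icc_self, mem_singleton_iff] at hy
  rw [hy]
  exact deriv_omega_self_pos hγ ⟨yf_lt_yF hγ, le_rfl⟩

/-- A solution which touches the Friedman solution is the Friedman solution. -/
lemma omega_eq_omegaF (hγ : γ ∈ Ioo (1 : ℝ) (4 / 3)) (ht : t ∈ Icc (yf γ) (yF γ)) {c : ℝ}
    (hc : c ∈ Ioo (sonicTime γ t) t) (hcF : omega γ t c = omegaF γ)
    (hcd : deriv (omega γ t) c = 0) {y : ℝ} (hy : y ∈ Ioo (sonicTime γ t) t) :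
    omega γ t y = omegaF γ := by
  have H := isLPH hγ ht
  have hs := sonicTime_nonneg γ t
  have hF := omegaF_pos hγ
  have hρF := rho0_pos hγ hF
  have hhF := h_rho0 hγ hF
  have hF3 : 4 - 3 * γ - 3 * omegaF γ = 0 := by unfold omegaF; ring
  have hρc : rho γ t c = rho0 γ (omegaF γ) := by
    have h1 := mul_deriv_omega hγ ht hc
    have hG := H.subsonic c hc
    have hc0 := hs.trans_lt hc.1
    rw [hcd, domega, hcF, hF3, mul_zero, zero_sub, eq_comm, neg_eq_zero, kap, mul_eq_zero,
      div_eq_zero_iff, mul_eq_zero] at h1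
    rw [hcF] at hG
    have h2 : h γ (rho γ t c) (omegaF γ) = 0 := by
      rcases h1 with h1 | (h1 | h1) | h1
      · exact absurd h1 hF.ne'
      · exact absurd h1 (by positivity)
      · exact h1
      · exact absurd h1 hG.ne'
    rw [h_eq] at h2 hhF
    have hγ' : (4 - 3 * γ) ≠ 0 := by linarith [hγ.2]
    have hpi := Real.pi_pos
    have h3 : 4 * Real.pi * rho γ t c * omegaF γ / (4 - 3 * γ)
        = 4 * Real.pi * rho0 γ (omegaF γ) * omegaF γ / (4 - 3 * γ) := by linarith
    field_simp at h3
    exact h3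
  refine congrArg Prod.snd (eqOn_of_hasDerivAt (f := field γ) (fun p hp => contDiffAt_field hp)
    (v₁ := fun y => (rho γ t y, omega γ t y)) (v₂ := fun _ => (rho0 γ (omegaF γ), omegaF γ)) hc
    (fun y hy => H.hasDerivAt_pair hγ hs hy) (fun y hy => ⟨?_, hs.trans_lt hy.1, hρF, ?_⟩)
    (Prod.ext hρc hcF) hy)
  · simp only [field, hhF, hF3, mul_zero, zero_div, sub_zero]
    exact hasDerivAt_const _ _
  · have hG := G_rho0 hγ hF
    rw [ystar_omegaF hγ] at hG
    have hyF : y < yF γ := hy.2.trans_le ht.2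
    have hy0 := hs.trans_lt hy.1
    unfold G at hG ⊢
    have : y ^ 2 < yF γ ^ 2 := by gcongr
    have := mul_lt_mul_of_pos_right this (pow_pos hF 2)
    linarith

/-- Monotonicity of the relative velocity is inherited by the limit of the sonic points. -/
lemma deriv_omega_nonneg (hγ : γ ∈ Ioo (1 : ℝ) (4 / 3)) (ht : t ∈ Ico (yf γ) (yF γ))
    (hgood : ∀ s ∈ Ioo t (yF γ), CrossesMonotonically γ s) {c : ℝ} (hc : sonicTime γ t < c)
    (hcp : ∀ z ∈ Ioc c t, omegaF γ < omega γ t z) {y : ℝ} (hy : y ∈ Ioc c t) :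
    0 ≤ deriv (omega γ t) y := by
  have ht' := Ico_subset_Icc_self ht
  have ht0 := (yf_pos hγ).trans_le ht.1
  have hy0 := ((sonicTime_nonneg γ t).trans_lt hc).trans hy.1
  obtain ⟨x₀, hx₀, hxy⟩ := exists_mul_exp_eq hy0 ⟨le_rfl, hy.2⟩
  have hx₀0 := hx₀.2
  have hm : ∀ x ∈ Icc x₀ 0, t * Real.exp x ∈ Ioc c t := fun x hx =>
    ⟨hy.1.trans_le (hxy ▸ (mul_exp_mem ht0 hx).1), (mul_exp_mem ht0 hx).2⟩
  have hall : ∀ᶠ s in 𝓝[Icc (yf γ) (yF γ)] t, ∀ x ∈ Icc x₀ 0,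
      omegaF γ < omega γ s (s * Real.exp x) := by
    refine eventually_forall_mem_of_isCompact
      (Q := fun p => omegaF γ < omega γ p.2 (p.2 * Real.exp p.1))
      isCompact_Icc (fun x hx => hx.2) fun x hx => ?_
    exact (continuous_dependence hγ ht' hx.2 (hc.trans (hm x hx).1)).2.1.eventually
      (lt_mem_nhds (hcp _ (hm x hx)))
  have hsub : Ioo t (yF γ) ⊆ Icc (yf γ) (yF γ) := fun s hs => ⟨ht.1.trans hs.1.le, hs.2.le⟩
  have hev : ∀ᶠ s in 𝓝[Ioo t (yF γ)] t,
      0 ≤ s * Real.exp x₀ * deriv (omega γ s) (s * Real.exp x₀) := by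
    filter_upwards [hall.filter_mono (nhdsWithin_mono t hsub), self_mem_nhdsWithin] with s h1 hs
    have hs0 := ht0.trans hs.1
    obtain ⟨c', hc', hcF', -, hd'⟩ := (hgood s hs).exists_crossing hγ ⟨ht.1.trans hs.1.le, hs.2⟩
    -- For `s` close to `t` the solution stays above `ω_F` on the rescaled range, so its crossing
    -- lies to the left of it and `ω'` is positive at the point considered.
    have hlt : c' ≤ s * Real.exp x₀ := by
      by_contra! hlt
      obtain ⟨x, hx, rfl⟩ := exists_mul_exp_eq (by positivity) ⟨hlt.le, hc'.2.le⟩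
      rw [mul_div_cancel_left₀ _ hs0.ne', Real.log_exp] at hx
      exact (h1 x hx).ne' hcF'
    exact mul_nonneg (by positivity)
      (hd' _ ⟨hlt, (mul_exp_mem hs0 (left_mem_Icc.2 hx₀0)).2⟩).le
  have hne : (𝓝[Ioo t (yF γ)] t).NeBot := left_nhdsWithin_Ioo_neBot ht.2
  have htend : Tendsto (fun s => (x₀, s)) (𝓝[Ioo t (yF γ)] t)
      (𝓝[Iic 0 ×ˢ Icc (yf γ) (yF γ)] (x₀, t)) := by
    refine tendsto_nhdsWithin_iff.2 ⟨(Continuous.prodMk_right x₀).continuousAt.continuousWithinAt, ?_⟩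
    filter_upwards [self_mem_nhdsWithin] with s hs using ⟨hx₀0, hsub hs⟩
  have hlim := ((continuous_dependence hγ ht' hx₀0
    (hc.trans (hm x₀ (left_mem_Icc.2 hx₀0)).1)).2.2).comp htend
  have := ge_of_tendsto hlim hev
  rw [hxy] at this
  exact nonneg_of_mul_nonneg_right this hy0

/-- The closedness step: `ω' ≥ 0` survives the limit, and each possible zero of `ω'` between the
crossing and the sonic point is excluded by its own rigidity argument. -/
lemma crossesMonotonically_of_right (hγ : γ ∈ Ioo (1 : ℝ) (4 / 3)) (ht : t ∈ Ioo (yf γ) (yF γ))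
    (hit : ∃ y ∈ Ioo (sonicTime γ t) t, omega γ t y = omegaF γ)
    (hgood : ∀ s ∈ Ioo t (yF γ), CrossesMonotonically γ s) : CrossesMonotonically γ t := by
  have ht' := Ioo_subset_Icc_self ht
  have hto := Ioo_subset_Ico_self ht
  obtain ⟨c, hc, hcF, hcp⟩ := exists_last_crossing hγ hto hit
  have hnn := fun {y} => deriv_omega_nonneg hγ hto hgood hc.1 hcp (y := y)
  have hs := sonicTime_nonneg γ t
  have hmono : MonotoneOn (omega γ t) (Icc c t) := by
    refine monotoneOn_of_deriv_nonneg (convex_Icc _ _)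
      ((continuousOn_omega hγ ht').mono fun y hy => ⟨hc.1.trans_le hy.1, hy.2⟩) ?_ ?_ <;>
    rw [interior_Icc] <;> intro y hy
    · exact (hasDerivAt_omega hγ ht' ⟨hc.1.trans hy.1, hy.2.le⟩).differentiableAt.differentiableWithinAt
    · exact hnn (Ioo_subset_Ioc_self hy)
  have hpos : ∀ y ∈ Ioc c t, 0 < deriv (omega γ t) y := by
    intro y hy
    rcases hy.2.eq_or_lt with rfl | hlt
    · exact deriv_omega_self_pos hγ (Ioo_subset_Ioc_self ht)
    have hyI : y ∈ Ioo (sonicTime γ t) t := ⟨hc.1.trans hy.1, hlt⟩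
    have hle := hmono (Ioc_subset_Icc_self hy) (right_mem_Icc.2 hc.2.le) hy.2
    have hd := (isLPH hγ ht').domega_pos_of_nonneg hγ hs hyI
      ⟨hcp y hy, hle.trans_lt (omega_self_lt hγ (Ioo_subset_Ioc_self ht))⟩ (by
        filter_upwards [Ioo_mem_nhds hy.1 hlt] with z hz
        have hz' : z ∈ Ioo (sonicTime γ t) t := ⟨hc.1.trans hz.1, hz.2⟩
        rw [← mul_deriv_omega hγ ht' hz']
        exact mul_nonneg (hs.trans hz'.1.le) (hnn (Ioo_subset_Ioc_self hz)))
    rw [← mul_deriv_omega hγ ht' hyI] at hd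
    exact pos_of_mul_pos_right hd (hs.trans hyI.1.le)
  refine crossesMonotonically_of_deriv_pos hγ ht' (Ioo_subset_Ioc_self hc) hcF fun y hy => ?_
  rcases hy.1.eq_or_lt with rfl | hlt
  -- At the crossing, a vanishing derivative would make `ω` identically `ω_F`, although it exceeds
  -- `ω_F` immediately to the right.
  · refine lt_of_le_of_ne ?_ fun h0 => ?_
    · have hne : (𝓝[Ioo c t] c).NeBot := left_nhdsWithin_Ioo_neBot hc.2
      refine ge_of_tendsto ((continuousAt_deriv_omega hγ ht'
        (Ioo_subset_Ioc_self hc)).continuousWithinAt (s := Ioo c t)).tendsto ?_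
      filter_upwards [self_mem_nhdsWithin] with z hz using hnn (Ioo_subset_Ioc_self hz)
    · obtain ⟨z, hz⟩ := exists_between hc.2
      exact (hcp z (Ioo_subset_Ioc_self hz)).ne'
        (omega_eq_omegaF hγ ht' hc hcF h0.symm ⟨hc.1.trans hz.1, hz.2⟩)
  · exact hpos y ⟨hlt, hy.2⟩

/-- The solution with the smallest sonic point is the far-field solution. -/
lemma omega_yf (hγ : γ ∈ Ioo (1 : ℝ) (4 / 3)) {y : ℝ} (hy : y ∈ Ioo 0 (yf γ)) :
    omega γ (yf γ) y = 2 - γ := by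
  have ht : yf γ ∈ Icc (yf γ) (yF γ) := left_mem_Icc.2 (yf_lt_yF hγ).le
  have hyf := yf_pos hγ
  have hw : 0 < 2 - γ := by linarith [hγ.2]
  -- The far-field solution has constant `ω` and `k`, hence exists for all `x`; this radius is just
  -- large enough to include `log (y / y_f)`.
  set r := 1 - Real.log (y / yf γ) with hr
  have hlog : Real.log (y / yf γ) < 0 :=
    Real.log_neg (div_pos hy.1 hyf) ((div_lt_one hyf).2 hy.2)
  have hr0 : 0 < r := by linarith
  have hexp : ∀ x : ℝ, Real.exp ((γ - 1) * (-2 / (2 - γ) * x))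
      = Real.exp (2 * x) * Real.exp (-2 / (2 - γ) * x) := fun x => by
    rw [← Real.exp_add]
    congr 1
    field_simp
    ring
  have H : IsLogLPH γ (2 - γ) r (fun _ => -2 / (2 - γ)) (fun x => -2 / (2 - γ) * x)
      (fun _ => 2 - γ) := by
    refine ⟨⟨continuousOn_const, mul_zero _, rfl, fun x _ => ?_, fun x _ => ?_⟩,
      (R₁_far hγ).symm, fun x _ => ?_⟩
    · simpa using (hasDerivAt_id x).const_mul (-2 / (2 - γ))
    · refine (hasDerivAt_const x (2 - γ)).congr_deriv ?_
      field_simp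
      ring
    · have ha : aF γ (2 - γ) = 2 * (2 - γ) := by unfold aF; ring
      have hk : (2 - γ) * (-2 / (2 - γ)) = -2 := by field_simp
      rw [hk, Gn, hn, ha, hexp]
      ring
  have hL := H.isLPHSolutionOn hγ hw hr0 (analyticAt_const.mul analyticAt_id) analyticAt_const
    fun x hx => by
      rw [Gn, sub_pos, mul_comm, hexp]
      have : 1 < Real.exp (-2 / (2 - γ) * x) := by
        rw [Real.one_lt_exp_iff, div_mul_eq_mul_div]
        exact div_pos (by linarith [hx.2]) hw
      have h2 : 0 < (2 - γ) ^ 2 * Real.exp (2 * x) := by positivity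
      nlinarith
  rw [ystar_far hγ] at hL
  refine (lphSolution_eq hγ ht ⟨by positivity, mul_lt_of_lt_one_right hyf (by simpa using hr0)⟩ hL
    ⟨?_, hy.2.le⟩).2
  rw [mul_comm, ← lt_div_iff₀ hyf, ← Real.lt_log_iff_exp_lt (div_pos hy.1 hyf)]
  linarith

/-! ### The fundamental set -/

/-- Otherwise the failing parameters in `[t, y_F]` form a nonempty compact set by openness. Its
largest element is neither `y_F` nor `y_f`, and everything to its right is good, so the closedness
step contradicts its failure. -/
lemma crossesMonotonically_of_mem_Y (hγ : γ ∈ Ioo (1 : ℝ) (4 / 3)) (ht : t ∈ Y γ) :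
    CrossesMonotonically γ t := by
  by_contra hbad
  obtain ⟨ht1, ht2⟩ := ht
  set B := {s ∈ Icc t (yF γ) | ¬ CrossesMonotonically γ s} with hB
  have hsub : Icc t (yF γ) ⊆ Icc (yf γ) (yF γ) := Icc_subset_Icc_left ht1.1
  have hcl : IsClosed B := by
    rw [← isOpen_compl_iff, isOpen_iff_mem_nhds]
    intro s hs
    by_cases hsI : s ∈ Icc t (yF γ)
    · have hg : CrossesMonotonically γ s := by
        by_contra hg
        exact hs ⟨hsI, hg⟩
      filter_upwards [eventually_nhdsWithin_iff.1 (hg.eventually hγ (hsub hsI))] with z hz hzB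
      exact hzB.2 (hz (hsub hzB.1))
    · filter_upwards [isClosed_Icc.isOpen_compl.mem_nhds hsI] with z hz hzB using hz hzB.1
  obtain ⟨m, ⟨hmI, hm⟩, hmax⟩ := (isCompact_Icc.of_isClosed_subset hcl
    (fun s hs => hs.1)).exists_isGreatest ⟨t, left_mem_Icc.2 ht1.2.le, hbad⟩
  have hmF : m < yF γ := hmI.2.lt_of_ne fun h => hm (h ▸ crossesMonotonically_yF hγ)
  obtain ⟨y, hy, hyF⟩ := ht2 m ⟨hmI.1, hmF⟩
  have hmf : yf γ < m := (ht1.1.trans hmI.1).lt_of_ne fun h => by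
    rw [← h] at hy hyF
    rw [omega_yf hγ ⟨(sonicTime_nonneg _ _).trans_lt hy.1, hy.2⟩] at hyF
    exact omegaF_lt.ne' hyF
  refine hm (crossesMonotonically_of_right hγ ⟨hmf, hmF⟩ ⟨y, hy, hyF⟩ fun s hs => ?_)
  by_contra hg
  exact absurd (hmax ⟨⟨hmI.1.trans hs.1.le, hs.2.le⟩, hg⟩) (not_le.2 hs.1)

lemma mem_Y_of_le {t' : ℝ} (ht : t ∈ Y γ) (htt : t ≤ t') (ht' : t' < yF γ) : t' ∈ Y γ :=
  ⟨⟨ht.1.1.trans htt, ht'⟩, fun s hs => ht.2 s ⟨htt.trans hs.1, hs.2⟩⟩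

lemma yf_lt_of_mem_Y (hγ : γ ∈ Ioo (1 : ℝ) (4 / 3)) (ht : t ∈ Y γ) : yf γ < t := by
  refine ht.1.1.lt_of_ne fun h => ?_
  obtain ⟨y, hy, hyF⟩ := ht.2 t ⟨le_rfl, ht.1.2⟩
  rw [← h] at hy hyF
  rw [omega_yf hγ ⟨(sonicTime_nonneg _ _).trans_lt hy.1, hy.2⟩] at hyF
  exact omegaF_lt.ne' hyF

/-- The property of crossing the Friedman value monotonically propagates to the left. -/
lemma exists_mem_Y_lt (hγ : γ ∈ Ioo (1 : ℝ) (4 / 3)) (ht : t ∈ Ioc (yf γ) (yF γ))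
    (hg : CrossesMonotonically γ t) (hY : ∀ s ∈ Ico t (yF γ), s ∈ Y γ) : ∃ s ∈ Y γ, s < t := by
  have hev := hg.eventually hγ (Ioc_subset_Icc_self ht)
  obtain ⟨b, hbt, hb⟩ := mem_nhdsLT_iff_exists_Ioo_subset.1
    ((eventually_nhdsWithin_iff.1 hev).filter_mono (nhdsWithin_le_nhds (s := Iio t)))
  rw [mem_Iio] at hbt
  obtain ⟨s, hs1, hs2⟩ := exists_between (max_lt hbt ht.1)
  obtain ⟨hs1, hs3⟩ := max_lt_iff.1 hs1
  refine ⟨s, ⟨⟨hs3.le, hs2.trans_le ht.2⟩, fun z hz => ?_⟩, hs2⟩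
  rcases lt_or_ge z t with hlt | hge
  · have hzI : z ∈ Ico (yf γ) (yF γ) := ⟨hs3.le.trans hz.1, hz.2⟩
    obtain ⟨c, hc, hcF, -⟩ := (hb ⟨hs1.trans_le hz.1, hlt⟩
      (Ico_subset_Icc_self hzI)).exists_crossing hγ hzI
    exact ⟨c, hc, hcF⟩
  · exact (hY z ⟨hge, hz.2⟩).2 z ⟨le_rfl, hz.2⟩

lemma Y_nonempty (hγ : γ ∈ Ioo (1 : ℝ) (4 / 3)) : (Y γ).Nonempty := by
  obtain ⟨s, hs, -⟩ := exists_mem_Y_lt hγ ⟨yf_lt_yF hγ, le_rfl⟩ (crossesMonotonically_yF hγ)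
    fun s hs => absurd hs.2 (not_lt.2 hs.1)
  exact ⟨s, hs⟩

/-- `Y` is closed under moving right within `[y_f, y_F)` by definition. It has no least element,
because monotone crossing at a member persists slightly to the left and `y_f` itself is not a
member. -/
theorem Y_eq_Ioo (hγ : γ ∈ Ioo (1 : ℝ) (4 / 3)) : Y γ = Ioo (sInf (Y γ)) (yF γ) := by
  have hbdd : BddBelow (Y γ) := ⟨yf γ, fun s hs => hs.1.1⟩
  ext t
  refine ⟨fun ht => ⟨?_, ht.1.2⟩, fun ht => ?_⟩
  · obtain ⟨s, hs, hst⟩ := exists_mem_Y_lt hγ ⟨yf_lt_of_mem_Y hγ ht, ht.1.2.le⟩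
      (crossesMonotonically_of_mem_Y hγ ht) fun s hs => mem_Y_of_le ht hs.1 hs.2
    exact (csInf_le hbdd hs).trans_lt hst
  · obtain ⟨s, hs, hst⟩ := exists_lt_of_csInf_lt (Y_nonempty hγ) ht.1
    exact mem_Y_of_le hs hst.le ht.2

lemma criticalTime_spec (hγ : γ ∈ Ioo (1 : ℝ) (4 / 3)) (ht : t ∈ Y γ) :
    criticalTime γ t ∈ Ioo (sonicTime γ t) t ∧
      (∀ y ∈ Icc (criticalTime γ t) t, omegaF γ ≤ omega γ t y) ∧
      ∀ y ∈ Icc (criticalTime γ t) t, 0 < deriv (omega γ t) y := by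
  obtain ⟨c, hc, hcF, hcp, hd⟩ := (crossesMonotonically_of_mem_Y hγ ht).exists_crossing hγ ht.1
  rw [criticalTime_eq hc hcF hcp]
  refine ⟨hc, fun y hy => ?_, hd⟩
  rcases hy.1.eq_or_lt with rfl | hlt
  · exact hcF.ge
  · exact (hcp y ⟨hlt, hy.2⟩).le

theorem S_eq_Y (hγ : γ ∈ Ioo (1 : ℝ) (4 / 3)) : S γ = Y γ := by
  ext t
  exact ⟨fun h => h.1, fun h => ⟨h, fun s hs => (criticalTime_spec hγ (mem_Y_of_le h hs.1 hs.2)).2.2⟩⟩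

/-! ### Lower bounds for the sonic function -/

/-- The sonic function grows at least quadratically away from the sonic point. -/
theorem le_G (hγ : γ ∈ Ioo (1 : ℝ) (4 / 3)) (ht : t ∈ Y γ) {y : ℝ}
    (hy : y ∈ Icc (criticalTime γ t) t) :
    omegaF γ ^ 2 * (t ^ 2 - y ^ 2) ≤ G γ y (rho γ t y) (omega γ t y) := by
  obtain ⟨hc, hF, hd⟩ := criticalTime_spec hγ ht
  have ht' := Ico_subset_Icc_self ht.1
  have H := isLPH hγ ht'
  have hs := sonicTime_nonneg γ t
  have hγ0 : 0 < γ := by linarith [hγ.1]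
  have hγ1 : 0 < γ - 1 := by linarith [hγ.1]
  have hFp := omegaF_pos hγ
  have hcρ : ContinuousOn (rho γ t) (Ioc (sonicTime γ t) t) := by
    intro z hz
    rcases hz.2.eq_or_lt with rfl | hlt
    · exact H.analyticAt_rho.continuousAt.continuousWithinAt
    · exact (H.eq_rho z ⟨hz.1, hlt⟩).continuousAt.continuousWithinAt
  have hco := (continuous_G_comp hγ hcρ (continuousOn_omega hγ ht')).mono
    (fun z hz => ⟨hc.1.trans_le hz.1, hz.2⟩ : Icc (criticalTime γ t) t ⊆ Ioc (sonicTime γ t) t)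
  -- The derivative of `G` consists of a density term that is nonpositive when `h ≤ 0`, the term `-2
  -- z² ω ω' ≤ 0`, and `-2 z ω²`. The added quadratic is dominated by the last one since `ω ≥ ω_F`.
  set φ : ℝ → ℝ := fun z => G γ z (rho γ t z) (omega γ t z) + omegaF γ ^ 2 * z ^ 2 with hφ
  have hderiv : ∀ z ∈ Ioo (criticalTime γ t) t, ∃ d ≤ 0, HasDerivAt φ d z := by
    intro z hz
    have hzI : z ∈ Ioo (sonicTime γ t) t := ⟨hc.1.trans hz.1, hz.2⟩
    have hzc := Ioo_subset_Icc_self hz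
    have hz0 := hs.trans_lt hzI.1
    have hρ := H.rho_pos_of_mem hγ (Ioo_subset_Ioc_self hzI)
    have hG := H.subsonic z hzI
    have hdo := hd z hzc
    have hom := hF z hzc
    have hom0 := hFp.trans_le hom
    have h1 := H.eq_rho z hzI
    have h2 := (H.eq_omega z hzI).differentiableAt.hasDerivAt
    -- If `h` were positive, both terms of the equation for `ω'` would be nonpositive, contradicting
    -- `ω' > 0`.
    have hh : h γ (rho γ t z) (omega γ t z) ≤ 0 := by
      have h3 := (H.eq_omega z hzI).deriv
      have h4 : (4 - 3 * γ - 3 * omega γ t z) / z ≤ 0 := by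
        refine div_nonpos_of_nonpos_of_nonneg ?_ hz0.le
        unfold omegaF at hom
        linarith
      by_contra! hpos
      have : 0 < z * omega γ t z * h γ (rho γ t z) (omega γ t z) /
        G γ z (rho γ t z) (omega γ t z) := by positivity
      linarith
    have h5 := (((h1.rpow_const (p := γ - 1) (Or.inl hρ.ne')).const_mul γ).sub
      (((hasDerivAt_id z).pow 2).mul (h2.pow 2))).add
      (((hasDerivAt_id z).pow 2).const_mul (omegaF γ ^ 2))
    refine ⟨_, ?_, h5⟩
    have e1 : z * rho γ t z * h γ (rho γ t z) (omega γ t z) / G γ z (rho γ t z) (omega γ t z) ≤ 0 :=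
      div_nonpos_of_nonpos_of_nonneg (mul_nonpos_of_nonneg_of_nonpos (by positivity) hh) hG.le
    have e2 : γ * (z * rho γ t z * h γ (rho γ t z) (omega γ t z) /
        G γ z (rho γ t z) (omega γ t z) * (γ - 1) * rho γ t z ^ (γ - 1 - 1)) ≤ 0 :=
      mul_nonpos_of_nonneg_of_nonpos hγ0.le (mul_nonpos_of_nonpos_of_nonneg
        (mul_nonpos_of_nonpos_of_nonneg e1 hγ1.le) (by positivity))
    have e3 : omegaF γ ^ 2 ≤ omega γ t z ^ 2 := by gcongr
    have e4 := mul_le_mul_of_nonneg_left e3 hz0.le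
    have e5 : 0 ≤ z ^ 2 * (omega γ t z * deriv (omega γ t) z) := by positivity
    simp
    linarith
  have hanti : AntitoneOn φ (Icc (criticalTime γ t) t) := by
    refine antitoneOn_of_deriv_nonpos (convex_Icc _ _) (hco.add (by fun_prop)) ?_ ?_ <;>
    rw [interior_Icc] <;> intro z hz <;> obtain ⟨d, hd0, hd1⟩ := hderiv z hz
    · exact hd1.differentiableAt.differentiableWithinAt
    · rw [hd1.deriv]; exact hd0
  have := hanti hy (right_mem_Icc.2 hc.2.le) hy.2
  simp only [hφ, H.sonic] at this
  linarith

/-- Uniformity in the sonic point comes from `t² - y² = (t - y)(t + y) ≥ ν y_f`, as `t ≥ y_f` and `y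
≥ 0`. -/
theorem exists_le_G (hγ : γ ∈ Ioo (1 : ℝ) (4 / 3)) {ν : ℝ} (hν : 0 < ν) :
    ∃ η : ℝ, 0 < η ∧ ∀ t ∈ Y γ, ∀ y ∈ Icc (criticalTime γ t) (t - ν),
      η ≤ G γ y (rho γ t y) (omega γ t y) := by
  have hF := omegaF_pos hγ
  have hf := yf_pos hγ
  refine ⟨omegaF γ ^ 2 * (ν * yf γ), by positivity, fun t ht y hy => ?_⟩
  refine le_trans ?_ (le_G hγ ht ⟨hy.1, by linarith [hy.2]⟩)
  have hc := (criticalTime_spec hγ ht).1.1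
  have hy0 : 0 ≤ y := ((sonicTime_nonneg γ t).trans hc.le).trans hy.1
  have h1 := ht.1.1
  have h2 := hy.2
  gcongr
  have : ν * yf γ ≤ (t - y) * (t + y) := mul_le_mul (by linarith) (by linarith) hf.le (by linarith)
  linarith

end

end EulerPoisson

end

theorem proposition4 (γ : ℝ) (hγ : γ ∈ Set.Ioo (1 : ℝ) (4 / 3)) :
    -- `Y` is the non-empty open interval `(ȳ_*, y_F)`, where `ȳ_* = inf Y`
    ((EulerPoisson.Y γ).Nonempty ∧
      EulerPoisson.Y γ = Set.Ioo (sInf (EulerPoisson.Y γ)) (EulerPoisson.yF γ)) ∧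
    -- monotonicity of the relative velocity on `[y_c(y_*), y_*]`
    (∀ ys ∈ EulerPoisson.Y γ,
      EulerPoisson.IsLPHSolutionOn γ ys (EulerPoisson.sonicTime γ ys)
        (EulerPoisson.rho γ ys) (EulerPoisson.omega γ ys) ∧
      EulerPoisson.sonicTime γ ys < EulerPoisson.criticalTime γ ys ∧
      EulerPoisson.criticalTime γ ys < ys ∧
      (∀ y ∈ Set.Icc (EulerPoisson.criticalTime γ ys) ys,
        0 < deriv (EulerPoisson.omega γ ys) y) ∧
      StrictMonoOn (EulerPoisson.omega γ ys)
        (Set.Icc (EulerPoisson.criticalTime γ ys) ys)) ∧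
    EulerPoisson.S γ = EulerPoisson.Y γ ∧
    -- uniform lower bound on the sonic function
    (∀ ν : ℝ, 0 < ν → ∃ η : ℝ, 0 < η ∧ ∀ ys ∈ EulerPoisson.Y γ,
      ∀ y ∈ Set.Icc (EulerPoisson.criticalTime γ ys) (ys - ν),
        η ≤ EulerPoisson.G γ y (EulerPoisson.rho γ ys y) (EulerPoisson.omega γ ys y)) ∧
    -- at a degenerate critical point of `ω` the third derivative is negative
    (∀ ys ∈ Set.Icc (EulerPoisson.yf γ) (EulerPoisson.yF γ),
      ∀ y₀ ∈ Set.Ioo (EulerPoisson.sonicTime γ ys) ys,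
        EulerPoisson.omega γ ys y₀ ∈ Set.Ioo (EulerPoisson.omegaF γ) (2 - γ) →
        deriv (EulerPoisson.omega γ ys) y₀ = 0 →
        iteratedDeriv 2 (EulerPoisson.omega γ ys) y₀ = 0 →
        iteratedDeriv 3 (EulerPoisson.omega γ ys) y₀ < 0) := by
  have mem : ∀ ys ∈ EulerPoisson.Y γ, ys ∈ Set.Icc (EulerPoisson.yf γ) (EulerPoisson.yF γ) :=
    fun ys hys => Set.Ico_subset_Icc_self hys.1
  refine ⟨⟨EulerPoisson.Y_nonempty hγ, EulerPoisson.Y_eq_Ioo hγ⟩, fun ys hys => ?_,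
    EulerPoisson.S_eq_Y hγ, fun ν hν => EulerPoisson.exists_le_G hγ hν,
    fun ys hys y₀ hy₀ hom h1 h2 => (EulerPoisson.isLPH hγ hys).iteratedDeriv_three_neg hγ
      (EulerPoisson.sonicTime_nonneg γ ys) hy₀ hom h1 h2⟩
  obtain ⟨hc, -, hd⟩ := EulerPoisson.criticalTime_spec hγ hys
  exact ⟨EulerPoisson.isLPH hγ (mem ys hys), hc.1, hc.2, hd,
    EulerPoisson.strictMonoOn_omega hγ (mem ys hys) hc.1 hd⟩
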